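/- Let $L>0$, $\Omega=(0,L)$ and $\rho_1=2\ln 2+\psi(\tfrac12)-\gamma$ ($\psi=\Gamma'/\Gamma$ the digamma function, $\gamma$ the Euler–Mascheroni constant). Let $\mathbb H(\Omega)$ be the space of all $u\in L^2(\mathbb R)$ with $u=0$ a.e. in $\mathbb R\setminus\Omega$ and $\iint_{|x-y|<1}\frac{(u(x)-u(y))^2}{|x-y|}\,dx\,dy<\infty$, and let $$\mathcal E_L(u,v)=\frac12\iint_{|x-y|<1}\frac{(u(x)-u(y))(v(x)-v(y))}{|x-y|}\,dx\,dy-\iint_{|x-y|\ge 1}\frac{u(x)v(y)}{|x-y|}\,dx\,dy+\rho_1\int_{\mathbb R}uv\,dx$$ be the bilinear form of the logarithmic Laplacian $L_\Delta$ (the operator with Fourier symbol $2\ln|\xi|$). A number $\mu\in\mathbb R$ is a Dirichlet eigenvalue of $L_\Delta$ in $\Omega$ if there is $u\in\mathbb H(\Omega)\setminus\{0\}$ with $\mathcal E_L(u,v)=\mu\int_\Omega uv\,dx$ for all $v\in\mathbb H(\Omega)$; the dimension of the space of these $u$ (with $0$) is its multiplicity. For $N\in\mathbb N_0$ let $h=\frac{L}{N+1}$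 and $x_i=ih$, and let $\mathcal V_h$ be the space of functions on $\mathbb R$ that are continuous on $\Omega$, vanish in $\mathbb R\setminus\Omega$ and are affine on each $(x_i,x_{i+1})$, $0\le i\le N$ (functions that agree a.e. are identified). Let $\varphi_0,\dots,\varphi_{N+1}$ be its nodal basis: on $[0,L]$, $\varphi_i(x)=\max\{0,1-|x-x_i|/h\}$, and $\varphi_i=0$ outside $[0,L]$. Let $\mathcal A^L_h=(\mathcal E_L(\varphi_i,\varphi_j))_{i,j=0}^{N+1}$ be the stiffness matrix and $\mathcal M_h=(\int_\Omega\varphi_i\varphi_j\,dx)_{i,j=0}^{N+1}$ the mass matrix. Then the Dirichlet eigenvalues of $L_\Delta$ in $\Omega$, each repeated according to its (finite) multiplicity, form a sequence $\lambda_1\le\lambda_2\le\cdots$. For $1\le k\le N+2$ the number $$\lambda_{k,h}:=\inf_{\substack{M_h\subset\mathcal V_h\\ \dim M_h=k}}\ \max_{\substack{u_h\in M_h\\ \|u_h\|_{L^2(\Omega)}=1}}\mathcal E_L(u_h,u_h)$$ is well defined (the maxima exist and the infimum is finite), and for every $k\ge1$ $$\lambda_{k,h}\to\lambda_k\qquad\text{as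 } h=\tfrac{L}{N+1}\to0 .$$ Moreover, $\lambda_{k,h}$ is the $k$-th eigenvalue of $\mathcal A^L_h$ relative to $\mathcal M_h$: $\mathcal M_h$ is positive definite, and $\lambda_{1,h}\le\dots\le\lambda_{N+2,h}$ are the roots, with multiplicity, of $t\mapsto\det(t\mathcal M_h-\mathcal A^L_h)$. -/

import Mathlib

open MeasureTheory Filter Topology Set

namespace LogLap

noncomputable section

/-- The constant `ρ₁ = 2 ln 2 + ψ(1/2) - γ`, where `ψ = Γ'/Γ` is the digamma function and `γ` is the
Euler-Mascheroni constant. -/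
def rho₁ : ℝ :=
  2 * Real.log 2 + logDeriv Real.Gamma (1 / 2) - Real.eulerMascheroniConstant

/-- The pairs of points at distance less than one. -/
def nearPairs : Set (ℝ × ℝ) := {p | |p.1 - p.2| < 1}

/-- The pairs of points at distance at least one. -/
def farPairs : Set (ℝ × ℝ) := {p | 1 ≤ |p.1 - p.2|}

/-- `ℰ(u,v) = (1/2) ∬_{|x-y|<1} (u(x)-u(y))(v(x)-v(y)) / |x-y| dx dy`. -/
def energy (u v : ℝ → ℝ) : ℝ :=
  (1 / 2) * ∫ p in nearPairs, (u p.1 - u p.2) * (v p.1 - v p.2) / |p.1 - p.2|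

/-- `B(u,v) = - ∬_{|x-y|≥1} u(x) v(y) / |x-y| dx dy + ρ₁ ∫ u v`. -/
def lowerOrder (u v : ℝ → ℝ) : ℝ :=
  -(∫ p in farPairs, u p.1 * v p.2 / |p.1 - p.2|) + rho₁ * ∫ x, u x * v x

/-- The bilinear form `ℰ_L = ℰ + B` of the logarithmic Laplacian. -/
def energyL (u v : ℝ → ℝ) : ℝ := energy u v + lowerOrder u v

/-! ### The energy space -/

/-- `u ∈ L²(ℝ)` vanishes outside `(0,L)` and has finite energy. -/
def MemEnergySpace (L : ℝ) (u : Lp ℝ 2 (volume : Measure ℝ)) : Prop :=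
  (∀ᵐ x : ℝ, x ∉ Ioo 0 L → u x = 0) ∧
    IntegrableOn (fun p : ℝ × ℝ => (u p.1 - u p.2) ^ 2 / |p.1 - p.2|) nearPairs

theorem ae_fst {P : ℝ → Prop} (h : ∀ᵐ x : ℝ, P x) : ∀ᵐ p : ℝ × ℝ, P p.1 :=
  Measure.quasiMeasurePreserving_fst.ae h

theorem ae_snd {P : ℝ → Prop} (h : ∀ᵐ x : ℝ, P x) : ∀ᵐ p : ℝ × ℝ, P p.2 :=
  Measure.quasiMeasurePreserving_snd.ae h

theorem aesm_fst (u : Lp ℝ 2 (volume : Measure ℝ)) :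
    AEStronglyMeasurable (fun p : ℝ × ℝ => u p.1) volume :=
  (Lp.aestronglyMeasurable u).comp_quasiMeasurePreserving Measure.quasiMeasurePreserving_fst

theorem aesm_snd (u : Lp ℝ 2 (volume : Measure ℝ)) :
    AEStronglyMeasurable (fun p : ℝ × ℝ => u p.2) volume :=
  (Lp.aestronglyMeasurable u).comp_quasiMeasurePreserving Measure.quasiMeasurePreserving_snd

theorem aesm_abs_inv : AEStronglyMeasurable (fun p : ℝ × ℝ => |p.1 - p.2|⁻¹) volume := by
  have : Measurable (fun p : ℝ × ℝ => |p.1 - p.2|⁻¹) := by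
    have h : Measurable (fun p : ℝ × ℝ => |p.1 - p.2|) := by fun_prop
    exact h.inv
  exact this.aestronglyMeasurable

theorem MemEnergySpace.integrable_energy {L : ℝ} {u v : Lp ℝ 2 (volume : Measure ℝ)}
    (hu : MemEnergySpace L u) (hv : MemEnergySpace L v) :
    IntegrableOn (fun p : ℝ × ℝ => (u p.1 - u p.2) * (v p.1 - v p.2) / |p.1 - p.2|)
      nearPairs := by
  refine Integrable.mono' (hu.2.add hv.2) ?_ ?_
  · simp only [div_eq_mul_inv]
    exact ((((aesm_fst u).sub (aesm_snd u)).mul ((aesm_fst v).sub (aesm_snd v))).mul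
      aesm_abs_inv).restrict
  · refine Eventually.of_forall fun p => ?_
    simp only [Pi.add_apply, Real.norm_eq_abs, abs_div, abs_mul, abs_abs, ← add_div]
    refine div_le_div_of_nonneg_right ?_ (abs_nonneg _)
    rw [← abs_mul, abs_le]
    constructor <;> nlinarith [sq_nonneg ((u p.1 - u p.2) + (v p.1 - v p.2)),
      sq_nonneg ((u p.1 - u p.2) - (v p.1 - v p.2)), sq_nonneg (u p.1 - u p.2),
      sq_nonneg (v p.1 - v p.2)]

theorem MemEnergySpace.integrable {L : ℝ} {u : Lp ℝ 2 (volume : Measure ℝ)}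
    (hu : MemEnergySpace L u) : Integrable u := by
  have h1 : IntegrableOn u (Ioo 0 L) :=
    ((Lp.memLp u).restrict (Ioo 0 L)).integrable (by norm_num)
  refine IntegrableOn.integrable_of_ae_notMem_eq_zero h1 hu.1

theorem MemEnergySpace.integrable_lowerOrder {L : ℝ} {u v : Lp ℝ 2 (volume : Measure ℝ)}
    (hu : MemEnergySpace L u) (hv : MemEnergySpace L v) :
    IntegrableOn (fun p : ℝ × ℝ => u p.1 * v p.2 / |p.1 - p.2|) farPairs := by
  have h : Integrable (fun p : ℝ × ℝ => u p.1 * v p.2) := hu.integrable.mul_prod hv.integrable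
  have hm : MeasurableSet farPairs := by
    have : Measurable (fun p : ℝ × ℝ => |p.1 - p.2|) := by fun_prop
    exact measurableSet_le measurable_const this
  refine Integrable.mono h.integrableOn ?_ ?_
  · simp only [div_eq_mul_inv]
    exact (((aesm_fst u).mul (aesm_snd v)).mul aesm_abs_inv).restrict
  · refine (ae_restrict_iff' hm).2 (Eventually.of_forall fun p hp => ?_)
    rw [norm_div]
    refine div_le_self (norm_nonneg _) ?_
    have hp' : 1 ≤ |p.1 - p.2| := hp
    simpa using hp'

theorem integrable_mul (u v : Lp ℝ 2 (volume : Measure ℝ)) :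
    Integrable (fun x => u x * v x) :=
  (Lp.memLp u).integrable_mul (Lp.memLp v)

theorem MemEnergySpace.add {L : ℝ} {u v : Lp ℝ 2 (volume : Measure ℝ)}
    (hu : MemEnergySpace L u) (hv : MemEnergySpace L v) : MemEnergySpace L (u + v) := by
  have hae := Lp.coeFn_add u v
  refine ⟨?_, ?_⟩
  · filter_upwards [hu.1, hv.1, hae] with x h1 h2 h3 hx
    rw [h3, Pi.add_apply, h1 hx, h2 hx, add_zero]
  · have h := (hu.2.add hv.2).add ((hu.integrable_energy hv).const_mul 2)
    refine h.congr (ae_restrict_of_ae ?_)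
    filter_upwards [ae_fst hae, ae_snd hae] with p h1 h2
    simp only [Pi.add_apply, h1, h2]
    ring

theorem MemEnergySpace.smul {L : ℝ} {u : Lp ℝ 2 (volume : Measure ℝ)} (c : ℝ)
    (hu : MemEnergySpace L u) : MemEnergySpace L (c • u) := by
  have hae := Lp.coeFn_smul c u
  refine ⟨?_, ?_⟩
  · filter_upwards [hu.1, hae] with x h1 h3 hx
    rw [h3, Pi.smul_apply, h1 hx, smul_zero]
  · refine (hu.2.const_mul (c ^ 2)).congr (ae_restrict_of_ae ?_)
    filter_upwards [ae_fst hae, ae_snd hae] with p h1 h2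
    simp only [Pi.smul_apply, smul_eq_mul, h1, h2]
    ring

theorem memEnergySpace_zero (L : ℝ) : MemEnergySpace L 0 := by
  have hae : ∀ᵐ x : ℝ, (0 : Lp ℝ 2 (volume : Measure ℝ)) x = 0 := Lp.coeFn_zero ℝ 2 volume
  refine ⟨hae.mono fun x hx _ => hx, ?_⟩
  refine (integrable_zero (ℝ × ℝ) ℝ _).congr (ae_restrict_of_ae ?_)
  filter_upwards [ae_fst hae, ae_snd hae] with p h1 h2
  rw [h1, h2]
  simp

/-- The space `ℍ(Ω)`, `Ω = (0,L)`, as a subspace of `L²(ℝ)`. -/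
def energySpace (L : ℝ) : Submodule ℝ (Lp ℝ 2 (volume : Measure ℝ)) where
  carrier := {u | MemEnergySpace L u}
  add_mem' := fun hu hv => hu.add hv
  zero_mem' := memEnergySpace_zero L
  smul_mem' := fun c _ hu => hu.smul c

/-! ### Dirichlet eigenvalues of the logarithmic Laplacian -/

theorem energyL_add_left {L : ℝ} {u w v : Lp ℝ 2 (volume : Measure ℝ)}
    (hu : MemEnergySpace L u) (hw : MemEnergySpace L w) (hv : MemEnergySpace L v) :
    energyL (u + w : Lp ℝ 2 (volume : Measure ℝ)) v = energyL u v + energyL w v := by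
  have hae := Lp.coeFn_add u w
  have e1 : ∫ p in nearPairs, ((u + w : Lp ℝ 2 (volume : Measure ℝ)) p.1 -
        (u + w : Lp ℝ 2 (volume : Measure ℝ)) p.2) * (v p.1 - v p.2) / |p.1 - p.2| =
      (∫ p in nearPairs, (u p.1 - u p.2) * (v p.1 - v p.2) / |p.1 - p.2|) +
        ∫ p in nearPairs, (w p.1 - w p.2) * (v p.1 - v p.2) / |p.1 - p.2| := by
    rw [← integral_add (hu.integrable_energy hv) (hw.integrable_energy hv)]
    refine integral_congr_ae (ae_restrict_of_ae ?_)
    filter_upwards [ae_fst hae, ae_snd hae] with p h1 h2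
    simp only [Pi.add_apply, h1, h2]
    ring
  have e2 : ∫ p in farPairs, (u + w : Lp ℝ 2 (volume : Measure ℝ)) p.1 * v p.2 / |p.1 - p.2| =
      (∫ p in farPairs, u p.1 * v p.2 / |p.1 - p.2|) +
        ∫ p in farPairs, w p.1 * v p.2 / |p.1 - p.2| := by
    rw [← integral_add (hu.integrable_lowerOrder hv) (hw.integrable_lowerOrder hv)]
    refine integral_congr_ae (ae_restrict_of_ae ?_)
    filter_upwards [ae_fst hae] with p h1
    simp only [Pi.add_apply, h1]
    ring
  have e3 : ∫ x, (u + w : Lp ℝ 2 (volume : Measure ℝ)) x * v x =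
      (∫ x, u x * v x) + ∫ x, w x * v x := by
    rw [← integral_add (integrable_mul u v) (integrable_mul w v)]
    refine integral_congr_ae ?_
    filter_upwards [hae] with x h1
    simp only [Pi.add_apply, h1]
    ring
  simp only [energyL, energy, lowerOrder, e1, e2, e3]
  ring

theorem energyL_smul_left (c : ℝ) (u v : Lp ℝ 2 (volume : Measure ℝ)) :
    energyL (c • u : Lp ℝ 2 (volume : Measure ℝ)) v = c * energyL u v := by
  have hae := Lp.coeFn_smul c u
  have e1 : ∫ p in nearPairs, ((c • u : Lp ℝ 2 (volume : Measure ℝ)) p.1 -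
        (c • u : Lp ℝ 2 (volume : Measure ℝ)) p.2) * (v p.1 - v p.2) / |p.1 - p.2| =
      c * ∫ p in nearPairs, (u p.1 - u p.2) * (v p.1 - v p.2) / |p.1 - p.2| := by
    rw [← integral_const_mul]
    refine integral_congr_ae (ae_restrict_of_ae ?_)
    filter_upwards [ae_fst hae, ae_snd hae] with p h1 h2
    simp only [Pi.smul_apply, smul_eq_mul, h1, h2]
    ring
  have e2 : ∫ p in farPairs, (c • u : Lp ℝ 2 (volume : Measure ℝ)) p.1 * v p.2 / |p.1 - p.2| =
      c * ∫ p in farPairs, u p.1 * v p.2 / |p.1 - p.2| := by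
    rw [← integral_const_mul]
    refine integral_congr_ae (ae_restrict_of_ae ?_)
    filter_upwards [ae_fst hae] with p h1
    simp only [Pi.smul_apply, smul_eq_mul, h1]
    ring
  have e3 : ∫ x, (c • u : Lp ℝ 2 (volume : Measure ℝ)) x * v x = c * ∫ x, u x * v x := by
    rw [← integral_const_mul]
    refine integral_congr_ae ?_
    filter_upwards [hae] with x h1
    simp only [Pi.smul_apply, smul_eq_mul, h1]
    ring
  simp only [energyL, energy, lowerOrder, e1, e2, e3]
  ring

theorem inner_eq_integral (u v : Lp ℝ 2 (volume : Measure ℝ)) :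
    inner ℝ u v = ∫ x, u x * v x := by
  rw [L2.inner_def]
  exact integral_congr_ae (Eventually.of_forall fun x => by simp [mul_comm])

/-- The space of weak solutions `u ∈ ℍ(Ω)` of `L_Δ u = μ u` in `Ω = (0,L)`, `u = 0` in `ℝ ∖ Ω`. Its
nonzero elements are the Dirichlet eigenfunctions for `μ`, its dimension is the multiplicity. -/
def eigenspace (L μ : ℝ) : Submodule ℝ (Lp ℝ 2 (volume : Measure ℝ)) where
  carrier := {u | u ∈ energySpace L ∧
    ∀ v ∈ energySpace L, energyL u v = μ * ∫ x, u x * v x}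
  add_mem' := by
    rintro u w ⟨hu, hu'⟩ ⟨hw, hw'⟩
    refine ⟨add_mem hu hw, fun v hv => ?_⟩
    rw [energyL_add_left hu hw hv, hu' v hv, hw' v hv]
    simp only [← inner_eq_integral, inner_add_left]
    ring
  zero_mem' := by
    refine ⟨zero_mem _, fun v _ => ?_⟩
    have h := energyL_smul_left 0 0 v
    rw [smul_zero, zero_mul] at h
    rw [h, ← inner_eq_integral, inner_zero_left, mul_zero]
  smul_mem' := by
    rintro c u ⟨hu, hu'⟩
    refine ⟨Submodule.smul_mem _ c hu, fun v hv => ?_⟩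
    rw [energyL_smul_left, hu' v hv]
    simp only [← inner_eq_integral, real_inner_smul_left]
    ring

/-- `lam 0 ≤ lam 1 ≤ …` lists all Dirichlet eigenvalues of `L_Δ` in `(0,L)`, each one as often as its
multiplicity (which is finite). So `lam k` is the `(k+1)`-st eigenvalue. -/
def IsDirichletEigenvalueSequence (L : ℝ) (lam : ℕ → ℝ) : Prop :=
  Monotone lam ∧ ∀ μ : ℝ, FiniteDimensional ℝ (eigenspace L μ) ∧
    {j : ℕ | lam j = μ}.encard = (Module.finrank ℝ (eigenspace L μ) : ℕ∞)

/-! ### The finite element space -/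

/-- The mesh size `h = L / (N+1)`. -/
def meshSize (L : ℝ) (N : ℕ) : ℝ := L / (N + 1)

/-- Continuous functions on `(0,L)`, extended by zero, that are affine on each
`Ω_i = (ih, (i+1)h)`, `i = 0,…,N`. -/
def IsFEFunction (L : ℝ) (N : ℕ) (v : ℝ → ℝ) : Prop :=
  ContinuousOn v (Ioo 0 L) ∧ (∀ x ∉ Ioo 0 L, v x = 0) ∧
    ∀ i ∈ Finset.range (N + 1), ∃ a b : ℝ,
      ∀ x ∈ Ioo (i * meshSize L N) ((i + 1) * meshSize L N), v x = a * x + b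

/-- The space `𝒱_h`, `h = L / (N+1)`, as a subspace of `L²(ℝ)`. -/
def discreteSpace (L : ℝ) (N : ℕ) : Submodule ℝ (Lp ℝ 2 (volume : Measure ℝ)) where
  carrier := {u | ∃ v : ℝ → ℝ, IsFEFunction L N v ∧ u =ᵐ[volume] v}
  add_mem' := by
    rintro u w ⟨f, ⟨hf1, hf2, hf3⟩, huf⟩ ⟨g, ⟨hg1, hg2, hg3⟩, hwg⟩
    refine ⟨f + g, ⟨hf1.add hg1, fun x hx => ?_, fun i hi => ?_⟩,
      (Lp.coeFn_add u w).trans (huf.add hwg)⟩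
    · simp [hf2 x hx, hg2 x hx]
    · obtain ⟨a, b, h1⟩ := hf3 i hi
      obtain ⟨c, d, h2⟩ := hg3 i hi
      refine ⟨a + c, b + d, fun x hx => ?_⟩
      rw [Pi.add_apply, h1 x hx, h2 x hx]
      ring
  zero_mem' := ⟨0, ⟨continuousOn_const, fun _ _ => rfl, fun _ _ => ⟨0, 0, fun x _ => by simp⟩⟩,
    Lp.coeFn_zero ℝ 2 volume⟩
  smul_mem' := by
    rintro c u ⟨f, ⟨hf1, hf2, hf3⟩, huf⟩
    refine ⟨c • f, ⟨hf1.const_smul c, fun x hx => ?_, fun i hi => ?_⟩,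
      (Lp.coeFn_smul c u).trans (huf.const_smul c)⟩
    · simp [hf2 x hx]
    · obtain ⟨a, b, h1⟩ := hf3 i hi
      refine ⟨c * a, c * b, fun x hx => ?_⟩
      rw [Pi.smul_apply, smul_eq_mul, h1 x hx]
      ring

/-- The values `ℰ_L(u,u)` for `u ∈ M` with `‖u‖_{L²} = 1`. -/
def energyValues (M : Submodule ℝ (Lp ℝ 2 (volume : Measure ℝ))) : Set ℝ :=
  {c | ∃ u ∈ M, ‖u‖ = 1 ∧ c = energyL u u}

/-- The values `max {ℰ_L(u,u) : u ∈ M, ‖u‖_{L²} = 1}` for the `k`-dimensional subspaces `M` of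
`𝒱_h`. -/
def minimaxValues (L : ℝ) (N k : ℕ) : Set ℝ :=
  {c | ∃ M : Submodule ℝ (Lp ℝ 2 (volume : Measure ℝ)),
    M ≤ discreteSpace L N ∧ Module.finrank ℝ M = k ∧ IsGreatest (energyValues M) c}

/-- The discrete Courant-Fischer value `λ_{k,h}`, `h = L / (N+1)`, for `1 ≤ k ≤ N + 2`. -/
def discreteEigenvalue (L : ℝ) (N k : ℕ) : ℝ := sInf (minimaxValues L N k)

/-! ### Stiffness and mass matrix -/

/-- The shape function `φ_i`, `i = 0,…,N+1`: the piecewise affine hat of height one at `x_i = ih` that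
vanishes at the other nodes, cut off outside `[0,L]`. So it is the half hat `(x₁ - x)/h` on `[0,x₁]`
for `i = 0` and `(x - x_N)/h` on `[x_N,L]` for `i = N+1`. -/
def shapeFunction (L : ℝ) (N : ℕ) (i : Fin (N + 2)) : ℝ → ℝ :=
  (Icc 0 L).indicator fun x => max 0 (1 - |x - (i : ℕ) * meshSize L N| / meshSize L N)

/-- The stiffness matrix `𝒜^L_h = (ℰ_L(φ_i,φ_j))`. -/
def stiffnessMatrix (L : ℝ) (N : ℕ) : Matrix (Fin (N + 2)) (Fin (N + 2)) ℝ :=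
  Matrix.of fun i j => energyL (shapeFunction L N i) (shapeFunction L N j)

/-- The mass matrix `(∫ φ_i φ_j)`, the `L²` Gram matrix of the shape functions. -/
def massMatrix (L : ℝ) (N : ℕ) : Matrix (Fin (N + 2)) (Fin (N + 2)) ℝ :=
  Matrix.of fun i j => ∫ x, shapeFunction L N i x * shapeFunction L N j x

/-- `μ 0 ≤ μ 1 ≤ …` are the eigenvalues, with multiplicity, of `A r = t G r`, that is, the roots of
`t ↦ det (t G - A)` (`G` positive definite). -/
def AreEigenvaluesRelativeTo {n : ℕ} (A G : Matrix (Fin n) (Fin n) ℝ) (μ : Fin n → ℝ) : Prop :=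
  G.PosDef ∧ Monotone μ ∧ ∀ t : ℝ, (t • G - A).det = G.det * ∏ i, (t - μ i)

end

end LogLap

open scoped ENNReal

namespace LogLap

/-! The form `energyL` is the nonnegative singular part `energy` plus `lowerOrder`, which is bounded
on `L²` because supports are bounded and the far kernel is at most one. Hence it is bounded below
and, by Fatou, lower semicontinuous under `L²` convergence. Its sublevel sets on the unit sphere are
totally bounded (`totallyBounded_energyL`): `2/|x-y|` dominates the sum of the dyadic kernels of any
number of generations, and each generation controls one copy of `‖g‖²` up to finitely many cell
averages. So successive minimisation over unit vectors orthogonal to the earlier minimisers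
succeeds. It yields orthonormal eigenvectors `e k` with energies tending to infinity. By
`eigenspace_finrank_eq` these energies list all eigenvalues with multiplicity, and counting fibres
shows that the list is unique.

The same minimisation on the finite dimensional `discreteSpace` gives the Courant-Fischer values.
The minimisers form an orthonormal basis there, and passing to it diagonalises the stiffness matrix
relative to the mass matrix.

Convergence is the Rayleigh-Ritz argument `tendsto_minimax`, which rests on two facts. The discrete
space lies in the energy space, although its functions may jump at `0` and `L`: across a jump,
`1/|x-y|` is at most a product of integrable weights `|s|^(-1/2) |t|^(-1/2)`. This gives the lower
bound. The upper bound needs finite element functions to be dense in the energy space. To see this,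
`u` is mollified and compressed back into `(0,L)`; up to an enlarged radius this does not increase
the energy near the diagonal, and away from it the kernel is bounded, so `L²` closeness is enough.
The resulting Lipschitz function is then close to its nodal interpolant in both norms.

Forms are treated as functions that are bilinear on a subspace only, because the defining integrals
are additive only where they converge. -/

/-! ### Symmetric forms on a subspace of an inner product space -/

section Abstract

variable {X : Type*} [NormedAddCommGroup X] [InnerProductSpace ℝ X]

/-- The function `a` restricts to a symmetric bilinear form on the subspace `W`. -/
structure SymmFormOn (a : X → X → ℝ) (W : Submodule ℝ X) : Prop where
  add_left : ∀ u ∈ W, ∀ w ∈ W, ∀ v ∈ W, a (u + w) v = a u v + a w v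
  smul_left : ∀ (c : ℝ), ∀ u ∈ W, ∀ v ∈ W, a (c • u) v = c * a u v
  symm : ∀ u ∈ W, ∀ v ∈ W, a u v = a v u

namespace SymmFormOn

variable {a b : X → X → ℝ} {W W' : Submodule ℝ X}

theorem mono (h : SymmFormOn a W) (hW : W' ≤ W) : SymmFormOn a W' where
  add_left u hu w hw v hv := h.add_left u (hW hu) w (hW hw) v (hW hv)
  smul_left c u hu v hv := h.smul_left c u (hW hu) v (hW hv)
  symm u hu v hv := h.symm u (hW hu) v (hW hv)

theorem add_right (h : SymmFormOn a W) {u w v : X} (hu : u ∈ W) (hw : w ∈ W) (hv : v ∈ W) :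
    a v (u + w) = a v u + a v w := by
  rw [h.symm v hv _ (W.add_mem hu hw), h.add_left u hu w hw v hv, h.symm u hu v hv,
    h.symm w hw v hv]

theorem smul_right (h : SymmFormOn a W) (c : ℝ) {u v : X} (hu : u ∈ W) (hv : v ∈ W) :
    a v (c • u) = c * a v u := by
  rw [h.symm v hv _ (W.smul_mem c hu), h.smul_left c u hu v hv, h.symm u hu v hv]

theorem zero_left (h : SymmFormOn a W) {v : X} (hv : v ∈ W) : a 0 v = 0 := by
  have := h.smul_left 0 0 W.zero_mem v hv
  simpa using this

theorem neg_left (h : SymmFormOn a W) {u v : X} (hu : u ∈ W) (hv : v ∈ W) :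
    a (-u) v = -a u v := by
  have := h.smul_left (-1) u hu v hv
  simpa using this

theorem sub_left (h : SymmFormOn a W) {u w v : X} (hu : u ∈ W) (hw : w ∈ W) (hv : v ∈ W) :
    a (u - w) v = a u v - a w v := by
  rw [sub_eq_add_neg, h.add_left u hu _ (W.neg_mem hw) v hv, h.neg_left hw hv, sub_eq_add_neg]

theorem sub_right (h : SymmFormOn a W) {u w v : X} (hu : u ∈ W) (hw : w ∈ W) (hv : v ∈ W) :
    a v (u - w) = a v u - a v w := by
  rw [h.symm v hv _ (W.sub_mem hu hw), h.sub_left hu hw hv, h.symm u hu v hv, h.symm w hw v hv]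

theorem sum_left (h : SymmFormOn a W) {ι : Type*} (s : Finset ι) (c : ι → ℝ) {e : ι → X}
    (he : ∀ i ∈ s, e i ∈ W) {v : X} (hv : v ∈ W) :
    a (∑ i ∈ s, c i • e i) v = ∑ i ∈ s, c i * a (e i) v := by
  classical
  induction s using Finset.induction_on with
  | empty => simpa using h.zero_left hv
  | insert i s hi ih =>
    have h1 : ∀ j ∈ s, e j ∈ W := fun j hj => he j (Finset.mem_insert_of_mem hj)
    have h2 : e i ∈ W := he i (Finset.mem_insert_self i s)
    rw [Finset.sum_insert hi, Finset.sum_insert hi, h.add_left _ (W.smul_mem _ h2) _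
      (W.sum_mem fun j hj => W.smul_mem _ (h1 j hj)) v hv, h.smul_left _ _ h2 v hv, ih h1]

theorem sum_right (h : SymmFormOn a W) {ι : Type*} (s : Finset ι) (c : ι → ℝ) {e : ι → X}
    (he : ∀ i ∈ s, e i ∈ W) {v : X} (hv : v ∈ W) :
    a v (∑ i ∈ s, c i • e i) = ∑ i ∈ s, c i * a v (e i) := by
  rw [h.symm v hv _ (W.sum_mem fun j hj => W.smul_mem _ (he j hj)), h.sum_left s c he hv]
  exact Finset.sum_congr rfl fun i hi => by rw [h.symm _ (he i hi) v hv]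

theorem sum_sum (h : SymmFormOn a W) {ι : Type*} (s : Finset ι) (c d : ι → ℝ) {e : ι → X}
    (he : ∀ i ∈ s, e i ∈ W) :
    a (∑ i ∈ s, c i • e i) (∑ i ∈ s, d i • e i) = ∑ i ∈ s, ∑ j ∈ s, c i * d j * a (e i) (e j) := by
  rw [h.sum_left s c he (W.sum_mem fun j hj => W.smul_mem _ (he j hj))]
  refine Finset.sum_congr rfl fun i hi => ?_
  rw [h.sum_right s d he (he i hi), Finset.mul_sum]
  exact Finset.sum_congr rfl fun j _ => by ring

theorem of_inner (W : Submodule ℝ X) : SymmFormOn (fun u v : X => inner ℝ u v) W where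
  add_left u _ w _ v _ := inner_add_left u w v
  smul_left c u _ v _ := real_inner_smul_left u v c
  symm u _ v _ := real_inner_comm v u

theorem add_const_mul (ha : SymmFormOn a W) (hb : SymmFormOn b W) (c : ℝ) :
    SymmFormOn (fun u v => a u v + c * b u v) W where
  add_left u hu w hw v hv := by
    rw [ha.add_left u hu w hw v hv, hb.add_left u hu w hw v hv]; ring
  smul_left t u hu v hv := by
    rw [ha.smul_left t u hu v hv, hb.smul_left t u hu v hv]; ring
  symm u hu v hv := by rw [ha.symm u hu v hv, hb.symm u hu v hv]

theorem apply_add_smul (h : SymmFormOn a W) {u v : X} (hu : u ∈ W) (hv : v ∈ W) (t : ℝ) :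
    a (u + t • v) (u + t • v) = a u u + 2 * t * a u v + t ^ 2 * a v v := by
  have htv := W.smul_mem t hv
  rw [h.add_left u hu _ htv _ (W.add_mem hu htv), h.add_right hu htv hu, h.add_right hu htv htv,
    h.smul_left t v hv _ htv, h.smul_left t v hv _ hu, h.smul_right t hv hu, h.smul_right t hv hv,
    h.symm v hv u hu]
  ring

/-- The Cauchy-Schwarz inequality for positive semidefinite forms. -/
theorem sq_le_mul (h : SymmFormOn a W) (hpos : ∀ u ∈ W, 0 ≤ a u u) {u v : X} (hu : u ∈ W)
    (hv : v ∈ W) : a u v ^ 2 ≤ a u u * a v v := by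
  have key : ∀ t : ℝ, 0 ≤ a v v * (t * t) + 2 * a u v * t + a u u := fun t => by
    have := hpos _ (W.add_mem hu (W.smul_mem t hv))
    rw [h.apply_add_smul hu hv] at this
    linarith
  have := discrim_le_zero key
  rw [discrim] at this
  linarith

end SymmFormOn

/-- A linear coefficient vanishes if the quadratic polynomial is nonnegative. -/
theorem eq_zero_of_forall_quadratic_nonneg {p q : ℝ} (h : ∀ t : ℝ, 0 ≤ p * t + q * t ^ 2) :
    p = 0 := by
  have := discrim_le_zero (a := q) (b := p) (c := 0) fun t => by
    have := h t
    linarith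
  rw [discrim] at this
  nlinarith [sq_nonneg p]

/-! ### Successive minimisation of a form over the unit sphere -/

/-- `e k` minimises `a` among the unit vectors of `W` that are orthogonal to all earlier `e j`. -/
structure IsMinimizingAt (a : X → X → ℝ) (W : Submodule ℝ X) (e : ℕ → X) (k : ℕ) : Prop where
  mem : e k ∈ W
  norm_eq : ‖e k‖ = 1
  orth : ∀ j < k, inner ℝ (e j) (e k) = 0
  le : ∀ v ∈ W, ‖v‖ = 1 → (∀ j < k, inner ℝ (e j) v = 0) → a (e k) (e k) ≤ a v v

/-- Recursion on all earlier values. -/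
noncomputable def recursiveSeq (g : ℕ → (ℕ → X) → X) : ℕ → X
  | k => g k fun j => if _ : j < k then recursiveSeq g j else 0

/-- The bound `d` is the dimension of the space: `⊤` for the energy space, `N + 2` for the discrete
one. From index `d` on, the sequence is arbitrary. -/
theorem exists_minimizing_seq {a : X → X → ℝ} {W : Submodule ℝ X} {d : ℕ∞}
    (hmin : ∀ k : ℕ, (k : ℕ∞) < d → ∀ f : ℕ → X, ∃ u ∈ W, ‖u‖ = 1 ∧ (∀ j < k, inner ℝ (f j) u = 0) ∧
      ∀ v ∈ W, ‖v‖ = 1 → (∀ j < k, inner ℝ (f j) v = 0) → a u u ≤ a v v) :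
    ∃ e : ℕ → X, ∀ k : ℕ, (k : ℕ∞) < d → IsMinimizingAt a W e k := by
  have : ∀ k : ℕ, ∀ f : ℕ → X, ∃ u : X, (k : ℕ∞) < d → u ∈ W ∧ ‖u‖ = 1 ∧
      (∀ j < k, inner ℝ (f j) u = 0) ∧
      ∀ v ∈ W, ‖v‖ = 1 → (∀ j < k, inner ℝ (f j) v = 0) → a u u ≤ a v v := by
    intro k f
    by_cases hk : (k : ℕ∞) < d
    · obtain ⟨u, h⟩ := hmin k hk f
      exact ⟨u, fun _ => h⟩
    · exact ⟨0, fun h => absurd h hk⟩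
  choose g hg using this
  refine ⟨recursiveSeq g, fun k hk => ?_⟩
  have hrec : recursiveSeq g k = g k fun j => if _ : j < k then recursiveSeq g j else 0 := by
    rw [recursiveSeq]
  obtain ⟨h1, h2, h3, h4⟩ := hg k (fun j => if _ : j < k then recursiveSeq g j else 0) hk
  rw [← hrec] at h1 h2 h3 h4
  refine ⟨h1, h2, fun j hj => ?_, fun v hv hv1 hv2 => h4 v hv hv1 fun j hj => ?_⟩
  · have := h3 j hj
    rwa [dif_pos hj] at this
  · rw [dif_pos hj]
    exact hv2 j hj

namespace IsMinimizingAt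

variable {a : X → X → ℝ} {W : Submodule ℝ X} {e : ℕ → X} {d : ℕ∞}

theorem mul_sq_norm_le {k : ℕ} (h : IsMinimizingAt a W e k) (ha : SymmFormOn a W) {v : X}
    (hv : v ∈ W) (hv' : ∀ j < k, inner ℝ (e j) v = 0) :
    a (e k) (e k) * ‖v‖ ^ 2 ≤ a v v := by
  rcases eq_or_ne v 0 with rfl | h0
  · simp [ha.zero_left W.zero_mem]
  have hn : ‖v‖ ≠ 0 := norm_ne_zero_iff.2 h0
  have h1 := h.le (‖v‖⁻¹ • v) (W.smul_mem _ hv) (by rw [norm_smul, norm_inv, norm_norm,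
    inv_mul_cancel₀ hn]) fun j hj => by rw [inner_smul_right, hv' j hj, mul_zero]
  rw [ha.smul_left _ _ hv _ (W.smul_mem _ hv), ha.smul_right _ hv hv] at h1
  have : 0 < ‖v‖ ^ 2 := by positivity
  calc a (e k) (e k) * ‖v‖ ^ 2 ≤ (‖v‖⁻¹ * (‖v‖⁻¹ * a v v)) * ‖v‖ ^ 2 := by gcongr
    _ = a v v := by field_simp

theorem inner_eq (h : ∀ k : ℕ, (k : ℕ∞) < d → IsMinimizingAt a W e k) {i j : ℕ}
    (hi : (i : ℕ∞) < d) (hj : (j : ℕ∞) < d) :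
    inner ℝ (e i) (e j) = if i = j then (1 : ℝ) else 0 := by
  rcases lt_trichotomy i j with hij | rfl | hij
  · rw [if_neg hij.ne, (h j hj).orth i hij]
  · rw [if_pos rfl, real_inner_self_eq_norm_sq, (h i hi).norm_eq, one_pow]
  · rw [if_neg hij.ne', real_inner_comm, (h i hi).orth j hij]

/-- The Euler-Lagrange equation: the minimisers are eigenvectors. -/
theorem apply_eq (h : ∀ k : ℕ, (k : ℕ∞) < d → IsMinimizingAt a W e k) (ha : SymmFormOn a W) :
    ∀ k : ℕ, (k : ℕ∞) < d → ∀ v ∈ W, a (e k) v = a (e k) (e k) * inner ℝ (e k) v := by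
  intro k
  induction k using Nat.strong_induction_on with
  | _ k ih =>
    intro hk v hv
    have hlt : ∀ j < k, (j : ℕ∞) < d := fun j hj => lt_trans (by exact_mod_cast hj) hk
    have hek := (h k hk).mem
    -- First variation: `a(e k + t w) - a(e k) ‖e k + t w‖²` is nonnegative for all `t` and vanishes
    -- at `t = 0`, so its linear coefficient is zero.
    have horth : ∀ w ∈ W, (∀ j < k, inner ℝ (e j) w = 0) →
        a (e k) w = a (e k) (e k) * inner ℝ (e k) w := by
      intro w hw hw'
      have : 2 * (a (e k) w - a (e k) (e k) * inner ℝ (e k) w) = 0 := by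
        refine eq_zero_of_forall_quadratic_nonneg
          (q := a w w - a (e k) (e k) * ‖w‖ ^ 2) fun t => ?_
        have h1 := (h k hk).mul_sq_norm_le ha (W.add_mem hek (W.smul_mem t hw)) fun j hj => by
          rw [inner_add_right, inner_smul_right, hw' j hj, (h k hk).orth j hj]; simp
        rw [ha.apply_add_smul hek hw, norm_add_sq_real, (h k hk).norm_eq, norm_smul,
          inner_smul_right, mul_pow, Real.norm_eq_abs, sq_abs] at h1
        nlinarith
      linarith
    -- For general `v`, split off the projection `p` onto the earlier minimisers. Both sides vanish
    -- on `p`: the form by symmetry and the equations already known for `j < k`, the inner product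
    -- by orthogonality.
    set p : X := ∑ j ∈ Finset.range k, (inner ℝ (e j) v : ℝ) • e j with hp
    have hpe : ∀ j ∈ Finset.range k, e j ∈ W := fun j hj =>
      (h j (hlt j (Finset.mem_range.1 hj))).mem
    have hpW : p ∈ W := W.sum_mem fun j hj => W.smul_mem _ (hpe j hj)
    have h1 : a (e k) p = 0 := by
      rw [hp, ha.sum_right _ _ hpe hek]
      refine Finset.sum_eq_zero fun j hj => ?_
      have hj' := Finset.mem_range.1 hj
      rw [ha.symm _ hek _ (hpe j hj), ih j hj' (hlt j hj') _ hek, (h k hk).orth j hj']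
      simp
    have h2 : inner ℝ (e k) p = (0 : ℝ) := by
      rw [hp, inner_sum]
      refine Finset.sum_eq_zero fun j hj => ?_
      rw [inner_smul_right, real_inner_comm (e j), (h k hk).orth j (Finset.mem_range.1 hj), mul_zero]
    have h3 := horth (v - p) (W.sub_mem hv hpW) fun j hj => by
      rw [inner_sub_right, hp, inner_sum]
      simp only [inner_smul_right]
      rw [Finset.sum_eq_single_of_mem j (Finset.mem_range.2 hj)]
      · rw [inner_eq h (hlt j hj) (hlt j hj)]; simp
      · intro i hi hij
        rw [inner_eq h (hlt j hj) (hlt i (Finset.mem_range.1 hi)), if_neg hij.symm, mul_zero]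
    rw [ha.sub_right hv hpW hek, h1, inner_sub_right, h2] at h3
    linarith

theorem apply_pair (h : ∀ k : ℕ, (k : ℕ∞) < d → IsMinimizingAt a W e k) (ha : SymmFormOn a W)
    {i j : ℕ} (hi : (i : ℕ∞) < d) (hj : (j : ℕ∞) < d) :
    a (e i) (e j) = if i = j then a (e i) (e i) else 0 := by
  rw [apply_eq h ha i hi _ (h j hj).mem, inner_eq h hi hj]
  simp

theorem apply_self_mono (h : ∀ k : ℕ, (k : ℕ∞) < d → IsMinimizingAt a W e k) {i j : ℕ}
    (hij : i ≤ j) (hj : (j : ℕ∞) < d) : a (e i) (e i) ≤ a (e j) (e j) :=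
  (h i (lt_of_le_of_lt (by exact_mod_cast hij) hj)).le _ (h j hj).mem (h j hj).norm_eq
    fun l hl => (h j hj).orth l (hl.trans_le hij)

end IsMinimizingAt

/-! ### Extremal vectors in finite dimension. -/

/-- A subspace of dimension more than `k` has a unit vector orthogonal to `k` given vectors. -/
theorem exists_unit_orthogonal {M : Submodule ℝ X} {k : ℕ} (hM : k < Module.finrank ℝ M)
    (f : ℕ → X) : ∃ u ∈ M, ‖u‖ = 1 ∧ ∀ j < k, inner ℝ (f j) u = 0 := by
  have : FiniteDimensional ℝ M := FiniteDimensional.of_finrank_pos (by omega)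
  let T : M →ₗ[ℝ] (Fin k → ℝ) := LinearMap.pi fun j => (innerₛₗ ℝ (f j)).comp M.subtype
  obtain ⟨u, hu, hu0⟩ := (Submodule.ne_bot_iff _).1
    (LinearMap.ker_ne_bot_of_finrank_lt (f := T) (by simpa using hM))
  have hn : ‖(u : X)‖ ≠ 0 := by simpa using hu0
  refine ⟨‖(u : X)‖⁻¹ • (u : X), M.smul_mem _ u.2, ?_, fun j hj => ?_⟩
  · rw [norm_smul, norm_inv, norm_norm, inv_mul_cancel₀ hn]
  · have := congrFun (LinearMap.mem_ker.1 hu) ⟨j, hj⟩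
    simp only [T, LinearMap.pi_apply, LinearMap.comp_apply, Submodule.subtype_apply,
      innerₛₗ_apply_apply, Pi.zero_apply] at this
    rw [inner_smul_right, this, mul_zero]

/-- On a finite dimensional space, a symmetric form is continuous. -/
theorem SymmFormOn.continuous_apply_self {a : X → X → ℝ} {W : Submodule ℝ X}
    (h : SymmFormOn a W) [FiniteDimensional ℝ W] : Continuous fun u : W => a u u := by
  let b := stdOrthonormalBasis ℝ W
  have hexp : ∀ u : W, a u u = ∑ i, ∑ j, inner ℝ (b i) u * inner ℝ (b j) u * a (b i) (b j) := by
    intro u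
    rw [← h.sum_sum Finset.univ (fun i => inner ℝ (b i) u) (fun i => inner ℝ (b i) u)
      (e := fun i => (b i : X)) fun i _ => (b i).2]
    have hu : (u : X) = ∑ i, (inner ℝ (b i) u : ℝ) • (b i : X) := by
      conv_lhs => rw [← b.sum_repr' u]
      simp
    rw [← hu]
  simp only [hexp]
  fun_prop

/-- In finite dimension, a symmetric form has a minimum and a maximum on the unit vectors that are
orthogonal to given vectors. -/
theorem SymmFormOn.exists_extremal {a : X → X → ℝ} {W : Submodule ℝ X} (h : SymmFormOn a W) {k : ℕ}
    (hk : k < Module.finrank ℝ W) (f : ℕ → X) :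
    (∃ u ∈ W, ‖u‖ = 1 ∧ (∀ j < k, inner ℝ (f j) u = 0) ∧
      ∀ v ∈ W, ‖v‖ = 1 → (∀ j < k, inner ℝ (f j) v = 0) → a u u ≤ a v v) ∧
    ∃ u ∈ W, ‖u‖ = 1 ∧ (∀ j < k, inner ℝ (f j) u = 0) ∧
      ∀ v ∈ W, ‖v‖ = 1 → (∀ j < k, inner ℝ (f j) v = 0) → a v v ≤ a u u := by
  have hW : FiniteDimensional ℝ W := FiniteDimensional.of_finrank_pos (by omega)
  let S : Set W := Metric.sphere 0 1 ∩ ⋂ j ∈ Finset.range k, {u : W | inner ℝ (f j) (u : X) = 0}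
  have hS : IsCompact S := by
    refine (isCompact_sphere 0 1).inter_right (isClosed_biInter fun j _ => ?_)
    exact isClosed_eq (by fun_prop) continuous_const
  have hmem : ∀ v : W, v ∈ S ↔ ‖(v : X)‖ = 1 ∧ ∀ j < k, inner ℝ (f j) (v : X) = 0 := by
    intro v
    simp [S]
  obtain ⟨w, hw, hw1, hw2⟩ := exists_unit_orthogonal hk f
  have hne : S.Nonempty := ⟨⟨w, hw⟩, (hmem _).2 ⟨hw1, hw2⟩⟩
  constructor
  · obtain ⟨u, hu, hmin⟩ := hS.exists_isMinOn hne h.continuous_apply_self.continuousOn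
    exact ⟨u, u.2, ((hmem u).1 hu).1, ((hmem u).1 hu).2,
      fun v hv hv1 hv2 => hmin ((hmem ⟨v, hv⟩).2 ⟨hv1, hv2⟩)⟩
  · obtain ⟨u, hu, hmax⟩ := hS.exists_isMaxOn hne h.continuous_apply_self.continuousOn
    exact ⟨u, u.2, ((hmem u).1 hu).1, ((hmem u).1 hu).2,
      fun v hv hv1 hv2 => hmax ((hmem ⟨v, hv⟩).2 ⟨hv1, hv2⟩)⟩

/-! ### Counting eigenvalues -/

/-- The eigenspaces of a form are spanned by the successive minimisers, if the latter have
energies tending to infinity. -/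
theorem eigenspace_finrank_eq {a : X → X → ℝ} {W : Submodule ℝ X} {e : ℕ → X}
    (ha : SymmFormOn a W) (h : ∀ k, IsMinimizingAt a W e k)
    (hlim : Tendsto (fun k => a (e k) (e k)) atTop atTop) (μ : ℝ) (E : Submodule ℝ X)
    (hE : ∀ u, u ∈ E ↔ u ∈ W ∧ ∀ v ∈ W, a u v = μ * inner ℝ u v) :
    FiniteDimensional ℝ E ∧ {j : ℕ | a (e j) (e j) = μ}.encard = (Module.finrank ℝ E : ℕ∞) := by
  have h' : ∀ k : ℕ, (k : ℕ∞) < ⊤ → IsMinimizingAt a W e k := fun k _ => h k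
  have htop : ∀ k : ℕ, (k : ℕ∞) < ⊤ := fun k => ENat.natCast_lt_top k
  have hEL : ∀ k, ∀ v ∈ W, a (e k) v = a (e k) (e k) * inner ℝ (e k) v := fun k =>
    IsMinimizingAt.apply_eq h' ha k (htop k)
  have hin : ∀ i j, inner ℝ (e i) (e j) = if i = j then (1 : ℝ) else 0 := fun i j =>
    IsMinimizingAt.inner_eq h' (htop i) (htop j)
  have horth : Orthonormal ℝ e := orthonormal_iff_ite.2 hin
  have hfin : {j : ℕ | a (e j) (e j) = μ}.Finite := by
    have := (hlim.eventually_gt_atTop μ)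
    rw [← Nat.cofinite_eq_atTop] at this
    refine Set.Finite.subset this fun j hj => ?_
    simp only [mem_compl_iff, mem_ofPred_eq, not_lt] at hj ⊢
    exact hj.le
  set s := hfin.toFinset with hs
  have hmem : ∀ j, j ∈ s ↔ a (e j) (e j) = μ := fun j => by simp [hs]
  have hspan : E = Submodule.span ℝ (Set.range fun j : s => e j) := by
    apply le_antisymm
    · intro u hu
      obtain ⟨huW, hu'⟩ := (hE u).1 hu
      set p : X := ∑ j ∈ s, (inner ℝ (e j) u : ℝ) • e j with hp
      have hpE : p ∈ E := E.sum_mem fun j hj => E.smul_mem _ <| (hE _).2 ⟨(h j).mem, fun v hv => by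
        rw [hEL j v hv, (hmem j).1 hj]⟩
      have hpS : p ∈ Submodule.span ℝ (Set.range fun j : s => e j) :=
        Submodule.sum_mem _ fun j hj => Submodule.smul_mem _ _
          (Submodule.subset_span ⟨⟨j, hj⟩, rfl⟩)
      obtain ⟨hwW, hw'⟩ := (hE (u - p)).1 (E.sub_mem hu hpE)
      -- `u - p` is orthogonal to every minimiser: to those with energy `μ` by the choice of `p`, to
      -- the others because eigenvectors for different eigenvalues are orthogonal.
      have hw0 : ∀ j, inner ℝ (e j) (u - p) = (0 : ℝ) := by
        intro j
        by_cases hj : j ∈ s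
        · rw [inner_sub_right, hp, inner_sum]
          simp only [inner_smul_right, hin]
          rw [Finset.sum_eq_single_of_mem j hj fun i _ hij => by rw [if_neg hij.symm, mul_zero]]
          simp
        · have h1 := hw' (e j) (h j).mem
          rw [ha.symm _ hwW _ (h j).mem, hEL j _ hwW, real_inner_comm] at h1
          rw [real_inner_comm]
          rw [hmem] at hj
          have : (a (e j) (e j) - μ) * inner ℝ (u - p) (e j) = 0 := by linarith
          exact (mul_eq_zero.1 this).resolve_left (sub_ne_zero.2 hj)
      -- A nonzero `u - p` would compete in every minimisation problem, so that `a (e k) (e k) ≤ μ`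
      -- for all `k`.
      have hzero : u - p = 0 := by
        by_contra hne
        obtain ⟨k, hk⟩ := (hlim.eventually_gt_atTop μ).exists
        have h1 := (h k).mul_sq_norm_le ha hwW fun j _ => hw0 j
        rw [hw' _ hwW, real_inner_self_eq_norm_sq] at h1
        have : 0 < ‖u - p‖ ^ 2 := by
          have := norm_pos_iff.2 hne
          positivity
        nlinarith
      rw [sub_eq_zero.1 hzero]
      exact hpS
    · rw [Submodule.span_le]
      rintro _ ⟨j, rfl⟩
      exact (hE _).2 ⟨(h j).mem, fun v hv => by rw [hEL j v hv, (hmem j).1 j.2]⟩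
  have hli : LinearIndependent ℝ fun j : s => e j :=
    (horth.comp _ Subtype.val_injective).linearIndependent
  constructor
  · rw [hspan]
    exact FiniteDimensional.span_of_finite ℝ (Set.finite_range _)
  · rw [hspan, finrank_span_eq_card hli, Fintype.card_coe, hfin.encard_eq_coe_toFinset_card]

/-- A monotone sequence is determined by the finite numbers of times it takes each value. -/
theorem eq_of_encard_fiber_eq {f g : ℕ → ℝ} (hf : Monotone f) (hg : Monotone g)
    (hfin : ∀ c, {j | f j = c}.Finite)
    (h : ∀ c, {j | f j = c}.encard = {j | g j = c}.encard) : f = g := by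
  -- If `p` and `q` agree below `n` and `p n < q n`, then `q` takes the value `p n` only at indices
  -- below `n`. There `p` takes it too, and once more at `n`, so the finite fibres differ in size.
  have key : ∀ {p q : ℕ → ℝ}, Monotone q → (∀ c, {j | p j = c}.Finite) →
      (∀ c, {j | p j = c}.encard = {j | q j = c}.encard) → ∀ n, (∀ m < n, p m = q m) →
      ¬ p n < q n := by
    intro p q hq hpfin hpq n hn hlt
    have hss : {j | q j = p n} ⊂ {j | p j = p n} := by
      refine (Set.ssubset_iff_of_subset fun j hj => ?_).2 ⟨n, rfl, fun hj => hlt.ne' hj⟩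
      have hj' : j < n := by
        by_contra hc
        have := hq (not_lt.1 hc)
        rw [mem_ofPred_eq] at hj
        linarith
      rw [mem_ofPred_eq, hn j hj']
      exact hj
    have := (hpfin (p n)).subset hss.subset |>.encard_lt_encard hss
    rw [hpq] at this
    exact lt_irrefl _ this
  funext n
  induction n using Nat.strong_induction_on with
  | _ n ih =>
    refine le_antisymm ?_ ?_
    · refine not_lt.1 (key hf (fun c => ?_) (fun c => (h c).symm) n fun m hm => (ih m hm).symm)
      have := hfin c
      rw [← Set.encard_lt_top_iff] at this ⊢
      rwa [← h]
    · exact not_lt.1 (key hg hfin h n ih)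

/-- A totally bounded set contains no infinite orthonormal sequence. -/
theorem not_totallyBounded_range_orthonormal {e : ℕ → X} (he : Orthonormal ℝ e) :
    ¬ TotallyBounded (Set.range e) := by
  intro htb
  obtain ⟨t, ht, hcov⟩ := Metric.totallyBounded_iff.1 htb (1 / 2) (by norm_num)
  have : ∀ n, ∃ y ∈ t, e n ∈ Metric.ball y (1 / 2) := fun n => by
    simpa using hcov (Set.mem_range_self n)
  choose y hy hey using this
  obtain ⟨m, -, n, -, hmn, hyn⟩ := Set.infinite_univ.exists_ne_map_eq_of_mapsTo
    (f := y) (fun n _ => hy n) ht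
  have h1 : dist (e m) (e n) < 1 := by
    have h2 := hey m
    have h3 := hey n
    rw [← hyn, Metric.mem_ball'] at h3
    have := dist_triangle (e m) (y m) (e n)
    rw [Metric.mem_ball] at h2
    linarith
  have h2 : dist (e m) (e n) ^ 2 = 2 := by
    rw [dist_eq_norm, norm_sub_sq_real, he.1 m, he.1 n, he.2 hmn]
    norm_num
  nlinarith [dist_nonneg (x := e m) (y := e n)]

/-- The energies are monotone. If they converged, all minimisers would lie in one totally bounded
sublevel set, which an infinite orthonormal sequence cannot do. -/
theorem tendsto_apply_self_atTop {a : X → X → ℝ} {W : Submodule ℝ X} {e : ℕ → X}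
    (h : ∀ k, IsMinimizingAt a W e k)
    (htb : ∀ C : ℝ, TotallyBounded {u | u ∈ W ∧ ‖u‖ = 1 ∧ a u u ≤ C}) :
    Tendsto (fun k => a (e k) (e k)) atTop atTop := by
  have h' : ∀ k : ℕ, (k : ℕ∞) < ⊤ → IsMinimizingAt a W e k := fun k _ => h k
  have hmono : Monotone fun k => a (e k) (e k) := fun i j hij =>
    IsMinimizingAt.apply_self_mono h' hij (ENat.natCast_lt_top j)
  refine (tendsto_atTop_of_monotone hmono).resolve_right ?_
  rintro ⟨C, hC⟩
  refine not_totallyBounded_range_orthonormal (e := e) (orthonormal_iff_ite.2 fun i j =>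
    IsMinimizingAt.inner_eq h' (ENat.natCast_lt_top i) (ENat.natCast_lt_top j)) ((htb C).subset ?_)
  rintro _ ⟨k, rfl⟩
  exact ⟨(h k).mem, (h k).norm_eq, hmono.ge_of_tendsto hC k⟩

end Abstract

/-! ### The minimax principle -/

section Minimax

variable {X : Type*} [NormedAddCommGroup X] [InnerProductSpace ℝ X]
  {a : X → X → ℝ} {W : Submodule ℝ X} {e : ℕ → X}

/-- The values of the quadratic form of `a` on the unit sphere of `M`. -/
def sphereValues (a : X → X → ℝ) (M : Submodule ℝ X) : Set ℝ :=
  {c | ∃ u ∈ M, ‖u‖ = 1 ∧ c = a u u}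

/-- The maxima of the quadratic form of `a` on the unit spheres of the `k`-dimensional subspaces
of `W`. -/
def minimaxSet (a : X → X → ℝ) (W : Submodule ℝ X) (k : ℕ) : Set ℝ :=
  {c | ∃ M : Submodule ℝ X, M ≤ W ∧ Module.finrank ℝ M = k ∧ IsGreatest (sphereValues a M) c}

theorem exists_isGreatest_sphereValues (ha : SymmFormOn a W)
    {M : Submodule ℝ X} (hM : M ≤ W) (hpos : 0 < Module.finrank ℝ M) :
    ∃ c, IsGreatest (sphereValues a M) c := by
  obtain ⟨u, hu, hu1, -, hmax⟩ := ((ha.mono hM).exists_extremal hpos (fun _ => 0)).2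
  refine ⟨a u u, ⟨u, hu, hu1, rfl⟩, ?_⟩
  rintro _ ⟨v, hv, hv1, rfl⟩
  exact hmax v hv hv1 fun j hj => absurd hj (Nat.not_lt_zero j)

/-- A `(k+1)`-dimensional subspace contains a unit vector orthogonal to the first `k` minimisers,
and `e k` has the least energy among those. -/
theorem le_of_mem_minimaxSet {k : ℕ} (h : IsMinimizingAt a W e k) {c : ℝ}
    (hc : c ∈ minimaxSet a W (k + 1)) : a (e k) (e k) ≤ c := by
  obtain ⟨M, hMW, hM, hgr⟩ := hc
  obtain ⟨u, hu, hu1, hu2⟩ := exists_unit_orthogonal (M := M) (k := k) (by omega) e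
  exact (h.le u (hMW hu) hu1 hu2).trans (hgr.2 ⟨u, hu, hu1, rfl⟩)

/-- The Courant-Fischer principle. -/
theorem isLeast_minimaxSet {d : ℕ∞} (ha : SymmFormOn a W)
    (h : ∀ k : ℕ, (k : ℕ∞) < d → IsMinimizingAt a W e k) {k : ℕ} (hk : (k : ℕ∞) < d) :
    IsLeast (minimaxSet a W (k + 1)) (a (e k) (e k)) := by
  refine ⟨?_, fun c hc => le_of_mem_minimaxSet (h k hk) hc⟩
  have hlt : ∀ i : Fin (k + 1), ((i : ℕ) : ℕ∞) < d := fun i =>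
    lt_of_le_of_lt (by exact_mod_cast Nat.lt_succ_iff.1 i.2) hk
  have horth : Orthonormal ℝ fun i : Fin (k + 1) => e i := orthonormal_iff_ite.2 fun i j => by
    rw [IsMinimizingAt.inner_eq h (hlt i) (hlt j)]
    simp [Fin.ext_iff]
  -- The optimal subspace is spanned by the first `k + 1` minimisers. The form is diagonal there,
  -- and its largest entry belongs to `e k`.
  refine ⟨Submodule.span ℝ (Set.range fun i : Fin (k + 1) => e i), ?_, ?_, ⟨e k, ?_, ?_, rfl⟩, ?_⟩
  · rw [Submodule.span_le]
    rintro _ ⟨i, rfl⟩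
    exact (h i (hlt i)).mem
  · rw [finrank_span_eq_card horth.linearIndependent, Fintype.card_fin]
  · exact Submodule.subset_span ⟨Fin.last k, by simp⟩
  · exact (h k hk).norm_eq
  · rintro _ ⟨u, hu, hu1, rfl⟩
    obtain ⟨c, rfl⟩ := (Submodule.mem_span_range_iff_exists_fun ℝ).1 hu
    have hn : ∑ i, c i ^ 2 = 1 := by
      have h1 := real_inner_self_eq_norm_sq (∑ i, c i • e (i : Fin (k + 1)))
      rw [hu1, horth.inner_sum] at h1
      simpa [sq] using h1
    rw [ha.sum_sum Finset.univ c c (e := fun i : Fin (k + 1) => e i) fun i _ => (h i (hlt i)).mem]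
    calc ∑ i, ∑ j, c i * c j * a (e (i : Fin (k + 1))) (e (j : Fin (k + 1)))
        = ∑ i : Fin (k + 1), c i ^ 2 * a (e i) (e i) := by
          refine Finset.sum_congr rfl fun i _ => ?_
          rw [Finset.sum_eq_single_of_mem i (Finset.mem_univ i)]
          · ring
          · intro j _ hj
            rw [IsMinimizingAt.apply_pair h ha (hlt i) (hlt j),
              if_neg fun hc => hj (Fin.ext hc.symm), mul_zero]
      _ ≤ ∑ i, c i ^ 2 * a (e k) (e k) := by
          refine Finset.sum_le_sum fun i _ => mul_le_mul_of_nonneg_left ?_ (sq_nonneg _)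
          exact IsMinimizingAt.apply_self_mono h (Nat.lt_succ_iff.1 i.2) hk
      _ = a (e k) (e k) := by rw [← Finset.sum_mul, hn, one_mul]

/-! ### The Rayleigh-Ritz method. -/

/-- If `w n ∈ W` converges to `u` in the norm and in the seminorm of a bounded below form, the
values of the form converge. -/
theorem SymmFormOn.tendsto_apply (ha : SymmFormOn a W) {C : ℝ}
    (hC : ∀ u ∈ W, -(C * ‖u‖ ^ 2) ≤ a u u) {u u' : X} {w w' : ℕ → X} (hu : u ∈ W) (hu' : u' ∈ W)
    (hw : ∀ n, w n ∈ W) (hw' : ∀ n, w' n ∈ W)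
    (h1 : Tendsto (fun n => ‖u - w n‖) atTop (𝓝 0))
    (h1' : Tendsto (fun n => ‖u' - w' n‖) atTop (𝓝 0))
    (h2 : Tendsto (fun n => a (u - w n) (u - w n)) atTop (𝓝 0))
    (h2' : Tendsto (fun n => a (u' - w' n) (u' - w' n)) atTop (𝓝 0)) :
    Tendsto (fun n => a (w n) (w' n)) atTop (𝓝 (a u u')) := by
  have hW := SymmFormOn.of_inner W
  have hq := ha.add_const_mul hW C
  -- Adding `C` times the inner product makes the form positive semidefinite, so that the
  -- Cauchy-Schwarz inequality controls the mixed terms.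
  set q : X → X → ℝ := fun u v => a u v + C * inner ℝ u v with hqdef
  have hpos : ∀ u ∈ W, 0 ≤ q u u := fun u hu => by
    have := hC u hu
    simp only [hqdef, real_inner_self_eq_norm_sq]
    linarith
  have hqlim : ∀ {x : X} {y : ℕ → X}, Tendsto (fun n => ‖x - y n‖) atTop (𝓝 0) →
      Tendsto (fun n => a (x - y n) (x - y n)) atTop (𝓝 0) →
      Tendsto (fun n => q (x - y n) (x - y n)) atTop (𝓝 0) := by
    intro x y g1 g2
    have := g2.add ((g1.pow 2).const_mul C)
    simpa [hqdef, real_inner_self_eq_norm_sq] using this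
  have hsmall : ∀ {f : ℕ → ℝ} {g : ℕ → ℝ}, (∀ n, f n ^ 2 ≤ g n) → Tendsto g atTop (𝓝 0) →
      Tendsto f atTop (𝓝 0) := by
    intro f g hfg hg
    have : Tendsto (fun n => f n ^ 2) atTop (𝓝 0) :=
      squeeze_zero (fun n => sq_nonneg _) hfg hg
    have h3 := this.sqrt
    simp only [Real.sqrt_sq_eq_abs, Real.sqrt_zero] at h3
    exact (tendsto_zero_iff_abs_tendsto_zero _).2 h3
  have hd := hqlim h1 h2
  have hd' := hqlim h1' h2'
  have t1 : Tendsto (fun n => q (u - w n) u') atTop (𝓝 0) :=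
    hsmall (fun n => hq.sq_le_mul hpos (W.sub_mem hu (hw n)) hu')
      (by simpa using hd.mul_const (q u' u'))
  have t2 : Tendsto (fun n => q u (u' - w' n)) atTop (𝓝 0) :=
    hsmall (fun n => hq.sq_le_mul hpos hu (W.sub_mem hu' (hw' n)))
      (by simpa using hd'.const_mul (q u u))
  have t3 : Tendsto (fun n => q (u - w n) (u' - w' n)) atTop (𝓝 0) :=
    hsmall (fun n => hq.sq_le_mul hpos (W.sub_mem hu (hw n)) (W.sub_mem hu' (hw' n)))
      (by simpa using hd.mul hd')
  have tq : Tendsto (fun n => q (w n) (w' n)) atTop (𝓝 (q u u')) := by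
    have := ((tendsto_const_nhds (x := q u u')).sub t1).sub (t2.sub t3)
    simp only [sub_zero] at this
    refine this.congr fun n => ?_
    have e1 := hq.sub_left hu (hw n) hu'
    have e2 := hq.sub_right hu' (hw' n) hu
    have e3 := hq.sub_left hu (hw n) (W.sub_mem hu' (hw' n))
    have e4 := hq.sub_right hu' (hw' n) (hw n)
    linarith
  have lw : Tendsto w atTop (𝓝 u) := by
    rw [tendsto_iff_norm_sub_tendsto_zero]
    simpa [norm_sub_rev] using h1
  have lw' : Tendsto w' atTop (𝓝 u') := by
    rw [tendsto_iff_norm_sub_tendsto_zero]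
    simpa [norm_sub_rev] using h1'
  have := tq.sub ((lw.inner lw' (𝕜 := ℝ)).const_mul C)
  simpa [hqdef] using this

/-- A quadratic form whose matrix is entrywise close to a negative multiple of the identity. -/
theorem sum_sum_le_of_close {ι : Type*} [Fintype ι] {m b : ι → ι → ℝ} {ε δ : ℝ}
    (hclose : ∀ i j, |m i j - b i j| ≤ δ) (hδ : δ * Fintype.card ι ≤ ε / 2)
    (c : ι → ℝ) (hb : ∑ i, ∑ j, c i * c j * b i j ≤ -ε * ∑ i, c i ^ 2) :
    ∑ i, ∑ j, c i * c j * m i j ≤ -(ε / 2) * ∑ i, c i ^ 2 := by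
  have h1 : ∀ i j, c i * c j * m i j ≤ c i * c j * b i j + δ * ((c i ^ 2 + c j ^ 2) / 2) := by
    intro i j
    have h2 : c i * c j * (m i j - b i j) ≤ |c i * c j| * δ :=
      (le_abs_self _).trans (by rw [abs_mul]; gcongr; exact hclose i j)
    have h3 : |c i * c j| ≤ (c i ^ 2 + c j ^ 2) / 2 := by
      rw [abs_le]
      constructor <;> nlinarith [sq_nonneg (c i + c j), sq_nonneg (c i - c j)]
    have hδ0 : 0 ≤ δ := (abs_nonneg _).trans (hclose i j)
    nlinarith
  have h4 : ∑ i, ∑ j, δ * ((c i ^ 2 + c j ^ 2) / 2) = δ * Fintype.card ι * ∑ i, c i ^ 2 := by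
    simp only [← Finset.mul_sum, ← Finset.sum_div, Finset.sum_add_distrib, Finset.sum_const,
      Finset.card_univ, nsmul_eq_mul]
    ring
  have h5 : ∑ i, ∑ j, c i * c j * m i j ≤
      ∑ i, ∑ j, c i * c j * b i j + ∑ i, ∑ j, δ * ((c i ^ 2 + c j ^ 2) / 2) := by
    simp only [← Finset.sum_add_distrib]
    exact Finset.sum_le_sum fun i _ => Finset.sum_le_sum fun j _ => h1 i j
  rw [h4] at h5
  have h6 : 0 ≤ ∑ i, c i ^ 2 := Finset.sum_nonneg fun i _ => sq_nonneg _
  nlinarith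

/-- Convergence of the Rayleigh-Ritz method. -/
theorem tendsto_minimax (ha : SymmFormOn a W) {C : ℝ} (hC : ∀ u ∈ W, -(C * ‖u‖ ^ 2) ≤ a u u)
    (h : ∀ k, IsMinimizingAt a W e k) {V : ℕ → Submodule ℝ X} (hV : ∀ n, V n ≤ W)
    (happ : ∀ u ∈ W, ∃ w : ℕ → X, (∀ n, w n ∈ V n) ∧
      Tendsto (fun n => ‖u - w n‖) atTop (𝓝 0) ∧
      Tendsto (fun n => a (u - w n) (u - w n)) atTop (𝓝 0))
    {k : ℕ} {μ : ℕ → ℝ} (hμ : ∀ᶠ n in atTop, IsGLB (minimaxSet a (V n) (k + 1)) (μ n) ∧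
      (minimaxSet a (V n) (k + 1)).Nonempty) :
    Tendsto μ atTop (𝓝 (a (e k) (e k))) := by
  have h' : ∀ k : ℕ, (k : ℕ∞) < ⊤ → IsMinimizingAt a W e k := fun k _ => h k
  -- Subspaces of `V n` are subspaces of `W`, so the discrete values never drop below the exact
  -- ones.
  have hlow : ∀ᶠ n in atTop, a (e k) (e k) ≤ μ n := by
    filter_upwards [hμ] with n hn
    refine hn.1.2 ?_
    rintro c ⟨M, hM, hM'⟩
    exact le_of_mem_minimaxSet (h k) ⟨M, hM.trans (hV n), hM'⟩
  refine tendsto_order.2 ⟨fun c hc => hlow.mono fun n hn => hc.trans_le hn, fun c hc => ?_⟩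
  obtain ⟨c', hc1, hc2⟩ := exists_between hc
  set ε := c' - a (e k) (e k) with hε
  have hε0 : 0 < ε := sub_pos.2 hc1
  choose w hwV hw1 hw2 using fun i : Fin (k + 1) => happ (e i) (h i).mem
  have hwW : ∀ i n, w i n ∈ W := fun i n => hV n (hwV i n)
  have hI := SymmFormOn.of_inner W
  have hb := ha.add_const_mul hI (-c')
  -- On the span of `e 0, …, e k` the shifted form `b` is at most `-ε` times the squared norm. The
  -- approximants `w i n` inherit this with `ε / 2`, once the `(k+1) × (k+1)` matrix of `b` is known
  -- up to `δ`.
  set b : X → X → ℝ := fun u v => a u v + -c' * inner ℝ u v with hbdef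
  have hblim : ∀ i j, Tendsto (fun n => b (w i n) (w j n)) atTop
      (𝓝 (b (e (i : Fin (k + 1))) (e (j : Fin (k + 1))))) := by
    intro i j
    have lw : ∀ i, Tendsto (w i) atTop (𝓝 (e (i : Fin (k + 1)))) := fun i => by
      rw [tendsto_iff_norm_sub_tendsto_zero]
      simpa [norm_sub_rev] using hw1 i
    exact (ha.tendsto_apply hC (h i).mem (h j).mem (hwW i) (hwW j) (hw1 i) (hw1 j) (hw2 i)
      (hw2 j)).add (((lw i).inner (lw j) (𝕜 := ℝ)).const_mul _)
  set δ := ε / (2 * (k + 1)) with hδ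
  have hδ0 : 0 < δ := by positivity
  have hclose : ∀ᶠ n in atTop, ∀ i j, |b (w i n) (w j n) - b (e (i : Fin (k + 1)))
      (e (j : Fin (k + 1)))| ≤ δ := by
    refine eventually_all.2 fun i => eventually_all.2 fun j => ?_
    filter_upwards [Metric.tendsto_nhds.1 (hblim i j) δ hδ0] with n hn
    exact (Real.dist_eq _ _ ▸ hn).le
  filter_upwards [hμ, hclose] with n hn hcl
  have hneg : ∀ c : Fin (k + 1) → ℝ, b (∑ i, c i • w i n) (∑ i, c i • w i n) ≤
      -(ε / 2) * ∑ i, c i ^ 2 := by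
    intro t
    rw [hb.sum_sum _ _ _ fun i _ => hwW i n]
    refine sum_sum_le_of_close hcl ?_ t ?_
    · rw [Fintype.card_fin, hδ]
      push_cast
      field_simp
      exact le_refl _
    · rw [Finset.mul_sum]
      refine Finset.sum_le_sum fun i _ => ?_
      rw [Finset.sum_eq_single_of_mem i (Finset.mem_univ i)]
      · simp only [hbdef]
        rw [IsMinimizingAt.inner_eq h' (ENat.natCast_lt_top _) (ENat.natCast_lt_top _), if_pos rfl]
        have := IsMinimizingAt.apply_self_mono h' (Nat.lt_succ_iff.1 i.2) (ENat.natCast_lt_top _)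
        have h3 : a (e i) (e i) + -c' * 1 ≤ -ε := by rw [hε]; linarith
        nlinarith [sq_nonneg (t i)]
      · intro j _ hj
        have hij : (i : ℕ) ≠ j := fun hc => hj (Fin.ext hc.symm)
        simp only [hbdef]
        rw [IsMinimizingAt.apply_pair h' ha (ENat.natCast_lt_top _) (ENat.natCast_lt_top _),
          IsMinimizingAt.inner_eq h' (ENat.natCast_lt_top _) (ENat.natCast_lt_top _), if_neg hij,
          if_neg hij]
        simp
  -- Strict negativity of `b` on nontrivial combinations also excludes linear dependence of the
  -- approximants.
  have hli : LinearIndependent ℝ fun i => w i n := by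
    rw [Fintype.linearIndependent_iff]
    intro t ht
    have h1 := hneg t
    rw [ht, hb.zero_left W.zero_mem] at h1
    have h2 : ∑ i, t i ^ 2 ≤ 0 := by nlinarith
    have h3 : ∑ i, t i ^ 2 = 0 := le_antisymm h2 (Finset.sum_nonneg fun i _ => sq_nonneg _)
    intro i
    have := (Finset.sum_eq_zero_iff_of_nonneg fun i _ => sq_nonneg (t i)).1 h3 i (Finset.mem_univ i)
    exact pow_eq_zero_iff (two_ne_zero) |>.1 this
  set M := Submodule.span ℝ (Set.range fun i => w i n) with hM
  have hMV : M ≤ V n := by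
    rw [hM, Submodule.span_le]
    rintro _ ⟨i, rfl⟩
    exact hwV i n
  have hMr : Module.finrank ℝ M = k + 1 := by
    rw [hM, finrank_span_eq_card hli, Fintype.card_fin]
  obtain ⟨t, ht⟩ := exists_isGreatest_sphereValues ha (hMV.trans (hV n)) (by rw [hMr]; omega)
  refine lt_of_le_of_lt (hn.1.1 ⟨M, hMV, hMr, ht⟩) (lt_of_le_of_lt ?_ hc2)
  obtain ⟨u, hu, hu1, rfl⟩ := ht.1
  obtain ⟨s, rfl⟩ := (Submodule.mem_span_range_iff_exists_fun ℝ).1 hu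
  have h1 := hneg s
  simp only [hbdef, real_inner_self_eq_norm_sq, hu1] at h1
  have h2 : 0 ≤ ∑ i, s i ^ 2 := Finset.sum_nonneg fun i _ => sq_nonneg _
  nlinarith

/-! ### Generalised matrix eigenvalues. -/

/-- The characteristic polynomial of a form relative to the Gram matrix of a basis. -/
theorem det_smul_gram_sub {n : ℕ} (ha : SymmFormOn a W)
    (h : ∀ k : ℕ, (k : ℕ∞) < n → IsMinimizingAt a W e k) {φ : Fin n → X}
    (hφ : Submodule.span ℝ (Set.range φ) = W) {A G : Matrix (Fin n) (Fin n) ℝ}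
    (hA : ∀ i j, A i j = a (φ i) (φ j)) (hG : ∀ i j, G i j = inner ℝ (φ i) (φ j)) (t : ℝ) :
    (t • G - A).det = G.det * ∏ i : Fin n, (t - a (e i) (e i)) := by
  have hlt : ∀ i : Fin n, ((i : ℕ) : ℕ∞) < n := fun i => by exact_mod_cast i.2
  have hφW : ∀ i, φ i ∈ W := fun i => hφ ▸ Submodule.subset_span ⟨i, rfl⟩
  -- The rows of `P` are coordinates of the minimisers in terms of `φ`. Congruence by `P` takes `G`
  -- to the identity and `A` to the diagonal matrix of energies; the first of these gives `det P ^ 2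
  -- * det G = 1`.
  choose P hP using fun i : Fin n =>
    (Submodule.mem_span_range_iff_exists_fun ℝ).1 (hφ.symm ▸ (h i (hlt i)).mem)
  have hconj : ∀ {b : X → X → ℝ} {B : Matrix (Fin n) (Fin n) ℝ}, SymmFormOn b W →
      (∀ i j, B i j = b (φ i) (φ j)) →
      ∀ i j, (Matrix.of P * B * (Matrix.of P).transpose) i j = b (e i) (e j) := by
    intro b B hb hB i j
    rw [← hP i, ← hP j, hb.sum_left _ _ (fun i _ => hφW i) (W.sum_mem fun i _ =>
      W.smul_mem _ (hφW i))]
    simp only [hb.sum_right _ _ (fun i _ => hφW i) (hφW _), Matrix.mul_apply,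
      Matrix.transpose_apply, Matrix.of_apply, hB, Finset.sum_mul, Finset.mul_sum]
    rw [Finset.sum_comm]
    exact Finset.sum_congr rfl fun _ _ => Finset.sum_congr rfl fun _ _ => by ring
  have h1 : Matrix.of P * G * (Matrix.of P).transpose = 1 := by
    ext i j
    rw [hconj (SymmFormOn.of_inner W) hG, IsMinimizingAt.inner_eq h (hlt i) (hlt j),
      Matrix.one_apply]
    simp [Fin.ext_iff]
  have h2 : Matrix.of P * A * (Matrix.of P).transpose =
      Matrix.diagonal fun i : Fin n => a (e i) (e i) := by
    ext i j
    rw [hconj ha hA, IsMinimizingAt.apply_pair h ha (hlt i) (hlt j), Matrix.diagonal_apply]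
    simp [Fin.ext_iff]
  have h3 : Matrix.of P * (t • G - A) * (Matrix.of P).transpose =
      Matrix.diagonal fun i : Fin n => t - a (e i) (e i) := by
    rw [Matrix.mul_sub, Matrix.sub_mul, h2, Matrix.mul_smul, Matrix.smul_mul, h1]
    ext i j
    by_cases hij : i = j <;> simp [hij]
  have d1 := congrArg Matrix.det h1
  have d3 := congrArg Matrix.det h3
  rw [Matrix.det_mul, Matrix.det_mul, Matrix.det_transpose, Matrix.det_one] at d1
  rw [Matrix.det_mul, Matrix.det_mul, Matrix.det_transpose, Matrix.det_diagonal] at d3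
  rw [← d3]
  linear_combination -(t • G - A).det * d1

end Minimax

/-! ### The energy as a lower integral -/

/-- The kernel `1/|z|`, cut off at distance `δ`. -/
noncomputable def nearKernel (δ z : ℝ) : ℝ≥0∞ := if |z| < δ then ENNReal.ofReal |z|⁻¹ else 0

/-- `∬ |u(x) - u(y)|² k(x - y) dx dy`. -/
noncomputable def kernelEnergy (k : ℝ → ℝ≥0∞) (u : ℝ → ℝ) : ℝ≥0∞ :=
  ∫⁻ x, ∫⁻ y, ‖u x - u y‖ₑ ^ 2 * k (x - y)

theorem measurable_nearKernel (δ : ℝ) : Measurable (nearKernel δ) := by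
  refine Measurable.ite (measurableSet_lt (by fun_prop) measurable_const) ?_ measurable_const
  exact ENNReal.measurable_ofReal.comp (measurable_norm.inv)

theorem nearKernel_ne_top (δ z : ℝ) : nearKernel δ z ≠ ⊤ := by
  rw [nearKernel]
  split_ifs <;> simp

/-- The iterated integral suits changes of variables, the product integral suits Fatou, domination
and comparison with `energy`. -/
theorem kernelEnergy_eq_lintegral_prod {k : ℝ → ℝ≥0∞} (hk : Measurable k) {u : ℝ → ℝ}
    (hu : Measurable u) :
    kernelEnergy k u = ∫⁻ p : ℝ × ℝ, ‖u p.1 - u p.2‖ₑ ^ 2 * k (p.1 - p.2) := by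
  rw [Measure.volume_eq_prod, lintegral_prod _ (by fun_prop)]
  rfl

theorem kernelEnergy_congr {k : ℝ → ℝ≥0∞} {u v : ℝ → ℝ} (h : u =ᵐ[volume] v) :
    kernelEnergy k u = kernelEnergy k v := by
  refine lintegral_congr_ae ?_
  filter_upwards [h] with x hx
  refine lintegral_congr_ae ?_
  filter_upwards [h] with y hy
  rw [hx, hy]

theorem measurableSet_nearPairs : MeasurableSet nearPairs :=
  measurableSet_lt (by fun_prop) measurable_const

theorem measurableSet_farPairs : MeasurableSet farPairs :=
  measurableSet_le measurable_const (by fun_prop)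

theorem ofReal_sq_div (a b : ℝ) :
    ENNReal.ofReal (a ^ 2 / |b|) = ‖a‖ₑ ^ 2 * ENNReal.ofReal |b|⁻¹ := by
  rw [div_eq_mul_inv, ENNReal.ofReal_mul (sq_nonneg a), ← sq_abs, ENNReal.ofReal_pow (abs_nonneg a),
    Real.enorm_eq_ofReal_abs]

theorem setLIntegral_nearPairs {u : ℝ → ℝ} (hu : Measurable u) :
    ∫⁻ p in nearPairs, ENNReal.ofReal ((u p.1 - u p.2) ^ 2 / |p.1 - p.2|) =
      kernelEnergy (nearKernel 1) u := by
  rw [kernelEnergy_eq_lintegral_prod (measurable_nearKernel 1) hu,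
    ← lintegral_indicator measurableSet_nearPairs]
  refine lintegral_congr fun p => ?_
  by_cases hp : p ∈ nearPairs
  · rw [indicator_of_mem hp, ofReal_sq_div, nearKernel, if_pos (show |p.1 - p.2| < 1 from hp)]
  · rw [indicator_of_notMem hp, nearKernel, if_neg (show ¬|p.1 - p.2| < 1 from hp), mul_zero]

theorem measurable_sq_div {u : ℝ → ℝ} (hu : Measurable u) :
    Measurable fun p : ℝ × ℝ => (u p.1 - u p.2) ^ 2 / |p.1 - p.2| := by
  refine Measurable.div (by fun_prop) (by fun_prop)

/-- No finiteness is needed: if the energy is infinite, the Bochner integral and `toReal` both take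
the default value `0`. -/
theorem energy_self_eq {u : ℝ → ℝ} (hu : Measurable u) :
    energy u u = 1 / 2 * (kernelEnergy (nearKernel 1) u).toReal := by
  rw [energy, ← setLIntegral_nearPairs hu, ← integral_eq_lintegral_of_nonneg_ae]
  · simp only [sq]
  · exact Eventually.of_forall fun p => by positivity
  · exact (measurable_sq_div hu).aestronglyMeasurable

theorem energy_self_nonneg (u : ℝ → ℝ) : 0 ≤ energy u u := by
  refine mul_nonneg (by norm_num) (integral_nonneg fun p => ?_)
  exact div_nonneg (mul_self_nonneg _) (abs_nonneg _)

theorem integrableOn_nearPairs_iff {u : ℝ → ℝ} (hu : Measurable u) :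
    IntegrableOn (fun p : ℝ × ℝ => (u p.1 - u p.2) ^ 2 / |p.1 - p.2|) nearPairs ↔
      kernelEnergy (nearKernel 1) u < ⊤ := by
  rw [← setLIntegral_nearPairs hu, IntegrableOn, Integrable,
    and_iff_right (measurable_sq_div hu).aestronglyMeasurable,
    hasFiniteIntegral_iff_ofReal (Eventually.of_forall fun p => by positivity)]

theorem Lp_measurable (u : Lp ℝ 2 (volume : Measure ℝ)) : Measurable u :=
  (Lp.stronglyMeasurable u).measurable

theorem mem_energySpace_iff {L : ℝ} {u : Lp ℝ 2 (volume : Measure ℝ)} :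
    u ∈ energySpace L ↔ (∀ᵐ x : ℝ, x ∉ Ioo 0 L → u x = 0) ∧
      kernelEnergy (nearKernel 1) u < ⊤ := by
  rw [← integrableOn_nearPairs_iff (Lp_measurable u)]
  rfl

/-! ### The forms on the energy space -/

theorem energyL_congr {u u' v v' : ℝ → ℝ} (hu : u =ᵐ[volume] u') (hv : v =ᵐ[volume] v') :
    energyL u v = energyL u' v' := by
  have e1 : energy u v = energy u' v' := by
    rw [energy, energy]
    congr 1
    refine integral_congr_ae (ae_restrict_of_ae ?_)
    filter_upwards [ae_fst hu, ae_snd hu, ae_fst hv, ae_snd hv] with p h1 h2 h3 h4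
    rw [h1, h2, h3, h4]
  have e2 : lowerOrder u v = lowerOrder u' v' := by
    rw [lowerOrder, lowerOrder]
    congr 2
    · refine integral_congr_ae (ae_restrict_of_ae ?_)
      filter_upwards [ae_fst hu, ae_snd hv] with p h1 h2
      rw [h1, h2]
    · refine integral_congr_ae ?_
      filter_upwards [hu, hv] with x h1 h2
      rw [h1, h2]
  rw [energyL, energyL, e1, e2]

theorem lowerOrder_comm (u v : ℝ → ℝ) : lowerOrder u v = lowerOrder v u := by
  have h : ∫ p in farPairs, u p.1 * v p.2 / |p.1 - p.2| =
      ∫ p in farPairs, v p.1 * u p.2 / |p.1 - p.2| := by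
    have hpre : Prod.swap ⁻¹' farPairs = farPairs := by
      ext p
      simp [farPairs, abs_sub_comm]
    have := (Measure.measurePreserving_swap (α := ℝ) (β := ℝ) (μ := volume)
      (ν := volume)).setIntegral_preimage_emb MeasurableEquiv.prodComm.measurableEmbedding
      (fun p : ℝ × ℝ => u p.1 * v p.2 / |p.1 - p.2|) farPairs
    rw [hpre] at this
    rw [Measure.volume_eq_prod, ← this]
    refine integral_congr_ae (Eventually.of_forall fun p => ?_)
    simp only [Prod.fst_swap, Prod.snd_swap, abs_sub_comm p.2 p.1]
    ring
  rw [lowerOrder, lowerOrder, h]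
  congr 2
  exact integral_congr_ae (Eventually.of_forall fun x => mul_comm _ _)

theorem energy_comm (u v : ℝ → ℝ) : energy u v = energy v u := by
  rw [energy, energy]
  congr 1
  exact integral_congr_ae (Eventually.of_forall fun p => by ring)

theorem symmFormOn_energyL (L : ℝ) :
    SymmFormOn (fun u v : Lp ℝ 2 (volume : Measure ℝ) => energyL u v) (energySpace L) where
  add_left _ hu _ hw _ hv := energyL_add_left hu hw hv
  smul_left c u _ v _ := energyL_smul_left c u v
  symm u _ v _ := by rw [energyL, energyL, energy_comm, lowerOrder_comm]

theorem symmFormOn_lowerOrder (L : ℝ) :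
    SymmFormOn (fun u v : Lp ℝ 2 (volume : Measure ℝ) => lowerOrder u v) (energySpace L) where
  add_left u hu w hw v hv := by
    have hae := Lp.coeFn_add u w
    have e2 : ∫ p in farPairs, (u + w : Lp ℝ 2 (volume : Measure ℝ)) p.1 * v p.2 / |p.1 - p.2| =
        (∫ p in farPairs, u p.1 * v p.2 / |p.1 - p.2|) +
          ∫ p in farPairs, w p.1 * v p.2 / |p.1 - p.2| := by
      rw [← integral_add (MemEnergySpace.integrable_lowerOrder hu hv)
        (MemEnergySpace.integrable_lowerOrder hw hv)]
      refine integral_congr_ae (ae_restrict_of_ae ?_)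
      filter_upwards [ae_fst hae] with p h1
      simp only [Pi.add_apply, h1]
      ring
    simp only [lowerOrder, e2, ← inner_eq_integral, inner_add_left]
    ring
  smul_left c u hu v hv := by
    have hae := Lp.coeFn_smul c u
    have e2 : ∫ p in farPairs, (c • u : Lp ℝ 2 (volume : Measure ℝ)) p.1 * v p.2 / |p.1 - p.2| =
        c * ∫ p in farPairs, u p.1 * v p.2 / |p.1 - p.2| := by
      rw [← integral_const_mul]
      refine integral_congr_ae (ae_restrict_of_ae ?_)
      filter_upwards [ae_fst hae] with p h1
      simp only [Pi.smul_apply, smul_eq_mul, h1]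
      ring
    simp only [lowerOrder, e2, ← inner_eq_integral, real_inner_smul_left]
    ring
  symm u _ v _ := lowerOrder_comm _ _

theorem symmFormOn_energy (L : ℝ) :
    SymmFormOn (fun u v : Lp ℝ 2 (volume : Measure ℝ) => energy u v) (energySpace L) := by
  have := (symmFormOn_energyL L).add_const_mul (symmFormOn_lowerOrder L) (-1)
  simpa [energyL] using this

/-- Functions supported in a bounded interval are integrable, with the `L¹` norm controlled by the
`L²` norm. -/
theorem exists_integral_abs_le (L : ℝ) : ∃ c : ℝ, 0 ≤ c ∧ ∀ u ∈ energySpace L,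
    ∫ x, |u x| ≤ c * ‖u‖ := by
  have hfin : volume (Ioo 0 L) ≠ ⊤ := by simp
  refine ⟨‖indicatorConstLp 2 measurableSet_Ioo hfin (1 : ℝ)‖, norm_nonneg _, fun u hu => ?_⟩
  have h1 : ∫ x, |u x| = ∫ x in Ioo 0 L, |u x| := by
    refine (setIntegral_eq_integral_of_ae_compl_eq_zero ?_).symm
    filter_upwards [hu.1] with x hx hx'
    rw [hx hx', abs_zero]
  have h2 : ∫ x in Ioo 0 L, |u x| = ∫ x in Ioo 0 L, |u| x := by
    refine integral_congr_ae (ae_restrict_of_ae ?_)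
    filter_upwards [Lp.coeFn_abs u] with x hx
    rw [hx]
  rw [h1, h2, ← L2.inner_indicatorConstLp_one (𝕜 := ℝ) measurableSet_Ioo hfin]
  refine (real_inner_le_norm _ _).trans_eq ?_
  rw [norm_abs_eq_norm]

/-- The kernel is at most one on `farPairs`, so the double integral is at most the product of the
`L¹` norms, which bounded support turns into `L²` norms. -/
theorem exists_lowerOrder_le (L : ℝ) : ∃ C : ℝ, 0 ≤ C ∧ ∀ u ∈ energySpace L, ∀ v ∈ energySpace L,
    |lowerOrder u v| ≤ C * (‖u‖ * ‖v‖) := by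
  obtain ⟨c, hc, hcu⟩ := exists_integral_abs_le L
  refine ⟨c * c + |rho₁|, by positivity, fun u hu v hv => ?_⟩
  have h1 : |(∫ p in farPairs, u p.1 * v p.2 / |p.1 - p.2|)| ≤ (c * ‖u‖) * (c * ‖v‖) := by
    have hint : Integrable (fun p : ℝ × ℝ => |u p.1| * |v p.2|) :=
      (MemEnergySpace.integrable hu).abs.mul_prod (MemEnergySpace.integrable hv).abs
    calc |(∫ p in farPairs, u p.1 * v p.2 / |p.1 - p.2|)|
        ≤ ∫ p in farPairs, |u p.1| * |v p.2| := by
          refine norm_integral_le_of_norm_le (f := fun p : ℝ × ℝ => u p.1 * v p.2 / |p.1 - p.2|)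
            hint.integrableOn ?_
          refine (ae_restrict_iff' measurableSet_farPairs).2 (Eventually.of_forall fun p hp => ?_)
          rw [Real.norm_eq_abs, abs_div, abs_mul, abs_abs]
          exact div_le_self (by positivity) hp
      _ ≤ ∫ p : ℝ × ℝ, |u p.1| * |v p.2| :=
          setIntegral_le_integral hint (Eventually.of_forall fun p => by positivity)
      _ = (∫ x, |u x|) * ∫ x, |v x| := by
          rw [Measure.volume_eq_prod, integral_prod_mul (fun x => |u x|) (fun y => |v y|)]
      _ ≤ (c * ‖u‖) * (c * ‖v‖) := by
          refine mul_le_mul (hcu u hu) (hcu v hv) (integral_nonneg fun _ => abs_nonneg _)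
            (by positivity)
  have h2 : |rho₁ * ∫ x, u x * v x| ≤ |rho₁| * (‖u‖ * ‖v‖) := by
    rw [abs_mul, ← inner_eq_integral]
    exact mul_le_mul_of_nonneg_left (abs_real_inner_le_norm u v) (abs_nonneg _)
  rw [lowerOrder]
  refine (abs_add_le _ _).trans ?_
  rw [abs_neg]
  linarith

/-! ### Lower semicontinuity -/

/-- Fatou's lemma along an almost everywhere convergent subsequence. The bound on the energies also
forces the limit to have finite energy. -/
theorem energy_le_of_tendsto {L C : ℝ} {u : ℕ → Lp ℝ 2 (volume : Measure ℝ)}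
    {w : Lp ℝ 2 (volume : Measure ℝ)} (hu : ∀ n, u n ∈ energySpace L)
    (hlim : Tendsto u atTop (𝓝 w)) (hC : ∀ᶠ n in atTop, energy (u n) (u n) ≤ C) :
    w ∈ energySpace L ∧ energy w w ≤ C := by
  obtain ⟨ns, hns, hae⟩ := (tendstoInMeasure_of_tendsto_Lp hlim).exists_seq_tendsto_ae
  have hC0 : 0 ≤ C := by
    obtain ⟨n, hn⟩ := hC.exists
    exact (energy_self_nonneg _).trans hn
  have hE : kernelEnergy (nearKernel 1) w ≤ ENNReal.ofReal (2 * C) := by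
    have hm : ∀ v : Lp ℝ 2 (volume : Measure ℝ), Measurable fun p : ℝ × ℝ =>
        ‖v p.1 - v p.2‖ₑ ^ 2 * nearKernel 1 (p.1 - p.2) := by
      intro v
      have h1 := Lp_measurable v
      have h2 := measurable_nearKernel 1
      fun_prop
    calc kernelEnergy (nearKernel 1) w
        = ∫⁻ p : ℝ × ℝ, ‖w p.1 - w p.2‖ₑ ^ 2 * nearKernel 1 (p.1 - p.2) :=
          kernelEnergy_eq_lintegral_prod (measurable_nearKernel 1) (Lp_measurable w)
      _ = ∫⁻ p : ℝ × ℝ, liminf (fun i =>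
            ‖u (ns i) p.1 - u (ns i) p.2‖ₑ ^ 2 * nearKernel 1 (p.1 - p.2)) atTop := by
          refine lintegral_congr_ae ?_
          filter_upwards [ae_fst hae, ae_snd hae] with p h1 h2
          refine (Tendsto.liminf_eq ?_).symm
          refine ENNReal.Tendsto.mul_const ?_ (Or.inr (nearKernel_ne_top _ _))
          exact ENNReal.Tendsto.pow ((h1.sub h2).enorm)
      _ ≤ liminf (fun i => ∫⁻ p : ℝ × ℝ,
            ‖u (ns i) p.1 - u (ns i) p.2‖ₑ ^ 2 * nearKernel 1 (p.1 - p.2)) atTop :=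
          lintegral_liminf_le fun i => hm _
      _ ≤ ENNReal.ofReal (2 * C) := by
          refine liminf_le_of_frequently_le' (Eventually.frequently ?_)
          filter_upwards [hns.tendsto_atTop.eventually hC] with i hi
          rw [← kernelEnergy_eq_lintegral_prod (measurable_nearKernel 1) (Lp_measurable _)]
          rw [energy_self_eq (Lp_measurable _)] at hi
          refine ENNReal.le_ofReal_iff_toReal_le ?_ (by positivity) |>.2 (by linarith)
          exact (mem_energySpace_iff.1 (hu (ns i))).2.ne
  refine ⟨mem_energySpace_iff.2 ⟨?_, hE.trans_lt ENNReal.ofReal_lt_top⟩, ?_⟩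
  · have h0 : ∀ᵐ x : ℝ, ∀ n, x ∉ Ioo 0 L → u n x = 0 := ae_all_iff.2 fun n => (hu n).1
    filter_upwards [hae, h0] with x h1 h2 hx
    refine tendsto_nhds_unique h1 ?_
    simp [h2 _ hx]
  · rw [energy_self_eq (Lp_measurable w)]
    have := ENNReal.toReal_le_of_le_ofReal (by positivity) hE
    linarith

/-- Lower semicontinuity of the form of the logarithmic Laplacian. -/
theorem energyL_le_of_tendsto {L m : ℝ} {u : ℕ → Lp ℝ 2 (volume : Measure ℝ)}
    {w : Lp ℝ 2 (volume : Measure ℝ)} (hu : ∀ n, u n ∈ energySpace L)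
    (hlim : Tendsto u atTop (𝓝 w)) (hm : Tendsto (fun n => energyL (u n) (u n)) atTop (𝓝 m)) :
    w ∈ energySpace L ∧ energyL w w ≤ m := by
  obtain ⟨C, hC0, hC⟩ := exists_lowerOrder_le L
  -- This crude bound serves only to place the limit `w` in the energy space.
  have hbd : ∀ᶠ n in atTop, energy (u n) (u n) ≤ (m + 1) + C * ((‖w‖ + 1) * (‖w‖ + 1)) := by
    filter_upwards [hm.eventually_le_const (lt_add_one m),
      hlim.norm.eventually_le_const (lt_add_one ‖w‖)] with n h1 h2
    have h3 := (abs_le.1 (hC _ (hu n) _ (hu n))).1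
    have h4 : C * (‖u n‖ * ‖u n‖) ≤ C * ((‖w‖ + 1) * (‖w‖ + 1)) := by gcongr
    rw [energyL] at h1
    linarith
  obtain ⟨hw, -⟩ := energy_le_of_tendsto hu hlim hbd
  refine ⟨hw, ?_⟩
  have hB := symmFormOn_lowerOrder L
  -- `lowerOrder` is continuous in `L²`, so the singular parts converge to `m - lowerOrder w w`, and
  -- semicontinuity applies with every larger constant.
  have hlow : Tendsto (fun n => lowerOrder (u n) (u n)) atTop (𝓝 (lowerOrder w w)) := by
    rw [tendsto_iff_dist_tendsto_zero]
    have h0 : Tendsto (fun n => C * (‖u n - w‖ * (‖u n‖ + ‖w‖))) atTop (𝓝 0) := by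
      have h1 := tendsto_iff_norm_sub_tendsto_zero.1 hlim
      simpa using (h1.mul (hlim.norm.add_const ‖w‖)).const_mul C
    refine squeeze_zero (fun n => dist_nonneg) (fun n => ?_) h0
    have hd := (energySpace L).sub_mem (hu n) hw
    have e1 := hB.sub_left (hu n) hw (hu n)
    have e2 := hB.sub_right (hu n) hw hw
    have b1 := hC _ hd _ (hu n)
    have b2 := hC _ hw _ hd
    have e3 : lowerOrder (u n) (u n) - lowerOrder w w =
        lowerOrder ((u n - w : Lp ℝ 2 (volume : Measure ℝ))) (u n) +
          lowerOrder w ((u n - w : Lp ℝ 2 (volume : Measure ℝ))) := by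
      rw [e1, e2, lowerOrder_comm w (u n)]
      ring
    rw [Real.dist_eq, e3]
    refine (abs_add_le _ _).trans ?_
    linarith
  refine le_of_forall_pos_le_add fun ε hε => ?_
  have hlim2 : Tendsto (fun n => energy (u n) (u n)) atTop (𝓝 (m - lowerOrder w w)) :=
    (hm.sub hlow).congr fun n => by rw [energyL]; ring
  have := (energy_le_of_tendsto hu hlim
    (hlim2.eventually_le_const (lt_add_of_pos_right _ hε))).2
  rw [energyL]
  linarith

/-! ### Compactness of the embedding into `L²` -/

/-- If a form dominates arbitrarily large multiples of the squared norm up to finitely many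
functionals, its sublevel sets in the unit ball are totally bounded. -/
theorem totallyBounded_sublevel {X : Type} [NormedAddCommGroup X] [InnerProductSpace ℝ X]
    {a : X → X → ℝ} {W : Submodule ℝ X} (ha : SymmFormOn a W) (hpos : ∀ u ∈ W, 0 ≤ a u u)
    (hcoer : ∀ J : ℕ, ∃ (ι : Type) (T : Finset ι) (b : ι → X) (K : ℝ), ∀ g ∈ W,
      J * ‖g‖ ^ 2 ≤ 2 * a g g + K * ∑ i ∈ T, inner ℝ (b i) g ^ 2) (C : ℝ) :
    TotallyBounded {u | u ∈ W ∧ ‖u‖ ≤ 1 ∧ a u u ≤ C} := by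
  refine Metric.totallyBounded_of_finite_discretization fun ε hε => ?_
  -- Two elements with the same discretisation will satisfy `J ‖u - v‖² ≤ 2 (4 C) + 1`: the `4 C`
  -- comes from the parallelogram law, the `1` from the functionals.
  obtain ⟨J, hJ⟩ := exists_nat_gt ((8 * C + 1) / ε ^ 2)
  obtain ⟨ι, T, b, K, hK⟩ := hcoer J
  obtain ⟨η, hη, hηK⟩ : ∃ η : ℝ, 0 < η ∧ |K| * (T.card * η ^ 2) ≤ 1 := by
    have : Tendsto (fun η : ℝ => |K| * (T.card * η ^ 2)) (𝓝[>] 0) (𝓝 0) := by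
      have h : Continuous fun η : ℝ => |K| * (T.card * η ^ 2) := by fun_prop
      have := (h.tendsto 0).mono_left (nhdsWithin_le_nhds (s := Ioi 0))
      simpa using this
    obtain ⟨η, h1, h2⟩ := ((this.eventually_le_const one_pos).and self_mem_nhdsWithin).exists
    exact ⟨η, h2, h1⟩
  obtain ⟨N, hN⟩ : ∃ N : ℕ, ∀ i ∈ T, ‖b i‖ / η + 1 ≤ N := by
    obtain ⟨N, hN⟩ := exists_nat_ge (∑ i ∈ T, (‖b i‖ / η + 1))
    refine ⟨N, fun i hi => le_trans ?_ hN⟩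
    exact Finset.single_le_sum (f := fun i => ‖b i‖ / η + 1) (fun i _ => by positivity) hi
  have hfloor : ∀ u : X, ‖u‖ ≤ 1 → ∀ i ∈ T, ⌊inner ℝ (b i) u / η⌋ ∈ Finset.Icc (-(N : ℤ)) N := by
    intro u hu i hi
    have h1 : |inner ℝ (b i) u / η| ≤ ‖b i‖ / η := by
      rw [abs_div, abs_of_pos hη]
      gcongr
      exact (abs_real_inner_le_norm _ _).trans (mul_le_of_le_one_right (norm_nonneg _) hu)
    have h2 := hN i hi
    rw [abs_le] at h1
    rw [Finset.mem_Icc]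
    constructor
    · rw [Int.le_floor]
      push_cast
      linarith
    · have : (⌊inner ℝ (b i) u / η⌋ : ℝ) ≤ N := (Int.floor_le _).trans (by linarith)
      exact_mod_cast this
  -- The discretisation records each functional rounded down to a multiple of `η`. On the unit ball
  -- only finitely many values occur.
  refine ⟨(T → Finset.Icc (-(N : ℤ)) N), Fintype.ofFinite _,
    fun u i => ⟨⌊inner ℝ (b i) (u : X) / η⌋, hfloor u u.2.2.1 i i.2⟩, ?_⟩
  rintro ⟨u, hu, hu1, hu2⟩ ⟨v, hv, hv1, hv2⟩ huv
  have hclose : ∀ i ∈ T, inner ℝ (b i) (u - v) ^ 2 ≤ η ^ 2 := by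
    intro i hi
    have h1 : ⌊inner ℝ (b i) u / η⌋ = ⌊inner ℝ (b i) v / η⌋ :=
      congrArg Subtype.val (congrFun huv ⟨i, hi⟩)
    have h2 := Int.abs_sub_lt_one_of_floor_eq_floor h1
    rw [← sub_div, ← inner_sub_right, abs_div, abs_of_pos hη, div_lt_one hη] at h2
    exact sq_le_sq.2 (by rw [abs_of_pos hη]; exact h2.le)
  have h1 := hK (u - v) (W.sub_mem hu hv)
  have h2 : a (u - v) (u - v) ≤ 4 * C := by
    have e1 := ha.apply_add_smul hu hv (-1)
    have e2 := ha.apply_add_smul hu hv 1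
    have e3 := hpos _ (W.add_mem hu (W.smul_mem 1 hv))
    rw [neg_one_smul, ← sub_eq_add_neg] at e1
    rw [e1]
    rw [e2] at e3
    linarith
  have h3 : K * ∑ i ∈ T, inner ℝ (b i) (u - v) ^ 2 ≤ 1 := by
    have h4 : ∑ i ∈ T, inner ℝ (b i) (u - v) ^ 2 ≤ T.card * η ^ 2 := by
      rw [← nsmul_eq_mul]
      exact Finset.sum_le_card_nsmul _ _ _ hclose
    have h5 : 0 ≤ ∑ i ∈ T, inner ℝ (b i) (u - v) ^ 2 := Finset.sum_nonneg fun _ _ => sq_nonneg _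
    calc K * ∑ i ∈ T, inner ℝ (b i) (u - v) ^ 2
        ≤ |K| * ∑ i ∈ T, inner ℝ (b i) (u - v) ^ 2 := by gcongr; exact le_abs_self K
      _ ≤ |K| * (T.card * η ^ 2) := by gcongr
      _ ≤ 1 := hηK
  rw [div_lt_iff₀ (by positivity)] at hJ
  have hC0 : 0 ≤ C := (hpos u hu).trans hu2
  have hJ0 : 0 < (J : ℝ) := by
    by_contra hc
    nlinarith [sq_nonneg ε]
  rw [dist_eq_norm]
  have h6 : ‖u - v‖ ^ 2 < ε ^ 2 := by
    have : J * ‖u - v‖ ^ 2 < J * ε ^ 2 := by linarith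
    exact lt_of_mul_lt_mul_left this hJ0.le
  exact lt_of_pow_lt_pow_left₀ 2 hε.le h6

/-! ### Dyadic decomposition of the singular kernel. -/

/-- The dyadic interval `[i 2⁻ʲ, (i+1) 2⁻ʲ)`. -/
def dyadicCell (j : ℕ) (i : ℤ) : Set ℝ := {x | ⌊(2 : ℝ) ^ j * x⌋ = i}

theorem dyadicCell_eq_Ico (j : ℕ) (i : ℤ) :
    dyadicCell j i = Ico (i / (2 : ℝ) ^ j) ((i + 1) / (2 : ℝ) ^ j) := by
  ext x
  have : (0 : ℝ) < 2 ^ j := by positivity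
  rw [dyadicCell, mem_ofPred_eq, Int.floor_eq_iff, mem_Ico, div_le_iff₀' this, lt_div_iff₀' this]

theorem measurableSet_dyadicCell (j : ℕ) (i : ℤ) : MeasurableSet (dyadicCell j i) := by
  rw [dyadicCell_eq_Ico]
  exact measurableSet_Ico

theorem volume_dyadicCell (j : ℕ) (i : ℤ) : volume (dyadicCell j i) ≠ ⊤ := by
  rw [dyadicCell_eq_Ico]
  simp

theorem volume_real_dyadicCell (j : ℕ) (i : ℤ) :
    volume.real (dyadicCell j i) = ((2 : ℝ) ^ j)⁻¹ := by
  rw [dyadicCell_eq_Ico, Real.volume_real_Ico_of_le]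
  · ring
  · gcongr
    linarith

/-- A geometric sum is less than twice its last term, and every term that counts is below `1/d`. -/
theorem sum_two_pow_ite_le (J : ℕ) {d : ℝ} (hd : 0 < d) :
    ∑ j ∈ Finset.range J, (if (2 : ℝ) ^ j * d < 1 then (2 : ℝ) ^ j else 0) ≤ 2 / d := by
  induction J with
  | zero => simp; positivity
  | succ J ih =>
    rw [Finset.sum_range_succ]
    split_ifs with h
    · have h1 : ∑ j ∈ Finset.range J, (if (2 : ℝ) ^ j * d < 1 then (2 : ℝ) ^ j else 0) ≤
          ∑ j ∈ Finset.range J, (2 : ℝ) ^ j := by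
        refine Finset.sum_le_sum fun j _ => ?_
        split_ifs
        · exact le_rfl
        · positivity
      have h2 : ∑ j ∈ Finset.range J, (2 : ℝ) ^ j = 2 ^ J - 1 := by
        rw [geom_sum_eq (by norm_num)]
        norm_num
      rw [le_div_iff₀ hd]
      nlinarith
    · simpa using ih

theorem abs_sub_lt_of_floor_eq {j : ℕ} {x y : ℝ} (h : ⌊(2 : ℝ) ^ j * y⌋ = ⌊(2 : ℝ) ^ j * x⌋) :
    (2 : ℝ) ^ j * |x - y| < 1 := by
  have := Int.abs_sub_lt_one_of_floor_eq_floor h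
  rwa [← mul_sub, abs_mul, abs_of_pos (by positivity), abs_sub_comm] at this

/-- A sum of dyadic kernels is dominated by `2/|x-y|`. -/
theorem sum_dyadic_mul_sq_le (J : ℕ) (s : ℕ → Finset ℤ) (g : ℝ → ℝ) (p : ℝ × ℝ) :
    ∑ j ∈ Finset.range J, ∑ i ∈ s j, (dyadicCell j i ×ˢ dyadicCell j i).indicator
      (fun p => (2 : ℝ) ^ j * (g p.1 - g p.2) ^ 2) p ≤
    nearPairs.indicator (fun p => 2 * ((g p.1 - g p.2) ^ 2 / |p.1 - p.2|)) p := by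
  obtain ⟨x, y⟩ := p
  rcases eq_or_ne x y with rfl | hxy
  · rw [Finset.sum_eq_zero fun j _ => Finset.sum_eq_zero fun i _ => by simp]
    exact indicator_nonneg (fun _ _ => by positivity) _
  have hd : 0 < |x - y| := abs_pos.2 (sub_ne_zero.2 hxy)
  -- In generation `j` at most one cell contains both points, and if one does, then `2 ^ j * |x - y|
  -- < 1`.
  have h1 : ∀ j ∈ Finset.range J, ∑ i ∈ s j, (dyadicCell j i ×ˢ dyadicCell j i).indicator
      (fun p : ℝ × ℝ => (2 : ℝ) ^ j * (g p.1 - g p.2) ^ 2) (x, y) ≤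
      (if (2 : ℝ) ^ j * |x - y| < 1 then (2 : ℝ) ^ j else 0) * (g x - g y) ^ 2 := by
    intro j _
    have : ∀ i : ℤ, (dyadicCell j i ×ˢ dyadicCell j i).indicator
        (fun p : ℝ × ℝ => (2 : ℝ) ^ j * (g p.1 - g p.2) ^ 2) (x, y) =
        if ⌊(2 : ℝ) ^ j * x⌋ = i then
          (if ⌊(2 : ℝ) ^ j * y⌋ = i then (2 : ℝ) ^ j * (g x - g y) ^ 2 else 0) else 0 := by
      intro i
      by_cases h2 : ⌊(2 : ℝ) ^ j * x⌋ = i <;> by_cases h3 : ⌊(2 : ℝ) ^ j * y⌋ = i <;>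
        simp [indicator, dyadicCell, h2, h3]
    simp only [this, Finset.sum_ite_eq]
    split_ifs with h2 h3 h4 h4
    · exact le_rfl
    · exact absurd (abs_sub_lt_of_floor_eq h3) h4
    all_goals positivity
  refine (Finset.sum_le_sum h1).trans ?_
  rw [← Finset.sum_mul]
  by_cases hn : |x - y| < 1
  · rw [indicator_of_mem (show (x, y) ∈ nearPairs from hn)]
    calc _ ≤ 2 / |x - y| * (g x - g y) ^ 2 := by
          gcongr
          exact sum_two_pow_ite_le J hd
      _ = _ := by simp only; ring
  · rw [indicator_of_notMem (show (x, y) ∉ nearPairs from hn), Finset.sum_eq_zero, zero_mul]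
    intro j _
    rw [if_neg]
    have : (1 : ℝ) ≤ 2 ^ j := one_le_pow₀ (by norm_num)
    nlinarith

/-- The variance identity: expand the square and apply Fubini. -/
theorem setIntegral_sq_sub {g : ℝ → ℝ} {c : Set ℝ} (hc : volume c ≠ ⊤)
    (hg : IntegrableOn g c) (hg2 : IntegrableOn (fun x => g x ^ 2) c) :
    IntegrableOn (fun p : ℝ × ℝ => (g p.1 - g p.2) ^ 2) (c ×ˢ c) ∧
    ∫ p in c ×ˢ c, (g p.1 - g p.2) ^ 2 =
      2 * volume.real c * (∫ x in c, g x ^ 2) - 2 * (∫ x in c, g x) ^ 2 := by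
  have h1 : IntegrableOn (fun _ : ℝ => (1 : ℝ)) c := integrableOn_const hc
  have hr : (volume : Measure (ℝ × ℝ)).restrict (c ×ˢ c) =
      (volume.restrict c).prod (volume.restrict c) := by
    rw [Measure.volume_eq_prod, Measure.prod_restrict]
  have i1 : Integrable (fun p : ℝ × ℝ => g p.1 ^ 2 * 1)
      ((volume.restrict c).prod (volume.restrict c)) := hg2.mul_prod h1
  have i2 : Integrable (fun p : ℝ × ℝ => 1 * g p.2 ^ 2)
      ((volume.restrict c).prod (volume.restrict c)) := Integrable.mul_prod h1 hg2
  have i3 : Integrable (fun p : ℝ × ℝ => g p.1 * g p.2)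
      ((volume.restrict c).prod (volume.restrict c)) := Integrable.mul_prod hg hg
  have e : (fun p : ℝ × ℝ => (g p.1 - g p.2) ^ 2) =
      fun p => g p.1 ^ 2 * 1 + 1 * g p.2 ^ 2 - 2 * (g p.1 * g p.2) := by
    funext p
    ring
  rw [IntegrableOn, hr, e]
  have i12 : Integrable (fun p : ℝ × ℝ => g p.1 ^ 2 * 1 + 1 * g p.2 ^ 2)
      ((volume.restrict c).prod (volume.restrict c)) := i1.add i2
  have j2 := integral_prod_mul (μ := volume.restrict c) (ν := volume.restrict c)
    (fun _ : ℝ => (1 : ℝ)) (fun x => g x ^ 2)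
  refine ⟨i12.sub (i3.const_mul 2), ?_⟩
  rw [integral_sub i12 (i3.const_mul 2), integral_add i1 i2, j2, integral_const_mul,
    integral_prod_mul (fun x => g x ^ 2) (fun _ => (1 : ℝ)), integral_prod_mul g g]
  simp only [integral_const, smul_eq_mul, mul_one, measureReal_restrict_apply_univ]
  ring

/-- The energy controls large multiples of the `L²` norm, up to finitely many averages. -/
theorem mul_norm_sq_le_energy (L : ℝ) (J : ℕ) {g : Lp ℝ 2 (volume : Measure ℝ)}
    (hg : g ∈ energySpace L) :
    J * ‖g‖ ^ 2 ≤ 2 * energy g g + ∑ j ∈ Finset.range J,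
      ∑ i ∈ Finset.Ico (0 : ℤ) (⌈L⌉ * 2 ^ j), 2 ^ j * (∫ x in dyadicCell j i, g x) ^ 2 := by
  have hi1 : Integrable g := MemEnergySpace.integrable hg
  have hi2 : Integrable fun x => g x ^ 2 := by simpa [sq] using integrable_mul g g
  -- These indices are those of cells that cover `(0,L)`.
  set s : ℕ → Finset ℤ := fun j => Finset.Ico (0 : ℤ) (⌈L⌉ * 2 ^ j) with hs
  have hcell : ∀ j, ∑ i ∈ s j, ∫ x in dyadicCell j i, g x ^ 2 = ‖g‖ ^ 2 := by
    intro j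
    have h1 : ∀ i ∈ s j, ∫ x in dyadicCell j i, g x ^ 2 =
        ∫ x, (dyadicCell j i).indicator (fun x => g x ^ 2) x := fun i _ =>
      (integral_indicator (measurableSet_dyadicCell j i)).symm
    rw [Finset.sum_congr rfl h1, ← integral_finsetSum _ fun i _ =>
      hi2.indicator (measurableSet_dyadicCell j i), ← real_inner_self_eq_norm_sq,
      inner_eq_integral]
    refine integral_congr_ae ?_
    filter_upwards [hg.1] with x hx
    have h2 : ∀ i, (dyadicCell j i).indicator (fun x => g x ^ 2) x =
        if ⌊(2 : ℝ) ^ j * x⌋ = i then g x ^ 2 else 0 := fun i => by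
      by_cases h4 : ⌊(2 : ℝ) ^ j * x⌋ = i <;> simp [indicator, dyadicCell, h4]
    simp only [h2, Finset.sum_ite_eq]
    split_ifs with h3
    · ring
    · rw [hx, mul_zero]
      intro h4
      refine h3 (Finset.mem_Ico.2 ⟨Int.floor_nonneg.2 (by have := h4.1; positivity), ?_⟩)
      rw [Int.floor_lt]
      push_cast
      have : x < ⌈L⌉ := h4.2.trans_le (Int.le_ceil L)
      have h5 : (0 : ℝ) < 2 ^ j := by positivity
      nlinarith
  have hsq : ∀ j i, IntegrableOn (fun p : ℝ × ℝ => (g p.1 - g p.2) ^ 2)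
      (dyadicCell j i ×ˢ dyadicCell j i) ∧ _ := fun j i =>
    setIntegral_sq_sub (volume_dyadicCell j i) hi1.integrableOn hi2.integrableOn
  have hmeas : ∀ j i, MeasurableSet (dyadicCell j i ×ˢ dyadicCell j i) := fun j i =>
    (measurableSet_dyadicCell j i).prod (measurableSet_dyadicCell j i)
  have hind : ∀ j i, Integrable ((dyadicCell j i ×ˢ dyadicCell j i).indicator
      (fun p : ℝ × ℝ => (2 : ℝ) ^ j * (g p.1 - g p.2) ^ 2)) := fun j i =>
    (integrable_indicator_iff (hmeas j i)).2 ((hsq j i).1.const_mul _)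
  have hnear : Integrable (nearPairs.indicator
      (fun p : ℝ × ℝ => 2 * ((g p.1 - g p.2) ^ 2 / |p.1 - p.2|))) :=
    (integrable_indicator_iff measurableSet_nearPairs).2 (hg.2.const_mul 2)
  have hmain := integral_mono (integrable_finsetSum (Finset.range J) fun j _ =>
    integrable_finsetSum (s j) fun i _ => hind j i) hnear (fun p => by
      simpa using sum_dyadic_mul_sq_le J s g p)
  rw [integral_indicator measurableSet_nearPairs, integral_const_mul,
    integral_finsetSum _ fun j _ => integrable_finsetSum (s j) fun i _ => hind j i] at hmain
  -- Since `2 ^ j` times the cell length is one, every generation contributes the same `2 ‖g‖²`,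
  -- minus averages. Summing `J` generations yields the factor `J`; this reflects that `1/|x-y|` is
  -- not integrable at the diagonal.
  have hterm : ∀ j ∈ Finset.range J, (∫ p : ℝ × ℝ, ∑ i ∈ s j,
      (dyadicCell j i ×ˢ dyadicCell j i).indicator
        (fun p : ℝ × ℝ => (2 : ℝ) ^ j * (g p.1 - g p.2) ^ 2) p) =
      2 * ‖g‖ ^ 2 - 2 * ∑ i ∈ s j, 2 ^ j * (∫ x in dyadicCell j i, g x) ^ 2 := by
    intro j _
    rw [integral_finsetSum _ fun i _ => hind j i, ← hcell j, Finset.mul_sum, Finset.mul_sum,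
      ← Finset.sum_sub_distrib]
    refine Finset.sum_congr rfl fun i _ => ?_
    rw [integral_indicator (hmeas j i), integral_const_mul, (hsq j i).2, volume_real_dyadicCell]
    field_simp
  rw [Finset.sum_congr rfl hterm, Finset.sum_sub_distrib, Finset.sum_const,
    Finset.card_range, nsmul_eq_mul] at hmain
  have hen : energy g g = 1 / 2 * ∫ p in nearPairs, (g p.1 - g p.2) ^ 2 / |p.1 - p.2| := by
    simp only [energy, sq]
  rw [hen]
  simp only [← Finset.mul_sum] at hmain ⊢
  linarith

/-- On unit vectors the two forms differ by at most `B`. The functionals are integrals over dyadic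
cells, and `2 ^ J` bounds all their weights. -/
theorem totallyBounded_energyL (L C : ℝ) :
    TotallyBounded {u | u ∈ energySpace L ∧ ‖u‖ = 1 ∧ energyL u u ≤ C} := by
  obtain ⟨B, hB0, hB⟩ := exists_lowerOrder_le L
  refine (totallyBounded_sublevel (symmFormOn_energy L) (fun u _ => energy_self_nonneg u)
    (fun J => ?_) (C + B)).subset ?_
  · let T : Finset (Σ _ : ℕ, ℤ) :=
      (Finset.range J).sigma fun j => Finset.Ico (0 : ℤ) (⌈L⌉ * 2 ^ j)
    refine ⟨Σ _ : ℕ, ℤ, T, fun q => indicatorConstLp 2 (measurableSet_dyadicCell q.1 q.2)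
      (volume_dyadicCell q.1 q.2) (1 : ℝ), 2 ^ J, fun g hg => ?_⟩
    refine (mul_norm_sq_le_energy L J hg).trans (add_le_add le_rfl ?_)
    simp only [L2.inner_indicatorConstLp_one]
    rw [Finset.sum_sigma, Finset.mul_sum]
    refine Finset.sum_le_sum fun j hj => ?_
    rw [Finset.mul_sum]
    refine Finset.sum_le_sum fun i _ => ?_
    gcongr
    · norm_num
    · exact (Finset.mem_range.1 hj).le
  · rintro u ⟨hu, hu1, hu2⟩
    refine ⟨hu, hu1.le, ?_⟩
    have := (abs_le.1 (hB u hu u hu)).1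
    rw [hu1] at this
    rw [energyL] at hu2
    linarith

/-! ### Existence of minimisers by the direct method. -/

/-- The form of the logarithmic Laplacian is bounded below. -/
theorem exists_le_energyL (L : ℝ) : ∃ C : ℝ, ∀ u ∈ energySpace L,
    -(C * ‖u‖ ^ 2) ≤ energyL u u := by
  obtain ⟨B, -, hB⟩ := exists_lowerOrder_le L
  refine ⟨B, fun u hu => ?_⟩
  have := (abs_le.1 (hB u hu u hu)).1
  have := energy_self_nonneg u
  rw [energyL]
  linarith

/-- The form of the logarithmic Laplacian attains its minimum on the unit vectors that are
orthogonal to given ones. -/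
theorem exists_minimizer_energyL (L : ℝ) (k : ℕ) (f : ℕ → Lp ℝ 2 (volume : Measure ℝ))
    (hne : ∃ u ∈ energySpace L, ‖u‖ = 1 ∧ ∀ j < k, inner ℝ (f j) u = 0) :
    ∃ u ∈ energySpace L, ‖u‖ = 1 ∧ (∀ j < k, inner ℝ (f j) u = 0) ∧
      ∀ v ∈ energySpace L, ‖v‖ = 1 → (∀ j < k, inner ℝ (f j) v = 0) →
        energyL u u ≤ energyL v v := by
  set A : Set (Lp ℝ 2 (volume : Measure ℝ)) :=
    {u | u ∈ energySpace L ∧ ‖u‖ = 1 ∧ ∀ j < k, inner ℝ (f j) u = 0} with hA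
  set S : Set ℝ := (fun u : Lp ℝ 2 (volume : Measure ℝ) => energyL u u) '' A with hS
  obtain ⟨u₀, hu₀⟩ := hne
  have hSne : S.Nonempty := ⟨_, u₀, hu₀, rfl⟩
  have hSbdd : BddBelow S := by
    obtain ⟨C, hC⟩ := exists_le_energyL L
    refine ⟨-C, ?_⟩
    rintro _ ⟨u, hu, rfl⟩
    have := hC u hu.1
    rw [hu.2.1] at this
    simpa using this
  obtain ⟨c, -, hc, hcS⟩ := exists_seq_tendsto_sInf hSne hSbdd
  choose u hu huc using hcS
  have htend : Tendsto (fun n => energyL (u n) (u n)) atTop (𝓝 (sInf S)) :=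
    hc.congr fun n => (huc n).symm
  obtain ⟨N, hN⟩ := eventually_atTop.1 (htend.eventually_le_const (lt_add_one _))
  have hcomp := (TotallyBounded.closure
    (totallyBounded_energyL L (sInf S + 1))).isCompact_of_isClosed isClosed_closure
  -- The shift by `N` keeps only terms of energy at most `sInf S + 1`, which lie in a totally
  -- bounded set.
  obtain ⟨w, -, φ, hφ, hw⟩ := hcomp.tendsto_subseq (x := fun n => u (n + N)) fun n =>
    subset_closure ⟨(hu _).1, (hu _).2.1, hN _ (Nat.le_add_left N n)⟩
  have hφ' : Tendsto (fun n => φ n + N) atTop atTop :=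
    (tendsto_add_atTop_nat N).comp hφ.tendsto_atTop
  obtain ⟨hwm, hwe⟩ := energyL_le_of_tendsto (fun n => (hu (φ n + N)).1) hw (htend.comp hφ')
  refine ⟨w, hwm, ?_, fun j hj => ?_, fun v hv hv1 hv2 => hwe.trans (csInf_le hSbdd
    ⟨v, ⟨hv, hv1, hv2⟩, rfl⟩)⟩
  · refine tendsto_nhds_unique hw.norm ?_
    simp [(hu _).2.1]
  · have h1 : Tendsto (fun n => inner ℝ (f j) (u (φ n + N))) atTop (𝓝 (inner ℝ (f j) w)) :=
      tendsto_const_nhds.inner hw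
    refine tendsto_nhds_unique h1 ?_
    simp [(hu _).2.2 j hj]

/-! ### Mollification -/

theorem enorm_sq_eq_ofReal (a : ℝ) : ‖a‖ₑ ^ 2 = ENNReal.ofReal (a ^ 2) := by
  rw [Real.enorm_eq_ofReal_abs, ← ENNReal.ofReal_pow (abs_nonneg a), sq_abs]

theorem enorm_sub_sq_le (a b : ℝ) : ‖a - b‖ₑ ^ 2 ≤ 2 * ‖a‖ₑ ^ 2 + 2 * ‖b‖ₑ ^ 2 := by
  have h : (2 : ℝ≥0∞) = ENNReal.ofReal 2 := by simp
  rw [enorm_sq_eq_ofReal, enorm_sq_eq_ofReal, enorm_sq_eq_ofReal, h,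
    ← ENNReal.ofReal_mul (by norm_num), ← ENNReal.ofReal_mul (by norm_num),
    ← ENNReal.ofReal_add (by positivity) (by positivity)]
  refine ENNReal.ofReal_le_ofReal ?_
  nlinarith [sq_nonneg (a + b)]

theorem eLpNorm_two_sq {α : Type*} [MeasurableSpace α] (μ : Measure α) (f : α → ℝ) :
    eLpNorm f 2 μ ^ 2 = ∫⁻ x, ‖f x‖ₑ ^ 2 ∂μ := by
  have h := eLpNorm_nnreal_pow_eq_lintegral (μ := μ) (f := f) (p := 2) two_ne_zero
  simpa using h

/-- Jensen's inequality for the square. -/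
theorem enorm_integral_sq_le {P : Measure ℝ} [IsProbabilityMeasure P] {X : ℝ → ℝ}
    (hX : AEStronglyMeasurable X P) : ‖∫ t, X t ∂P‖ₑ ^ 2 ≤ ∫⁻ t, ‖X t‖ₑ ^ 2 ∂P := by
  rw [← eLpNorm_two_sq]
  gcongr
  refine (enorm_integral_le_lintegral_enorm _).trans ?_
  rw [← eLpNorm_one_eq_lintegral_enorm]
  exact eLpNorm_le_eLpNorm_of_exponent_le one_le_two hX

/-- Averaging over translations does not increase the energy. -/
theorem kernelEnergy_average_le {P : Measure ℝ} [IsProbabilityMeasure P] {u : ℝ → ℝ}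
    (hu : Measurable u) (hP : ∀ x, Integrable (fun t => u (x - t)) P) {k : ℝ → ℝ≥0∞}
    (hk : Measurable k) : kernelEnergy k (fun x => ∫ t, u (x - t) ∂P) ≤ kernelEnergy k u := by
  calc kernelEnergy k (fun x => ∫ t, u (x - t) ∂P)
      ≤ ∫⁻ x, ∫⁻ y, (∫⁻ t, ‖u (x - t) - u (y - t)‖ₑ ^ 2 * k (x - y) ∂P) := by
        refine lintegral_mono fun x => lintegral_mono fun y => ?_
        simp only
        rw [← integral_sub (hP x) (hP y), lintegral_mul_const _ (by fun_prop)]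
        gcongr
        exact enorm_integral_sq_le ((hP x).sub (hP y)).aestronglyMeasurable
    _ = ∫⁻ x, (∫⁻ t, (∫⁻ y, ‖u (x - t) - u (y - t)‖ₑ ^ 2 * k (x - y)) ∂P) := by
        refine lintegral_congr fun x => lintegral_lintegral_swap ?_
        refine Measurable.aemeasurable ?_
        change Measurable fun q : ℝ × ℝ => ‖u (x - q.2) - u (q.1 - q.2)‖ₑ ^ 2 * k (x - q.1)
        fun_prop
    _ = ∫⁻ t, (∫⁻ x, ∫⁻ y, ‖u (x - t) - u (y - t)‖ₑ ^ 2 * k (x - y)) ∂P := by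
        refine lintegral_lintegral_swap (Measurable.aemeasurable ?_)
        have hG : Measurable fun q : (ℝ × ℝ) × ℝ =>
            ‖u (q.1.1 - q.1.2) - u (q.2 - q.1.2)‖ₑ ^ 2 * k (q.1.1 - q.2) := by fun_prop
        exact hG.lintegral_prod_right'
    _ = ∫⁻ _, kernelEnergy k u ∂P := by
        -- Translating both variables by `t` leaves `x - y`, hence the kernel, unchanged.
        refine lintegral_congr fun t => ?_
        rw [kernelEnergy, ← lintegral_sub_right_eq_self
          (fun x => ∫⁻ y, ‖u x - u y‖ₑ ^ 2 * k (x - y)) t]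
        refine lintegral_congr fun x => ?_
        rw [← lintegral_sub_right_eq_self (fun y => ‖u (x - t) - u y‖ₑ ^ 2 * k (x - t - y)) t]
        refine lintegral_congr fun y => ?_
        rw [sub_sub_sub_cancel_right]
    _ = kernelEnergy k u := by simp

theorem lintegral_comp_mul_left {g : ℝ → ℝ≥0∞} (hg : Measurable g) {σ : ℝ} (hσ : 0 < σ) :
    ∫⁻ x, g (σ * x) = ENNReal.ofReal σ⁻¹ * ∫⁻ x, g x := by
  rw [← lintegral_map hg (measurable_const_mul σ), Real.map_volume_mul_left hσ.ne',
    lintegral_smul_measure, abs_of_pos (inv_pos.2 hσ), smul_eq_mul]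

theorem nearKernel_scale (δ z : ℝ) {σ : ℝ} (hσ : 0 < σ) :
    nearKernel δ z = ENNReal.ofReal σ * nearKernel (σ * δ) (σ * z) := by
  rw [nearKernel, nearKernel, abs_mul, abs_of_pos hσ]
  by_cases h : |z| < δ
  · rw [if_pos h, if_pos (by gcongr), ← ENNReal.ofReal_mul hσ.le]
    congr 1
    rw [mul_inv, ← mul_assoc, mul_inv_cancel₀ hσ.ne', one_mul]
  · rw [if_neg h, if_neg fun hc => h (lt_of_mul_lt_mul_left hc hσ.le), mul_zero]

/-- Compression of the variable does not increase the energy near the diagonal. -/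
theorem kernelEnergy_comp_mul_le {f : ℝ → ℝ} (hf : Measurable f) (δ : ℝ) {σ : ℝ} (hσ : 1 ≤ σ) :
    kernelEnergy (nearKernel δ) (fun x => f (σ * x)) ≤ kernelEnergy (nearKernel (σ * δ)) f := by
  have hσ0 : 0 < σ := by linarith
  have hk := measurable_nearKernel (σ * δ)
  have hG : Measurable fun q : ℝ × ℝ =>
      ‖f q.1 - f q.2‖ₑ ^ 2 * nearKernel (σ * δ) (q.1 - q.2) := by fun_prop
  -- The kernel is homogeneous of degree `-1`, which cancels the Jacobian of one substitution. The
  -- other leaves a factor `σ⁻¹ ≤ 1`.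
  have h1 : ∀ x, ∫⁻ y, ‖f (σ * x) - f (σ * y)‖ₑ ^ 2 * nearKernel δ (x - y) =
      ∫⁻ y, ‖f (σ * x) - f y‖ₑ ^ 2 * nearKernel (σ * δ) (σ * x - y) := by
    intro x
    have e : ∀ y, ‖f (σ * x) - f (σ * y)‖ₑ ^ 2 * nearKernel δ (x - y) =
        ENNReal.ofReal σ * (fun y => ‖f (σ * x) - f y‖ₑ ^ 2 *
          nearKernel (σ * δ) (σ * x - y)) (σ * y) := by
      intro y
      rw [nearKernel_scale δ (x - y) hσ0, mul_sub]
      ring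
    simp only [e]
    rw [lintegral_const_mul _ (by fun_prop), lintegral_comp_mul_left (g := fun y =>
      ‖f (σ * x) - f y‖ₑ ^ 2 * nearKernel (σ * δ) (σ * x - y)) (by fun_prop) hσ0,
      ← mul_assoc, ← ENNReal.ofReal_mul hσ0.le, mul_inv_cancel₀ hσ0.ne', ENNReal.ofReal_one,
      one_mul]
  calc kernelEnergy (nearKernel δ) (fun x => f (σ * x))
      = ∫⁻ x, (fun x => ∫⁻ y, ‖f x - f y‖ₑ ^ 2 * nearKernel (σ * δ) (x - y)) (σ * x) :=
        lintegral_congr h1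
    _ = ENNReal.ofReal σ⁻¹ * kernelEnergy (nearKernel (σ * δ)) f :=
        lintegral_comp_mul_left hG.lintegral_prod_right' hσ0
    _ ≤ 1 * kernelEnergy (nearKernel (σ * δ)) f := by
        gcongr
        rw [ENNReal.ofReal_le_one]
        exact inv_le_one_of_one_le₀ hσ
    _ = _ := one_mul _

/-- The image of Lebesgue measure under `x ↦ σ x - t` is `σ⁻¹ ≤ 1` times Lebesgue measure. -/
theorem eLpNorm_comp_mul_sub_le {w : ℝ → ℝ} (hw : Measurable w) {σ : ℝ} (hσ : 1 ≤ σ) (t : ℝ) :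
    eLpNorm (fun x => w (σ * x - t)) 2 volume ≤ eLpNorm w 2 volume := by
  have hσ0 : 0 < σ := by linarith
  have hT : Measurable fun x : ℝ => σ * x - t := by fun_prop
  have hmap : Measure.map (fun x : ℝ => σ * x - t) volume ≤ volume := by
    have e : (fun x : ℝ => σ * x - t) = (fun x => x - t) ∘ fun x => σ * x := rfl
    rw [e, ← Measure.map_map (by fun_prop) (by fun_prop), Real.map_volume_mul_left hσ0.ne',
      Measure.map_smul, map_sub_right_eq_self, abs_of_pos (inv_pos.2 hσ0)]
    intro s
    rw [Measure.smul_apply, smul_eq_mul]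
    refine mul_le_of_le_one_left' ?_
    rw [ENNReal.ofReal_le_one]
    exact inv_le_one_of_one_le₀ hσ
  have := eLpNorm_map_measure (μ := volume) (p := 2) (f := fun x : ℝ => σ * x - t) (g := w)
    hw.aestronglyMeasurable hT.aemeasurable
  exact this.symm.trans_le (eLpNorm_mono_measure w hmap)

/-- Continuity in `L²` of small dilations and translations. -/
theorem exists_eLpNorm_comp_sub_le {u : ℝ → ℝ} (hu : Measurable u) (hu2 : MemLp u 2 volume) {ε : ℝ}
    (hε : 0 < ε) : ∃ r > 0, ∀ σ ∈ Icc 1 (1 + r), ∀ t ∈ Icc 0 r,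
      eLpNorm (fun x => u (σ * x - t) - u x) 2 volume ≤ ENNReal.ofReal ε := by
  obtain ⟨φ, hφs, hφu, hφc, -⟩ := hu2.exists_hasCompactSupport_eLpNorm_sub_le (by norm_num)
    (ε := ENNReal.ofReal (ε / 3)) (by simpa using hε)
  obtain ⟨R, hR0, hR⟩ : ∃ R > 0, ∀ x, R < |x| → φ x = 0 := by
    obtain ⟨R, hR0, hR⟩ := hφs.isBounded.subset_closedBall_lt 0 0
    refine ⟨R, hR0, fun x hx => image_eq_zero_of_notMem_tsupport fun hmem => ?_⟩
    have := hR hmem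
    rw [Metric.mem_closedBall, dist_zero_right, Real.norm_eq_abs] at this
    linarith
  set S : Set ℝ := Icc (-(R + 1)) (R + 1) with hS
  obtain ⟨M, hM0, hM⟩ : ∃ M > (0 : ℝ), volume S ^ ((2 : ℝ≥0∞).toReal)⁻¹ ≤ ENNReal.ofReal M := by
    have hfin : volume S ^ ((2 : ℝ≥0∞).toReal)⁻¹ ≠ ⊤ := by
      refine ENNReal.rpow_ne_top_of_nonneg (by positivity) ?_
      simp [hS]
    refine ⟨(volume S ^ ((2 : ℝ≥0∞).toReal)⁻¹).toReal + 1, by positivity, ?_⟩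
    rw [ENNReal.le_ofReal_iff_toReal_le hfin (by positivity)]
    linarith
  obtain ⟨d, hd0, hd⟩ := Metric.uniformContinuous_iff.1
    (hφs.uniformContinuous_of_continuous hφc) (ε / (3 * M)) (by positivity)
  -- With `r ≤ 1` both `φ` and its transform vanish outside `S`. On `S` the displacement is at most
  -- `r (R + 1) + r`, which is less than `r (R + 3) ≤ d`.
  refine ⟨min 1 (d / (R + 3)), by positivity, fun σ hσ t ht => ?_⟩
  set r := min 1 (d / (R + 3)) with hr
  have hr1 : r ≤ 1 := min_le_left _ _
  have hrd : r * (R + 3) ≤ d := by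
    rw [← le_div_iff₀ (by positivity)]
    exact min_le_right _ _
  have hψ : eLpNorm (fun x => φ (σ * x - t) - φ x) 2 volume ≤ ENNReal.ofReal (ε / 3) := by
    have hsupp : Function.support (fun x => φ (σ * x - t) - φ x) ⊆ S := by
      intro x hx
      by_contra hxS
      have hx1 : R + 1 < |x| := by
        by_contra hc
        exact hxS (abs_le.1 (not_lt.1 hc))
      refine hx ?_
      have h1 : R < |σ * x - t| := by
        have h2 : |σ * x| - |t| ≤ |σ * x - t| := abs_sub_abs_le_abs_sub _ _
        rw [abs_mul, abs_of_pos (by linarith [hσ.1] : 0 < σ), abs_of_nonneg ht.1] at h2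
        nlinarith [hσ.1, ht.2, abs_nonneg x]
      simp only [hR _ h1, hR x (by linarith), sub_zero]
    rw [← eLpNorm_restrict_eq_of_support_subset hsupp]
    have hb : ∀ᵐ x ∂volume.restrict S, ‖φ (σ * x - t) - φ x‖ ≤ ε / (3 * M) := by
      refine (ae_restrict_iff' measurableSet_Icc).2 (Eventually.of_forall fun x hx => ?_)
      have hx' : |x| ≤ R + 1 := abs_le.2 hx
      rw [Real.norm_eq_abs, ← Real.dist_eq]
      refine (hd ?_).le
      rw [Real.dist_eq]
      have h1 : |σ * x - t - x| ≤ (σ - 1) * |x| + t := by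
        have e : σ * x - t - x = (σ - 1) * x - t := by ring
        rw [e]
        refine (abs_sub _ _).trans ?_
        rw [abs_mul, abs_of_nonneg (by linarith [hσ.1] : 0 ≤ σ - 1), abs_of_nonneg ht.1]
      have hr0 : 0 < r := by positivity
      have h2 : (σ - 1) * |x| ≤ r * (R + 1) :=
        mul_le_mul (by linarith [hσ.2]) hx' (abs_nonneg x) hr0.le
      nlinarith [ht.2]
    refine (eLpNorm_le_of_ae_bound hb).trans ?_
    rw [Measure.restrict_apply_univ]
    refine (mul_le_mul_left hM _).trans ?_
    rw [← ENNReal.ofReal_mul hM0.le]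
    refine ENNReal.ofReal_le_ofReal (le_of_eq ?_)
    field_simp
  have hsub : Measurable (u - φ) := hu.sub hφc.measurable
  have e : (fun x => u (σ * x - t) - u x) = ((fun x => (u - φ) (σ * x - t)) +
      fun x => φ (σ * x - t) - φ x) - (u - φ) := by
    funext x
    simp only [Pi.add_apply, Pi.sub_apply]
    ring
  have m1 : Measurable fun x => (u - φ) (σ * x - t) := hsub.comp (by fun_prop)
  have m2 : Measurable fun x => φ (σ * x - t) - φ x := by
    have := hφc.measurable
    fun_prop
  rw [e]
  calc _ ≤ eLpNorm ((fun x => (u - φ) (σ * x - t)) + fun x => φ (σ * x - t) - φ x) 2 volume +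
        eLpNorm (u - φ) 2 volume :=
        eLpNorm_sub_le (m1.add m2).aestronglyMeasurable hsub.aestronglyMeasurable one_le_two
    _ ≤ (eLpNorm (fun x => (u - φ) (σ * x - t)) 2 volume +
        eLpNorm (fun x => φ (σ * x - t) - φ x) 2 volume) + eLpNorm (u - φ) 2 volume := by
        gcongr
        exact eLpNorm_add_le m1.aestronglyMeasurable m2.aestronglyMeasurable one_le_two
    _ ≤ (ENNReal.ofReal (ε / 3) + ENNReal.ofReal (ε / 3)) + ENNReal.ofReal (ε / 3) := by
        gcongr
        exact (eLpNorm_comp_mul_sub_le hsub hσ.1 t).trans hφu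
    _ = ENNReal.ofReal ε := by
        rw [← ENNReal.ofReal_add (by positivity) (by positivity),
          ← ENNReal.ofReal_add (by positivity) (by positivity)]
        congr 1
        ring

/-- The energy near the diagonal is small. -/
theorem exists_kernelEnergy_nearKernel_le {u : ℝ → ℝ} (hu : Measurable u)
    (hfin : kernelEnergy (nearKernel 1) u < ⊤) {η : ℝ≥0∞} (hη : 0 < η) :
    ∃ δ > 0, δ ≤ 1 ∧ kernelEnergy (nearKernel δ) u ≤ η := by
  have hlim : Tendsto (fun n : ℕ => ∫⁻ p : ℝ × ℝ, ‖u p.1 - u p.2‖ₑ ^ 2 *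
      nearKernel (1 / ((n : ℝ) + 1)) (p.1 - p.2)) atTop (𝓝 (∫⁻ _ : ℝ × ℝ, 0)) := by
    refine tendsto_lintegral_of_dominated_convergence
      (fun p => ‖u p.1 - u p.2‖ₑ ^ 2 * nearKernel 1 (p.1 - p.2)) (fun n => ?_) (fun n => ?_) ?_ ?_
    · have := measurable_nearKernel (1 / ((n : ℝ) + 1))
      fun_prop
    · refine Eventually.of_forall fun p => ?_
      simp only
      gcongr
      rw [nearKernel, nearKernel]
      split_ifs with h1 h2
      · exact le_rfl
      · refine absurd (h1.trans_le ?_) h2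
        rw [div_le_one (by positivity)]
        linarith [(Nat.cast_nonneg n : (0 : ℝ) ≤ n)]
      all_goals exact zero_le
    · rw [← kernelEnergy_eq_lintegral_prod (measurable_nearKernel 1) hu]
      exact hfin.ne
    · refine Eventually.of_forall fun p => ?_
      rcases eq_or_ne p.1 p.2 with h | h
      · simp [h]
      · refine tendsto_const_nhds.congr' ?_
        have h0 : 0 < |p.1 - p.2| := abs_pos.2 (sub_ne_zero.2 h)
        filter_upwards [tendsto_one_div_add_atTop_nhds_zero_nat.eventually_lt_const h0] with n hn
        rw [nearKernel, if_neg (not_lt.2 hn.le), mul_zero]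
  rw [lintegral_zero] at hlim
  obtain ⟨n, hn⟩ := (hlim.eventually_le_const hη).exists
  refine ⟨1 / ((n : ℝ) + 1), by positivity, ?_, ?_⟩
  · rw [div_le_one (by positivity)]
    linarith [(Nat.cast_nonneg n : (0 : ℝ) ≤ n)]
  · rwa [kernelEnergy_eq_lintegral_prod (measurable_nearKernel _) hu]

/-- The energy of a difference, from the energies near the diagonal and the `L²` norm. -/
theorem kernelEnergy_sub_le {u f : ℝ → ℝ} (hu : Measurable u) (hf : Measurable f) {δ : ℝ}
    (hδ : 0 < δ) :
    kernelEnergy (nearKernel 1) (u - f) ≤ 2 * kernelEnergy (nearKernel δ) u +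
      2 * kernelEnergy (nearKernel δ) f +
      ENNReal.ofReal (8 / δ) * ∫⁻ x, ‖u x - f x‖ₑ ^ 2 := by
  have hk1 := measurable_nearKernel δ
  set B : ℝ → ℝ≥0∞ := (Ioo (-1) 1).indicator 1 with hB
  have hBm : Measurable B := measurable_one.indicator measurableSet_Ioo
  have hBint : ∫⁻ z, B z = 2 := by
    rw [hB, lintegral_indicator_one measurableSet_Ioo, Real.volume_Ioo]
    norm_num
  set g : ℝ → ℝ := u - f with hg
  have hgm : Measurable g := hu.sub hf
  -- Closer than `δ`, the difference is estimated by the two functions separately. Between `δ` and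
  -- `1` the kernel is at most `1/δ`, and `L²` norms suffice. The constant `8` is `2` from the
  -- square, `2` for the two variables and `2` for the length of `(-1,1)`.
  have hpt : ∀ p : ℝ × ℝ, ‖g p.1 - g p.2‖ₑ ^ 2 * nearKernel 1 (p.1 - p.2) ≤
      (2 * (‖u p.1 - u p.2‖ₑ ^ 2 * nearKernel δ (p.1 - p.2)) +
        2 * (‖f p.1 - f p.2‖ₑ ^ 2 * nearKernel δ (p.1 - p.2))) +
      (2 * ENNReal.ofReal δ⁻¹) * (‖g p.1‖ₑ ^ 2 * B (p.1 - p.2) +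
        ‖g p.2‖ₑ ^ 2 * B (p.1 - p.2)) := by
    intro p
    by_cases h1 : |p.1 - p.2| < 1
    · by_cases h2 : |p.1 - p.2| < δ
      · refine le_add_right ?_
        simp only [nearKernel, if_pos h1, if_pos h2]
        have : g p.1 - g p.2 = (u p.1 - u p.2) - (f p.1 - f p.2) := by
          simp only [hg, Pi.sub_apply]; ring
        rw [this, ← mul_assoc, ← mul_assoc, ← add_mul]
        gcongr
        exact enorm_sub_sq_le _ _
      · refine le_add_left ?_
        have hmem : p.1 - p.2 ∈ Ioo (-1 : ℝ) 1 := abs_lt.1 h1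
        simp only [nearKernel, if_pos h1, hB, indicator_of_mem hmem, Pi.one_apply, mul_one]
        calc ‖g p.1 - g p.2‖ₑ ^ 2 * ENNReal.ofReal |p.1 - p.2|⁻¹
            ≤ (2 * ‖g p.1‖ₑ ^ 2 + 2 * ‖g p.2‖ₑ ^ 2) * ENNReal.ofReal δ⁻¹ := by
              gcongr
              · exact enorm_sub_sq_le _ _
              · exact not_lt.1 h2
          _ = _ := by ring
    · simp [nearKernel, if_neg h1]
  have m1 : ∀ v : ℝ → ℝ, Measurable v → Measurable fun p : ℝ × ℝ =>
      ‖v p.1 - v p.2‖ₑ ^ 2 * nearKernel δ (p.1 - p.2) := fun v hv => by fun_prop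
  have m2 : Measurable fun p : ℝ × ℝ => ‖g p.1‖ₑ ^ 2 * B (p.1 - p.2) := by fun_prop
  have m3 : Measurable fun p : ℝ × ℝ => ‖g p.2‖ₑ ^ 2 * B (p.1 - p.2) := by fun_prop
  have i2 : ∫⁻ p : ℝ × ℝ, ‖g p.1‖ₑ ^ 2 * B (p.1 - p.2) = 2 * ∫⁻ x, ‖g x‖ₑ ^ 2 := by
    rw [Measure.volume_eq_prod, lintegral_prod _ m2.aemeasurable,
      ← lintegral_const_mul _ (by fun_prop)]
    refine lintegral_congr fun x => ?_
    simp only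
    rw [lintegral_const_mul _ (by fun_prop), lintegral_sub_left_eq_self B x, hBint, mul_comm]
  have i3 : ∫⁻ p : ℝ × ℝ, ‖g p.2‖ₑ ^ 2 * B (p.1 - p.2) = 2 * ∫⁻ x, ‖g x‖ₑ ^ 2 := by
    rw [Measure.volume_eq_prod, lintegral_prod_symm _ m3.aemeasurable,
      ← lintegral_const_mul _ (by fun_prop)]
    refine lintegral_congr fun x => ?_
    simp only
    rw [lintegral_const_mul _ (by fun_prop), lintegral_sub_right_eq_self B x, hBint, mul_comm]
  rw [kernelEnergy_eq_lintegral_prod (measurable_nearKernel 1) hgm,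
    kernelEnergy_eq_lintegral_prod hk1 hu, kernelEnergy_eq_lintegral_prod hk1 hf]
  refine (lintegral_mono hpt).trans_eq ?_
  have m4 : Measurable fun p : ℝ × ℝ => 2 * (‖u p.1 - u p.2‖ₑ ^ 2 * nearKernel δ (p.1 - p.2)) +
      2 * (‖f p.1 - f p.2‖ₑ ^ 2 * nearKernel δ (p.1 - p.2)) :=
    ((m1 u hu).const_mul 2).add ((m1 f hf).const_mul 2)
  have m5 : Measurable fun p : ℝ × ℝ => ‖g p.1‖ₑ ^ 2 * B (p.1 - p.2) +
      ‖g p.2‖ₑ ^ 2 * B (p.1 - p.2) := m2.add m3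
  rw [lintegral_add_left m4, lintegral_add_left ((m1 u hu).const_mul 2), lintegral_const_mul _ (m1 u hu),
    lintegral_const_mul _ (m1 f hf), lintegral_const_mul _ m5, lintegral_add_left m2, i2,
    i3]
  congr 1
  have e : ENNReal.ofReal (8 / δ) = 8 * ENNReal.ofReal δ⁻¹ := by
    rw [div_eq_mul_inv, ENNReal.ofReal_mul (by norm_num)]
    norm_num
  rw [e]
  simp only [hg, Pi.sub_apply]
  ring

/-- A Lipschitz probability density on `[0,r]`. -/
theorem exists_lipschitz_density {r : ℝ} (hr : 0 < r) : ∃ (ρ : ℝ → ℝ) (K : NNReal),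
    LipschitzWith K ρ ∧ (∀ t, 0 ≤ ρ t) ∧ (∀ t, t ∉ Icc 0 r → ρ t = 0) ∧ Integrable ρ ∧
      ∫ t, ρ t = 1 ∧ ∃ C, ∀ t, ‖ρ t‖ ≤ C := by
  -- The bump has radius `r / 4` about `r / 2`, so its support lies on one side of `0`: averaging
  -- then spreads mass only to the right.
  let b : ContDiffBump (r / 2) := ⟨r / 8, r / 4, by positivity, by linarith⟩
  obtain ⟨K, hK⟩ := ContDiff.lipschitzWith_of_hasCompactSupport (𝕂 := ℝ)
    (b.hasCompactSupport_normed (μ := volume)) (b.contDiff_normed (n := 1)) (by norm_num)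
  refine ⟨b.normed volume, K, hK, fun t => b.nonneg_normed t, fun t ht => ?_, b.integrable_normed,
    b.integral_normed,
    (b.hasCompactSupport_normed (μ := volume)).exists_bound_of_continuous hK.continuous⟩
  by_contra hne
  have hmem : t ∈ Function.support (b.normed volume) := hne
  rw [b.support_normed_eq, Real.ball_eq_Ioo] at hmem
  have h4 : b.rOut = r / 4 := rfl
  rw [h4] at hmem
  exact ht ⟨by linarith [hmem.1], by linarith [hmem.2]⟩

/-- Lipschitz functions that vanish outside `(0,L)` are dense in the energy space. -/
theorem exists_lipschitz_approx {L : ℝ} (hL : 0 < L) {u : ℝ → ℝ} (hu : Measurable u)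
    (hu2 : MemLp u 2 volume) (hu1 : Integrable u) (hsupp : ∀ x ∉ Ioo 0 L, u x = 0)
    (hfin : kernelEnergy (nearKernel 1) u < ⊤) {ε : ℝ} (hε : 0 < ε) :
    ∃ (f : ℝ → ℝ) (K : ℝ), 0 ≤ K ∧ (∀ x y, |f x - f y| ≤ K * |x - y|) ∧
      (∀ x ∉ Ioo 0 L, f x = 0) ∧
      ∫⁻ x, ‖u x - f x‖ₑ ^ 2 ≤ ENNReal.ofReal ε ∧
      kernelEnergy (nearKernel 1) (u - f) ≤ ENNReal.ofReal ε := by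
  obtain ⟨δ', hδ'0, hδ'1, hδ'⟩ := exists_kernelEnergy_nearKernel_le hu hfin
    (η := ENNReal.ofReal (ε / 8)) (by simpa using hε)
  -- Compression by `σ ≤ 2` enlarges the radius from `δ` to `σ * δ ≤ δ'`, where the energy is still
  -- small.
  set δ := δ' / 2 with hδ
  have hδ0 : 0 < δ := by positivity
  -- The final estimate is `2 (ε/8) + 2 (ε/8) + (8/δ)(ε δ/16) = ε`.
  set η := min ε (ε * δ / 16) with hη
  have hη0 : 0 < η := by positivity
  obtain ⟨r₀, hr₀, hr₀'⟩ := exists_eLpNorm_comp_sub_le hu hu2 (Real.sqrt_pos.2 hη0)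
  -- The three bounds on `r` give in turn `t ≤ r₀` for the translations, `σ ≤ 2` and `σ ≤ 1 + r₀`.
  set r := min (min r₀ L) (r₀ * L) with hr
  have hr0 : 0 < r := by positivity
  have hrr : r ≤ r₀ := (min_le_left _ _).trans (min_le_left _ _)
  have hrL : r ≤ L := (min_le_left _ _).trans (min_le_right _ _)
  have hrL' : r ≤ r₀ * L := min_le_right _ _
  set σ := 1 + r / L with hσ
  have hσ1 : 1 ≤ σ := by
    have : 0 ≤ r / L := by positivity
    linarith
  have hσ2 : σ ≤ 2 := by
    have : r / L ≤ 1 := (div_le_one hL).2 hrL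
    linarith
  have hσ3 : σ ≤ 1 + r₀ := by
    have : r / L ≤ r₀ := (div_le_iff₀ hL).2 hrL'
    linarith
  have hσL : σ * L = L + r := by
    rw [hσ]
    field_simp
  obtain ⟨ρ, K, hρL, hρ0, hρs, hρi, hρ1, C, hρC⟩ := exists_lipschitz_density hr0
  have hρm : Measurable ρ := hρL.continuous.measurable
  set P : Measure ℝ := volume.withDensity fun t => ENNReal.ofReal (ρ t) with hP
  have hdm : Measurable fun t => ENNReal.ofReal (ρ t) := hρm.ennreal_ofReal
  have hPprob : IsProbabilityMeasure P := by
    constructor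
    rw [hP, withDensity_apply _ MeasurableSet.univ, Measure.restrict_univ,
      ← ofReal_integral_eq_lintegral_ofReal hρi (Eventually.of_forall hρ0), hρ1, ENNReal.ofReal_one]
  have hPsupp : ∀ᵐ t ∂P, t ∈ Icc 0 r := by
    rw [hP, ae_withDensity_iff hdm]
    refine Eventually.of_forall fun t ht => ?_
    by_contra hc
    exact ht (by rw [hρs t hc, ENNReal.ofReal_zero])
  have hprod : ∀ x, Integrable fun t => ρ (x - t) * u t := fun x =>
    hu1.bdd_mul (c := C)
      (hρL.continuous.comp (by fun_prop)).aestronglyMeasurable (Eventually.of_forall fun t => hρC _)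
  have hPint : ∀ x, Integrable (fun t => u (x - t)) P := by
    intro x
    rw [hP, integrable_withDensity_iff_integrable_smul' hdm
      (Eventually.of_forall fun t => ENNReal.ofReal_lt_top)]
    simp only [ENNReal.toReal_ofReal (hρ0 _), smul_eq_mul]
    simpa using (hprod x).comp_sub_left x
  -- The mollified `f₀` vanishes outside `(0, L + r)`. As `σ * L = L + r`, the compressed function
  -- `f₀ (σ * x)` vanishes outside `(0,L)`.
  set f₀ : ℝ → ℝ := fun x => ∫ t, u (x - t) ∂P with hf₀
  have hf₀' : ∀ x, f₀ x = ∫ t, ρ (x - t) * u t := by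
    intro x
    rw [← integral_sub_left_eq_self _ volume x, hf₀]
    simp only [hP]
    rw [integral_withDensity_eq_integral_toReal_smul hdm
      (Eventually.of_forall fun t => ENNReal.ofReal_lt_top)]
    simp only [ENNReal.toReal_ofReal (hρ0 _), smul_eq_mul, sub_sub_cancel]
  have hI0 : 0 ≤ ∫ t, |u t| := integral_nonneg fun t => abs_nonneg _
  have hLip : ∀ x y, |f₀ x - f₀ y| ≤ K * (∫ t, |u t|) * |x - y| := by
    intro x y
    rw [hf₀', hf₀', ← integral_sub (hprod x) (hprod y), ← Real.norm_eq_abs]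
    refine (norm_integral_le_of_norm_le (g := fun t => K * |x - y| * |u t|)
      (hu1.abs.const_mul _) (Eventually.of_forall fun t => ?_)).trans_eq ?_
    · rw [← sub_mul, norm_mul, Real.norm_eq_abs, Real.norm_eq_abs]
      have := hρL.dist_le_mul (x - t) (y - t)
      rw [Real.dist_eq, Real.dist_eq, sub_sub_sub_cancel_right] at this
      gcongr
    · rw [integral_const_mul]
      ring
  have hf₀m : Measurable f₀ :=
    (LipschitzWith.of_dist_le_mul (K := ⟨K * ∫ t, |u t|, by positivity⟩) fun x y => by
      rw [Real.dist_eq, Real.dist_eq]; exact hLip x y).continuous.measurable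
  have hfm : Measurable fun x => f₀ (σ * x) := hf₀m.comp (by fun_prop)
  have hL2 : ∫⁻ x, ‖u x - f₀ (σ * x)‖ₑ ^ 2 ≤ ENNReal.ofReal η := by
    calc ∫⁻ x, ‖u x - f₀ (σ * x)‖ₑ ^ 2
        ≤ ∫⁻ x, (∫⁻ t, ‖u (σ * x - t) - u x‖ₑ ^ 2 ∂P) := by
          refine lintegral_mono fun x => ?_
          have e : f₀ (σ * x) - u x = ∫ t, (u (σ * x - t) - u x) ∂P := by
            rw [integral_sub (hPint _) (integrable_const _)]
            simp [hf₀]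
          rw [enorm_sub_rev, e]
          exact enorm_integral_sq_le ((hPint _).sub (integrable_const _)).aestronglyMeasurable
      _ = ∫⁻ t, (∫⁻ x, ‖u (σ * x - t) - u x‖ₑ ^ 2) ∂P := by
          refine lintegral_lintegral_swap (Measurable.aemeasurable ?_)
          change Measurable fun q : ℝ × ℝ => ‖u (σ * q.1 - q.2) - u q.1‖ₑ ^ 2
          fun_prop
      _ ≤ ∫⁻ _, ENNReal.ofReal η ∂P := by
          refine lintegral_mono_ae ?_
          filter_upwards [hPsupp] with t ht
          rw [← eLpNorm_two_sq]
          calc _ ≤ ENNReal.ofReal (√η) ^ 2 := by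
                gcongr
                exact hr₀' σ ⟨hσ1, hσ3⟩ t ⟨ht.1, ht.2.trans hrr⟩
            _ = ENNReal.ofReal η := by
                rw [← ENNReal.ofReal_pow (Real.sqrt_nonneg _), Real.sq_sqrt hη0.le]
      _ = ENNReal.ofReal η := by simp
  have hmono : ∀ {a b : ℝ}, a ≤ b → ∀ v : ℝ → ℝ,
      kernelEnergy (nearKernel a) v ≤ kernelEnergy (nearKernel b) v := by
    intro a b hab v
    refine lintegral_mono fun x => lintegral_mono fun y => ?_
    simp only
    gcongr
    rw [nearKernel, nearKernel]
    split_ifs with h1 h2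
    · exact le_rfl
    · exact absurd (h1.trans_le hab) h2
    all_goals exact zero_le
  have hEf : kernelEnergy (nearKernel δ) (fun x => f₀ (σ * x)) ≤ ENNReal.ofReal (ε / 8) := by
    refine (kernelEnergy_comp_mul_le hf₀m δ hσ1).trans ?_
    refine (kernelEnergy_average_le hu hPint (measurable_nearKernel _)).trans ?_
    refine (hmono ?_ u).trans hδ'
    rw [hδ]
    nlinarith
  refine ⟨fun x => f₀ (σ * x), K * (∫ t, |u t|) * σ, by positivity, fun x y => ?_, fun x hx => ?_,
    hL2.trans (ENNReal.ofReal_le_ofReal (min_le_left _ _)), ?_⟩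
  · refine (hLip _ _).trans_eq ?_
    rw [← mul_sub, abs_mul, abs_of_pos (by linarith : 0 < σ)]
    ring
  · refine integral_eq_zero_of_ae ?_
    filter_upwards [hPsupp] with t ht
    refine hsupp _ fun hc => hx ⟨?_, ?_⟩
    · have := hc.1
      by_contra hneg
      nlinarith [ht.1]
    · have := hc.2
      by_contra hge
      nlinarith [ht.2]
  · refine (kernelEnergy_sub_le hu hfm hδ0).trans ?_
    calc _ ≤ 2 * ENNReal.ofReal (ε / 8) + 2 * ENNReal.ofReal (ε / 8) +
          ENNReal.ofReal (8 / δ) * ENNReal.ofReal (ε * δ / 16) := by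
          gcongr
          · refine (hmono ?_ u).trans hδ'
            rw [hδ]
            linarith
          · exact hL2.trans (ENNReal.ofReal_le_ofReal (min_le_right _ _))
      _ = ENNReal.ofReal ε := by
          have h2 : (2 : ℝ≥0∞) = ENNReal.ofReal 2 := by simp
          rw [h2, ← ENNReal.ofReal_mul (by norm_num), ← ENNReal.ofReal_mul (by positivity),
            ← ENNReal.ofReal_add (by positivity) (by positivity),
            ← ENNReal.ofReal_add (by positivity) (by positivity)]
          congr 1
          field_simp
          ring

/-! ### Nodal interpolation -/

/-- The piecewise affine interpolant of `f` at the nodes `i h`, `i ∈ ℤ`. -/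
noncomputable def nodalInterpolant (h : ℝ) (f : ℝ → ℝ) (x : ℝ) : ℝ :=
  f (⌊x / h⌋ * h) + (x / h - ⌊x / h⌋) * (f ((⌊x / h⌋ + 1) * h) - f (⌊x / h⌋ * h))

theorem floor_div_mul_le {h : ℝ} (hh : 0 < h) (x : ℝ) :
    ⌊x / h⌋ * h ≤ x ∧ x < (⌊x / h⌋ + 1) * h :=
  ⟨(le_div_iff₀ hh).1 (Int.floor_le _), (div_lt_iff₀ hh).1 (Int.lt_floor_add_one _)⟩

theorem nodalInterpolant_int_mul {h : ℝ} (hh : 0 < h) (f : ℝ → ℝ) (i : ℤ) :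
    nodalInterpolant h f (i * h) = f (i * h) := by
  rw [nodalInterpolant, mul_div_cancel_right₀ _ hh.ne', Int.floor_intCast]
  simp

section Lipschitz

variable {h K : ℝ} {f : ℝ → ℝ}

theorem abs_slope_le (hh : 0 < h) (hf : ∀ x y, |f x - f y| ≤ K * |x - y|) (i : ℝ) :
    |f ((i + 1) * h) - f (i * h)| ≤ K * h := by
  refine (hf _ _).trans_eq ?_
  rw [← sub_mul, add_sub_cancel_left, one_mul, abs_of_pos hh]

/-- Interpolation keeps the Lipschitz constant: each slope is a difference quotient of `f`, and a
pair of points in different cells is joined through the right node of the first cell and the left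
node of the second. -/
theorem nodalInterpolant_lipschitz (hh : 0 < h) (hf : ∀ x y, |f x - f y| ≤ K * |x - y|) (x y : ℝ) :
    |nodalInterpolant h f x - nodalInterpolant h f y| ≤ K * |x - y| := by
  wlog hxy : x ≤ y generalizing x y
  · rw [abs_sub_comm, abs_sub_comm x]
    exact this y x (le_of_not_ge hxy)
  obtain ⟨hx1, hx2⟩ := floor_div_mul_le hh x
  obtain ⟨hy1, hy2⟩ := floor_div_mul_le hh y
  have hfl : ⌊x / h⌋ ≤ ⌊y / h⌋ := Int.floor_mono (by gcongr)
  have sx := abs_slope_le hh hf ⌊x / h⌋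
  have sy := abs_slope_le hh hf ⌊y / h⌋
  rw [abs_sub_comm, abs_sub_comm x, abs_of_nonneg (sub_nonneg.2 hxy)]
  have ex : x / h * h = x := div_mul_cancel₀ x hh.ne'
  have ey : y / h * h = y := div_mul_cancel₀ y hh.ne'
  rw [nodalInterpolant, nodalInterpolant]
  rcases hfl.eq_or_lt with he | hlt
  · rw [← he]
    set i : ℝ := (⌊x / h⌋ : ℝ)
    have e : f (i * h) + (y / h - i) * (f ((i + 1) * h) - f (i * h)) -
        (f (i * h) + (x / h - i) * (f ((i + 1) * h) - f (i * h))) =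
        (y / h - x / h) * (f ((i + 1) * h) - f (i * h)) := by ring
    have h0 : 0 ≤ y / h - x / h := sub_nonneg.2 (by gcongr)
    rw [e, abs_mul, abs_of_nonneg h0]
    calc (y / h - x / h) * |f ((i + 1) * h) - f (i * h)|
        ≤ (y / h - x / h) * (K * h) := by gcongr
      _ = K * (y / h * h - x / h * h) := by ring
      _ = K * (y - x) := by rw [ex, ey]
  · have hlt' : (⌊x / h⌋ : ℝ) + 1 ≤ ⌊y / h⌋ := by exact_mod_cast hlt
    set i : ℝ := (⌊x / h⌋ : ℝ)
    set j : ℝ := (⌊y / h⌋ : ℝ)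
    have h1 : x / h ≤ i + 1 := by
      rw [div_le_iff₀ hh]
      exact hx2.le
    have h2 : j ≤ y / h := by
      rw [le_div_iff₀ hh]
      exact hy1
    have hm := hf (j * h) ((i + 1) * h)
    rw [← sub_mul, abs_mul, abs_of_nonneg (by linarith : 0 ≤ j - (i + 1)), abs_of_pos hh] at hm
    have e : f (j * h) + (y / h - j) * (f ((j + 1) * h) - f (j * h)) -
        (f (i * h) + (x / h - i) * (f ((i + 1) * h) - f (i * h))) =
        (y / h - j) * (f ((j + 1) * h) - f (j * h)) + (f (j * h) - f ((i + 1) * h)) +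
          (i + 1 - x / h) * (f ((i + 1) * h) - f (i * h)) := by ring
    rw [e]
    refine (abs_add_le _ _).trans ((add_le_add (abs_add_le _ _) le_rfl).trans ?_)
    rw [abs_mul, abs_mul, abs_of_nonneg (sub_nonneg.2 h2), abs_of_nonneg (sub_nonneg.2 h1)]
    calc _ ≤ (y / h - j) * (K * h) + K * ((j - (i + 1)) * h) + (i + 1 - x / h) * (K * h) := by
          have h1' := sub_nonneg.2 h1
          have h2' := sub_nonneg.2 h2
          gcongr
      _ = K * (y / h * h - x / h * h) := by ring
      _ = K * (y - x) := by rw [ex, ey]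

theorem abs_nodalInterpolant_sub_le (hh : 0 < h) (hK : 0 ≤ K)
    (hf : ∀ x y, |f x - f y| ≤ K * |x - y|) (x : ℝ) :
    |nodalInterpolant h f x - f x| ≤ 2 * K * h := by
  obtain ⟨hx1, hx2⟩ := floor_div_mul_le hh x
  have h1 := nodalInterpolant_lipschitz hh hf x (⌊x / h⌋ * h)
  have h2 := hf (⌊x / h⌋ * h) x
  rw [nodalInterpolant_int_mul hh] at h1
  rw [abs_sub_comm (⌊x / h⌋ * h) x] at h2
  have h3 : |x - ⌊x / h⌋ * h| ≤ h := by
    rw [abs_of_nonneg (by linarith)]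
    linarith
  have h4 : K * |x - ⌊x / h⌋ * h| ≤ K * h := by gcongr
  have := abs_sub_le (nodalInterpolant h f x) (f (⌊x / h⌋ * h)) (f x)
  linarith

end Lipschitz

theorem meshSize_pos {L : ℝ} (hL : 0 < L) (N : ℕ) : 0 < meshSize L N := by
  rw [meshSize]
  positivity

theorem succ_mul_meshSize (L : ℝ) (N : ℕ) : ((N : ℝ) + 1) * meshSize L N = L := by
  rw [meshSize]
  field_simp

theorem nodalInterpolant_eq_zero {L : ℝ} (hL : 0 < L) (N : ℕ) {f : ℝ → ℝ}
    (hf : ∀ x ∉ Ioo 0 L, f x = 0) {x : ℝ} (hx : x ∉ Ioo 0 L) :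
    nodalInterpolant (meshSize L N) f x = 0 := by
  have hh := meshSize_pos hL N
  have hNL := succ_mul_meshSize L N
  set h := meshSize L N
  obtain ⟨hx1, hx2⟩ := floor_div_mul_le hh x
  rw [mem_Ioo, not_and_or, not_lt, not_lt] at hx
  rcases hx with hx | hx
  -- The point `0` is special: its cell `[0,h)` reaches into the interval, but the right node has
  -- weight zero. Every other cell in question has both nodes outside `(0,L)`.
  · rcases hx.eq_or_lt with rfl | hx
    · have := nodalInterpolant_int_mul hh f 0
      rw [Int.cast_zero, zero_mul] at this
      rw [this, hf 0 (by simp)]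
    · have h1 : ⌊x / h⌋ + 1 ≤ 0 := by
        have : ⌊x / h⌋ < 0 := Int.floor_lt.2 (by
          rw [Int.cast_zero]
          exact div_neg_of_neg_of_pos hx hh)
        omega
      have h2 : ((⌊x / h⌋ : ℝ) + 1) * h ≤ 0 := by
        have : (⌊x / h⌋ : ℝ) + 1 ≤ 0 := by exact_mod_cast h1
        exact mul_nonpos_of_nonpos_of_nonneg this hh.le
      rw [nodalInterpolant, hf _ (fun hc => by linarith [hc.1]), hf _ (fun hc => by linarith [hc.1])]
      simp
  · have h1 : (N : ℤ) + 1 ≤ ⌊x / h⌋ := Int.le_floor.2 (by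
      rw [le_div_iff₀ hh]
      push_cast
      linarith)
    have h2 : L ≤ (⌊x / h⌋ : ℝ) * h := by
      have : (N : ℝ) + 1 ≤ ⌊x / h⌋ := by exact_mod_cast h1
      rw [← hNL]
      gcongr
    rw [nodalInterpolant, hf _ (fun hc => by linarith [hc.2]), hf _ (fun hc => by nlinarith [hc.2])]
    simp

theorem isFEFunction_nodalInterpolant {L K : ℝ} (hL : 0 < L) (N : ℕ) {f : ℝ → ℝ}
    (hfK : ∀ x y, |f x - f y| ≤ K * |x - y|) (hf : ∀ x ∉ Ioo 0 L, f x = 0) :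
    IsFEFunction L N (nodalInterpolant (meshSize L N) f) := by
  have hh := meshSize_pos hL N
  refine ⟨Continuous.continuousOn ?_, fun x hx => nodalInterpolant_eq_zero hL N hf hx,
    fun i _ => ?_⟩
  · refine (LipschitzWith.of_dist_le_mul (K := K.toNNReal) fun x y => ?_).continuous
    rw [Real.dist_eq, Real.dist_eq]
    refine (nodalInterpolant_lipschitz hh hfK x y).trans ?_
    gcongr
    exact Real.le_coe_toNNReal K
  · set h := meshSize L N
    refine ⟨h⁻¹ * (f ((i + 1) * h) - f (i * h)),
      f (i * h) - i * (f ((i + 1) * h) - f (i * h)), fun x hx => ?_⟩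
    have hfl : ⌊x / h⌋ = i := by
      rw [Int.floor_eq_iff, le_div_iff₀ hh, div_lt_iff₀ hh]
      push_cast
      exact ⟨hx.1.le, hx.2⟩
    rw [nodalInterpolant, hfl]
    simp only [Int.cast_natCast]
    ring

/-- The energy of a small Lipschitz function with bounded support. -/
theorem kernelEnergy_lipschitz_le {L K c : ℝ} (hL : 0 < L) (hK : 0 ≤ K) {g : ℝ → ℝ}
    (hgK : ∀ x y, |g x - g y| ≤ K * |x - y|) (hg : ∀ x, |g x| ≤ c)
    (hsupp : ∀ x ∉ Ioo 0 L, g x = 0) :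
    kernelEnergy (nearKernel 1) g ≤ ENNReal.ofReal (K * (2 * c) * ((L + 2) * (L + 2))) := by
  set S : Set ℝ := Icc (-1) (L + 1) with hS
  have hc : 0 ≤ c := (abs_nonneg _).trans (hg 0)
  have hvol : ∀ A : ℝ≥0∞, ∫⁻ x, S.indicator (fun _ => A) x = A * ENNReal.ofReal (L + 2) := by
    intro A
    rw [lintegral_indicator_const measurableSet_Icc, Real.volume_Icc]
    congr 2
    ring
  -- One factor `|g x - g y| ≤ K |x - y|` cancels the kernel, the other is at most `2 c`. So for
  -- fixed `K` the energy is small with the sup norm. Pairs that contribute have both points within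
  -- distance one of `(0,L)`.
  have hpt : ∀ x y, ‖g x - g y‖ₑ ^ 2 * nearKernel 1 (x - y) ≤
      S.indicator (fun _ => S.indicator (fun _ => ENNReal.ofReal (K * (2 * c))) y) x := by
    intro x y
    by_cases h1 : |x - y| < 1
    · by_cases h0 : x ∉ Ioo 0 L ∧ y ∉ Ioo 0 L
      · simp [hsupp x h0.1, hsupp y h0.2]
      · have hmem : x ∈ S ∧ y ∈ S := by
          have h2 := abs_lt.1 h1
          rw [not_and_or, not_not, not_not] at h0
          rcases h0 with h0 | h0
          · exact ⟨⟨by linarith [h0.1], by linarith [h0.2]⟩,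
              ⟨by linarith [h0.1, h2.2], by linarith [h0.2, h2.1]⟩⟩
          · exact ⟨⟨by linarith [h0.1, h2.1], by linarith [h0.2, h2.2]⟩,
              ⟨by linarith [h0.1], by linarith [h0.2]⟩⟩
        rw [indicator_of_mem hmem.1, indicator_of_mem hmem.2, nearKernel, if_pos h1,
          enorm_sq_eq_ofReal, ← ENNReal.ofReal_mul (sq_nonneg _)]
        refine ENNReal.ofReal_le_ofReal ?_
        rw [← div_eq_mul_inv]
        refine div_le_of_le_mul₀ (abs_nonneg _) (by positivity) ?_
        rw [← sq_abs]
        have h3 : |g x - g y| ≤ 2 * c := by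
          have := abs_sub (g x) (g y)
          linarith [hg x, hg y]
        calc |g x - g y| ^ 2 = |g x - g y| * |g x - g y| := sq _
          _ ≤ (K * |x - y|) * (2 * c) :=
            mul_le_mul (hgK x y) h3 (abs_nonneg _) (by positivity)
          _ = K * (2 * c) * |x - y| := by ring
    · rw [nearKernel, if_neg h1, mul_zero]
      exact zero_le
  calc kernelEnergy (nearKernel 1) g
      ≤ ∫⁻ x, ∫⁻ y, S.indicator (fun _ => S.indicator
          (fun _ => ENNReal.ofReal (K * (2 * c))) y) x :=
        lintegral_mono fun x => lintegral_mono fun y => hpt x y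
    _ = ∫⁻ x, S.indicator (fun _ => ENNReal.ofReal (K * (2 * c)) * ENNReal.ofReal (L + 2)) x := by
        refine lintegral_congr fun x => ?_
        by_cases hx : x ∈ S
        · simp only [indicator_of_mem hx, hvol]
        · simp only [indicator_of_notMem hx, lintegral_zero]
    _ = _ := by
        rw [hvol, mul_assoc, ← ENNReal.ofReal_mul (by positivity),
          ← ENNReal.ofReal_mul (by positivity)]

theorem lintegral_enorm_sq_le {L c : ℝ} {g : ℝ → ℝ} (hg : ∀ x, |g x| ≤ c)
    (hsupp : ∀ x ∉ Ioo 0 L, g x = 0) :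
    ∫⁻ x, ‖g x‖ₑ ^ 2 ≤ ENNReal.ofReal (c ^ 2 * L) := by
  have hc : 0 ≤ c := (abs_nonneg _).trans (hg 0)
  calc ∫⁻ x, ‖g x‖ₑ ^ 2 ≤ ∫⁻ x, (Ioo 0 L).indicator (fun _ => ENNReal.ofReal (c ^ 2)) x := by
        refine lintegral_mono fun x => ?_
        by_cases hx : x ∈ Ioo 0 L
        · rw [indicator_of_mem hx, enorm_sq_eq_ofReal]
          refine ENNReal.ofReal_le_ofReal ?_
          rw [← sq_abs]
          gcongr
          exact hg x
        · simp [hsupp x hx]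
    _ = _ := by
        rw [lintegral_indicator_const measurableSet_Ioo, Real.volume_Ioo, sub_zero,
          ← ENNReal.ofReal_mul (by positivity)]

/-! ### Approximation in the energy space by finite elements -/

theorem kernelEnergy_sub_le_add {k : ℝ → ℝ≥0∞} (hk : Measurable k) {u v w : ℝ → ℝ}
    (hu : Measurable u) (hv : Measurable v) (hw : Measurable w) :
    kernelEnergy k (u - w) ≤ 2 * kernelEnergy k (u - v) + 2 * kernelEnergy k (w - v) := by
  have m1 : ∀ g : ℝ → ℝ, Measurable g → Measurable fun p : ℝ × ℝ =>
      ‖g p.1 - g p.2‖ₑ ^ 2 * k (p.1 - p.2) := fun g hg => by fun_prop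
  rw [kernelEnergy_eq_lintegral_prod hk (hu.sub hw), kernelEnergy_eq_lintegral_prod hk (hu.sub hv),
    kernelEnergy_eq_lintegral_prod hk (hw.sub hv), ← lintegral_const_mul _ (m1 _ (hu.sub hv)),
    ← lintegral_const_mul _ (m1 _ (hw.sub hv)),
    ← lintegral_add_left ((m1 _ (hu.sub hv)).const_mul 2)]
  refine lintegral_mono fun p => ?_
  rw [← mul_assoc, ← mul_assoc, ← add_mul]
  gcongr
  have e : (u - w) p.1 - (u - w) p.2 =
      ((u - v) p.1 - (u - v) p.2) - ((w - v) p.1 - (w - v) p.2) := by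
    simp only [Pi.sub_apply]
    ring
  rw [e]
  exact enorm_sub_sq_le _ _

theorem lintegral_sub_le_add {u v w : ℝ → ℝ} (hu : Measurable u) (hv : Measurable v) :
    ∫⁻ x, ‖u x - w x‖ₑ ^ 2 ≤ 2 * (∫⁻ x, ‖u x - v x‖ₑ ^ 2) + 2 * ∫⁻ x, ‖w x - v x‖ₑ ^ 2 := by
  calc ∫⁻ x, ‖u x - w x‖ₑ ^ 2
      ≤ ∫⁻ x, (2 * ‖u x - v x‖ₑ ^ 2 + 2 * ‖w x - v x‖ₑ ^ 2) := by
        refine lintegral_mono fun x => ?_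
        have e : u x - w x = (u x - v x) - (w x - v x) := by ring
        rw [e]
        exact enorm_sub_sq_le _ _
    _ = _ := by
        rw [lintegral_add_left (by fun_prop), lintegral_const_mul' _ _ (by simp),
          lintegral_const_mul' _ _ (by simp)]

/-- A Lipschitz `f` close to `u` is fixed before the mesh. The interpolant then differs from `f` by
a function with Lipschitz constant `2 K` and sup norm at most `2 K h`, so this error tends to zero
in both norms. -/
theorem eventually_exists_discrete_approx {L : ℝ} (hL : 0 < L) {u : Lp ℝ 2 (volume : Measure ℝ)}
    (hu : u ∈ energySpace L) {ε : ℝ} (hε : 0 < ε) : ∀ᶠ N : ℕ in atTop,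
      ∃ w ∈ discreteSpace L N, ∫⁻ x, ‖(u - w : Lp ℝ 2 (volume : Measure ℝ)) x‖ₑ ^ 2 ≤
        ENNReal.ofReal ε ∧
      kernelEnergy (nearKernel 1) (u - w : Lp ℝ 2 (volume : Measure ℝ)) ≤ ENNReal.ofReal ε := by
  set v : ℝ → ℝ := (Ioo 0 L).indicator u with hv
  have huv : u =ᵐ[volume] v := by
    filter_upwards [hu.1] with x hx
    by_cases hxL : x ∈ Ioo 0 L
    · rw [hv, indicator_of_mem hxL]
    · rw [hv, indicator_of_notMem hxL, hx hxL]
  have hvm : Measurable v := (Lp_measurable u).indicator measurableSet_Ioo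
  obtain ⟨f, K, hK, hfK, hf0, hf1, hf2⟩ := exists_lipschitz_approx hL hvm
    ((memLp_congr_ae huv).1 (Lp.memLp u)) ((MemEnergySpace.integrable hu).congr huv)
    (fun x hx => indicator_of_notMem hx _)
    (by rw [← kernelEnergy_congr huv]; exact (mem_energySpace_iff.1 hu).2) (ε := ε / 4)
    (by positivity)
  have hfm : Measurable f := (LipschitzWith.of_dist_le_mul (K := ⟨K, hK⟩) fun x y => by
    rw [Real.dist_eq, Real.dist_eq]; exact hfK x y).continuous.measurable
  have hmesh : Tendsto (fun N : ℕ => meshSize L N) atTop (𝓝 0) := by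
    have := (tendsto_one_div_add_atTop_nhds_zero_nat (𝕜 := ℝ)).const_mul L
    simpa [meshSize, div_eq_mul_inv] using this
  have hsm1 : ∀ᶠ N : ℕ in atTop, (2 * K * meshSize L N) ^ 2 * L ≤ ε / 4 := by
    have : Tendsto (fun N : ℕ => (2 * K * meshSize L N) ^ 2 * L) atTop (𝓝 0) := by
      simpa using ((hmesh.const_mul (2 * K)).pow 2).mul_const L
    exact this.eventually_le_const (by positivity)
  have hsm2 : ∀ᶠ N : ℕ in atTop,
      (K + K) * (2 * (2 * K * meshSize L N)) * ((L + 2) * (L + 2)) ≤ ε / 4 := by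
    have : Tendsto (fun N : ℕ => (K + K) * (2 * (2 * K * meshSize L N)) * ((L + 2) * (L + 2)))
        atTop (𝓝 0) := by
      simpa using ((((hmesh.const_mul (2 * K)).const_mul 2).const_mul (K + K)).mul_const
        ((L + 2) * (L + 2)))
    exact this.eventually_le_const (by positivity)
  filter_upwards [hsm1, hsm2] with N hN1 hN2
  have hh := meshSize_pos hL N
  set w : ℝ → ℝ := nodalInterpolant (meshSize L N) f with hw
  have hw0 : ∀ x ∉ Ioo 0 L, w x = 0 := fun x hx => nodalInterpolant_eq_zero hL N hf0 hx
  have hwc : Continuous w := (LipschitzWith.of_dist_le_mul (K := ⟨K, hK⟩) fun x y => by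
    rw [Real.dist_eq, Real.dist_eq]; exact nodalInterpolant_lipschitz hh hfK x y).continuous
  have hwL : MemLp w 2 volume := hwc.memLp_of_hasCompactSupport
    (HasCompactSupport.intro (K := Icc 0 L) isCompact_Icc fun x hx =>
      hw0 x fun hc => hx ⟨hc.1.le, hc.2.le⟩)
  have hwLp : hwL.toLp w =ᵐ[volume] w := hwL.coeFn_toLp
  have hdiff : (u - hwL.toLp w : Lp ℝ 2 (volume : Measure ℝ)) =ᵐ[volume] v - w := by
    refine (Lp.coeFn_sub u (hwL.toLp w)).trans ?_
    filter_upwards [huv, hwLp] with x h1 h2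
    rw [Pi.sub_apply, Pi.sub_apply, h1, h2]
  have hg0 : ∀ x ∉ Ioo 0 L, (w - f) x = 0 := fun x hx => by
    rw [Pi.sub_apply, hw0 x hx, hf0 x hx, sub_zero]
  have hgb : ∀ x, |(w - f) x| ≤ 2 * K * meshSize L N := fun x =>
    abs_nodalInterpolant_sub_le hh hK hfK x
  have hgK : ∀ x y, |(w - f) x - (w - f) y| ≤ (K + K) * |x - y| := fun x y => by
    have e : (w - f) x - (w - f) y = (w x - w y) - (f x - f y) := by
      simp only [Pi.sub_apply]
      ring
    rw [e]
    refine (abs_sub _ _).trans ?_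
    rw [add_mul]
    exact add_le_add (nodalInterpolant_lipschitz hh hfK x y) (hfK x y)
  have hfin : 2 * ENNReal.ofReal (ε / 4) + 2 * ENNReal.ofReal (ε / 4) = ENNReal.ofReal ε := by
    have h2 : (2 : ℝ≥0∞) = ENNReal.ofReal 2 := by simp
    rw [h2, ← ENNReal.ofReal_mul (by norm_num), ← ENNReal.ofReal_add (by positivity)
      (by positivity)]
    congr 1
    ring
  refine ⟨hwL.toLp w, ⟨w, isFEFunction_nodalInterpolant hL N hfK hf0, hwLp⟩, ?_, ?_⟩
  · have e : ∫⁻ x, ‖(u - hwL.toLp w : Lp ℝ 2 (volume : Measure ℝ)) x‖ₑ ^ 2 =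
        ∫⁻ x, ‖v x - w x‖ₑ ^ 2 := by
      refine lintegral_congr_ae ?_
      filter_upwards [hdiff] with x hx
      rw [hx, Pi.sub_apply]
    rw [e, ← hfin]
    refine (lintegral_sub_le_add hvm hfm).trans ?_
    gcongr
    exact (lintegral_enorm_sq_le hgb hg0).trans (ENNReal.ofReal_le_ofReal hN1)
  · rw [kernelEnergy_congr hdiff, ← hfin]
    refine (kernelEnergy_sub_le_add (measurable_nearKernel 1) hvm hfm hwc.measurable).trans ?_
    gcongr
    exact (kernelEnergy_lipschitz_le hL (by positivity) hgK hgb hg0).trans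
      (ENNReal.ofReal_le_ofReal hN2)

/-! ### Functions with jumps at the boundary have finite energy -/

/-- The weight `|x|^{-1/2}`, cut off at distance `R`. -/
noncomputable def sqrtWeight (R : ℝ) : ℝ → ℝ := (Metric.ball 0 R).indicator fun x => (√|x|)⁻¹

theorem sqrtWeight_nonneg (R x : ℝ) : 0 ≤ sqrtWeight R x :=
  indicator_nonneg (fun x _ => by positivity) x

theorem integrable_sqrtWeight (R : ℝ) : Integrable (sqrtWeight R) := by
  refine (integrable_indicator_iff measurableSet_ball).2 ?_
  refine integrableOn_ball_of_norm_le_rpow (C := 1) (α := 1 / 2) (by simp) (by norm_num)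
    (Eventually.of_forall fun x => ?_) ?_
  · rw [Real.norm_of_nonneg (by positivity), Real.sqrt_eq_rpow, one_mul, Real.norm_eq_abs,
      Real.rpow_neg (abs_nonneg x)]
  · exact (by fun_prop : Measurable fun x : ℝ => (√|x|)⁻¹).aestronglyMeasurable

/-- Opposite signs give `|s - t| = |s| + |t| ≥ √(|s| |t|)`. Thus the singularity across a jump is
dominated by an integrable product. -/
theorem inv_abs_sub_le_sqrtWeight {R s t : ℝ} (hst : s * t < 0) (hs : |s| < R) (ht : |t| < R) :
    |s - t|⁻¹ ≤ sqrtWeight R s * sqrtWeight R t := by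
  have hs0 : 0 < |s| := abs_pos.2 fun h => by simp [h] at hst
  have ht0 : 0 < |t| := abs_pos.2 fun h => by simp [h] at hst
  rw [sqrtWeight, indicator_of_mem (by simpa using hs), indicator_of_mem (by simpa using ht),
    ← mul_inv, ← Real.sqrt_mul hs0.le]
  refine inv_anti₀ (by positivity) ?_
  have h1 : |s - t| = |s| + |t| := by
    rcases lt_or_gt_of_ne (abs_pos.1 hs0) with h | h
    · have : 0 < t := by nlinarith
      rw [abs_of_neg h, abs_of_pos this, abs_of_neg (by linarith)]
      ring
    · have : t < 0 := by nlinarith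
      rw [abs_of_pos h, abs_of_neg this, abs_of_pos (by linarith)]
      ring
  rw [h1, Real.sqrt_le_iff]
  constructor
  · positivity
  · nlinarith

theorem inv_abs_sub_le_of_mem_of_notMem {L x y : ℝ} (hx : x ∈ Ioo 0 L) (hy : y ∉ Icc 0 L)
    (hxy : |x - y| < 1) :
    |x - y|⁻¹ ≤ sqrtWeight (L + 2) x * sqrtWeight (L + 2) y +
      sqrtWeight (L + 2) (x - L) * sqrtWeight (L + 2) (y - L) := by
  have h1 := abs_lt.1 hxy
  rw [mem_Icc, not_and_or, not_le, not_le] at hy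
  rcases hy with hy | hy
  · refine le_add_of_le_of_nonneg (inv_abs_sub_le_sqrtWeight (by nlinarith [hx.1]) ?_ ?_)
      (mul_nonneg (sqrtWeight_nonneg _ _) (sqrtWeight_nonneg _ _))
    · rw [abs_lt]; constructor <;> linarith [hx.1, hx.2]
    · rw [abs_lt]; constructor <;> linarith [hx.1, hx.2]
  · refine le_add_of_nonneg_of_le (mul_nonneg (sqrtWeight_nonneg _ _) (sqrtWeight_nonneg _ _)) ?_
    have e : x - y = (x - L) - (y - L) := by ring
    rw [e]
    refine inv_abs_sub_le_sqrtWeight (by nlinarith [hx.2]) ?_ ?_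
    · rw [abs_lt]; constructor <;> linarith [hx.1, hx.2]
    · rw [abs_lt]; constructor <;> linarith [hx.1, hx.2]

/-- Inside the interval the Lipschitz bound beats the kernel. Across an endpoint the jump is at most
one and the product weights centred at `0` and `L` take over; the endpoints themselves form a null
set. -/
theorem kernelEnergy_indicator_lt_top {L K : ℝ} {T : ℝ → ℝ}
    (hT : ∀ x y, |T x - T y| ≤ K * |x - y|) (hTb : ∀ x, |T x| ≤ 1) (hTm : Measurable T) :
    kernelEnergy (nearKernel 1) ((Icc 0 L).indicator T) < ⊤ := by
  set φ := (Icc 0 L).indicator T with hφ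
  have hφm : Measurable φ := hTm.indicator measurableSet_Icc
  set q := sqrtWeight (L + 2) with hq
  have hqi : Integrable q := integrable_sqrtWeight _
  set χ : ℝ → ℝ := (Icc 0 L).indicator 1 with hχ
  have hχi : Integrable χ := by
    rw [hχ, integrable_indicator_iff measurableSet_Icc]
    exact integrableOn_const (C := (1 : ℝ)) (by simp)
  have hχ0 : ∀ x, 0 ≤ χ x := fun x => indicator_nonneg (fun _ _ => zero_le_one) x
  have hq0 : ∀ x, 0 ≤ q x := sqrtWeight_nonneg _
  set B : ℝ × ℝ → ℝ := fun p => K ^ 2 * (χ p.1 * χ p.2) +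
    (q p.1 * q p.2 + q (p.1 - L) * q (p.2 - L)) with hB
  have hBi : Integrable B := ((hχi.mul_prod hχi).const_mul _).add ((hqi.mul_prod hqi).add
    ((hqi.comp_sub_right L).mul_prod (hqi.comp_sub_right L)))
  have hne : ∀ᵐ x : ℝ, x ≠ 0 ∧ x ≠ L :=
    (Measure.ae_ne volume 0).and (Measure.ae_ne volume L)
  rw [kernelEnergy_eq_lintegral_prod (measurable_nearKernel 1) hφm]
  refine lt_of_le_of_lt (lintegral_mono_ae (g := fun p => ENNReal.ofReal (B p)) ?_)
    hBi.lintegral_lt_top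
  filter_upwards [ae_fst hne, ae_snd hne] with p hp1 hp2
  obtain ⟨x, y⟩ := p
  simp only at hp1 hp2 ⊢
  by_cases h1 : |x - y| < 1
  swap
  · rw [nearKernel, if_neg h1, mul_zero]
    exact zero_le
  rw [nearKernel, if_pos h1, enorm_sq_eq_ofReal, ← ENNReal.ofReal_mul (sq_nonneg _)]
  refine ENNReal.ofReal_le_ofReal ?_
  have hint : ∀ z, z ≠ 0 ∧ z ≠ L → z ∈ Icc 0 L → z ∈ Ioo 0 L := fun z hz hz' =>
    ⟨lt_of_le_of_ne hz'.1 hz.1.symm, lt_of_le_of_ne hz'.2 hz.2⟩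
  have hjump : ∀ z, T z ^ 2 ≤ 1 := fun z => by
    rw [← sq_abs]
    exact pow_le_one₀ (abs_nonneg _) (hTb z)
  have hA : 0 ≤ K ^ 2 * (χ x * χ y) := mul_nonneg (sq_nonneg _) (mul_nonneg (hχ0 x) (hχ0 y))
  have hQ : 0 ≤ q x * q y + q (x - L) * q (y - L) :=
    add_nonneg (mul_nonneg (hq0 _) (hq0 _)) (mul_nonneg (hq0 _) (hq0 _))
  by_cases hx : x ∈ Icc 0 L <;> by_cases hy : y ∈ Icc 0 L
  · have e1 : χ x = 1 := indicator_of_mem hx _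
    have e2 : χ y = 1 := indicator_of_mem hy _
    have e3 : φ x = T x := indicator_of_mem hx _
    have e4 : φ y = T y := indicator_of_mem hy _
    refine le_add_of_le_of_nonneg ?_ hQ
    rw [e1, e2, e3, e4, mul_one, mul_one, ← div_eq_mul_inv]
    refine div_le_of_le_mul₀ (abs_nonneg _) (sq_nonneg _) ?_
    have h2 : (T x - T y) ^ 2 ≤ (K * |x - y|) ^ 2 := by
      rw [← sq_abs]
      gcongr
      exact hT x y
    have h3 : |x - y| ^ 2 ≤ |x - y| := by
      rw [sq]
      exact mul_le_of_le_one_left (abs_nonneg _) h1.le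
    nlinarith [sq_nonneg K]
  · have e3 : φ x = T x := indicator_of_mem hx _
    have e4 : φ y = 0 := indicator_of_notMem hy _
    refine le_add_of_nonneg_of_le hA ?_
    rw [e3, e4, sub_zero]
    exact (mul_le_of_le_one_left (by positivity) (hjump x)).trans
      (inv_abs_sub_le_of_mem_of_notMem (hint x hp1 hx) hy h1)
  · have e3 : φ x = 0 := indicator_of_notMem hx _
    have e4 : φ y = T y := indicator_of_mem hy _
    refine le_add_of_nonneg_of_le hA ?_
    rw [e3, e4, zero_sub, neg_sq, abs_sub_comm, mul_comm (q x), mul_comm (q (x - L))]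
    rw [abs_sub_comm] at h1
    exact (mul_le_of_le_one_left (by positivity) (hjump y)).trans
      (inv_abs_sub_le_of_mem_of_notMem (hint y hp2 hy) hx h1)
  · have e3 : φ x = 0 := indicator_of_notMem hx _
    have e4 : φ y = 0 := indicator_of_notMem hy _
    rw [e3, e4, sub_zero, zero_pow two_ne_zero, zero_mul]
    exact add_nonneg hA hQ

/-! ### The nodal basis -/

/-- The hat function of height one at `i h`. -/
noncomputable def hat (h : ℝ) (i : ℕ) (x : ℝ) : ℝ := max 0 (1 - |x - i * h| / h)

section Hat

variable {h : ℝ}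

theorem hat_lipschitz (hh : 0 < h) (i : ℕ) (x y : ℝ) : |hat h i x - hat h i y| ≤ h⁻¹ * |x - y| := by
  rw [hat, hat]
  refine (abs_max_sub_max_le_max (0 : ℝ) _ 0 _).trans ?_
  rw [sub_self, abs_zero, max_eq_right (abs_nonneg _)]
  have e : 1 - |x - i * h| / h - (1 - |y - i * h| / h) = h⁻¹ * (|y - i * h| - |x - i * h|) := by
    ring
  rw [e, abs_mul, abs_of_pos (inv_pos.2 hh)]
  refine mul_le_mul_of_nonneg_left ?_ (inv_nonneg.2 hh.le)
  refine (abs_abs_sub_abs_le (y - i * h) (x - i * h)).trans_eq ?_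
  rw [sub_sub_sub_cancel_right, abs_sub_comm]

theorem continuous_hat (h : ℝ) (i : ℕ) : Continuous (hat h i) := by
  unfold hat
  fun_prop

theorem abs_hat_le (hh : 0 < h) (i : ℕ) (x : ℝ) : |hat h i x| ≤ 1 := by
  rw [hat, abs_of_nonneg (le_max_left _ _)]
  have : 0 ≤ |x - i * h| / h := by positivity
  exact max_le zero_le_one (by linarith)

theorem hat_eq (hh : 0 < h) {m : ℕ} {x : ℝ} (hx : x ∈ Icc (m * h) ((m + 1) * h)) (i : ℕ) :
    hat h i x = if i = m then 1 - (x / h - m) else if i = m + 1 then x / h - m else 0 := by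
  have e : |x - i * h| / h = |x / h - i| := by
    rw [← abs_of_pos hh, ← abs_div, abs_of_pos hh, sub_div, mul_div_cancel_right₀ _ hh.ne']
  have h1 : (m : ℝ) ≤ x / h := (le_div_iff₀ hh).2 hx.1
  have h2 : x / h ≤ m + 1 := (div_le_iff₀ hh).2 hx.2
  rw [hat, e]
  split_ifs with h3 h4
  · rw [h3, abs_of_nonneg (by linarith), max_eq_right (by linarith)]
  · rw [h4]
    push_cast
    rw [abs_of_nonpos (by linarith), max_eq_right (by linarith)]
    ring
  · refine max_eq_left ?_
    rcases lt_or_gt_of_ne h3 with h5 | h5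
    · have : (i : ℝ) + 1 ≤ m := by exact_mod_cast h5
      rw [abs_of_nonneg (by linarith)]
      linarith
    · have : (m : ℝ) + 2 ≤ i := by
        have : m + 2 ≤ i := by omega
        exact_mod_cast this
      rw [abs_of_nonpos (by linarith)]
      linarith

end Hat

theorem shapeFunction_eq (L : ℝ) (N : ℕ) (i : Fin (N + 2)) :
    shapeFunction L N i = (Icc 0 L).indicator (hat (meshSize L N) i) := rfl

theorem cell_subset {L : ℝ} (hL : 0 < L) {N m : ℕ} (hm : m ≤ N) :
    Icc (m * meshSize L N) ((m + 1) * meshSize L N) ⊆ Icc 0 L := by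
  have hh := meshSize_pos hL N
  refine Icc_subset_Icc (by positivity) ?_
  have h1 : (m : ℝ) ≤ N := by exact_mod_cast hm
  have h2 : ((m : ℝ) + 1) * meshSize L N ≤ (N + 1) * meshSize L N := by gcongr
  rwa [succ_mul_meshSize] at h2

theorem memLp_shapeFunction {L : ℝ} (N : ℕ) (i : Fin (N + 2)) :
    MemLp (shapeFunction L N i) 2 volume := by
  rw [shapeFunction_eq, memLp_indicator_iff_restrict measurableSet_Icc]
  obtain ⟨C, hC⟩ := (isCompact_Icc (a := 0) (b := L)).exists_bound_of_continuousOn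
    (continuous_hat (meshSize L N) i).continuousOn
  exact MemLp.of_bound (continuous_hat _ _).aestronglyMeasurable C
    ((ae_restrict_iff' measurableSet_Icc).2 (Eventually.of_forall hC))

/-- The shape functions as elements of `L²`. -/
noncomputable def shapeLp (L : ℝ) (N : ℕ) (i : Fin (N + 2)) : Lp ℝ 2 (volume : Measure ℝ) :=
  (memLp_shapeFunction (L := L) N i).toLp

theorem coeFn_shapeLp (L : ℝ) (N : ℕ) (i : Fin (N + 2)) :
    shapeLp L N i =ᵐ[volume] shapeFunction L N i :=
  (memLp_shapeFunction N i).coeFn_toLp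

theorem shapeLp_mem_energySpace {L : ℝ} (hL : 0 < L) (N : ℕ) (i : Fin (N + 2)) :
    shapeLp L N i ∈ energySpace L := by
  have hh := meshSize_pos hL N
  refine mem_energySpace_iff.2 ⟨?_, ?_⟩
  · filter_upwards [coeFn_shapeLp L N i, Measure.ae_ne volume 0, Measure.ae_ne volume L] with x h1
      h2 h3 hx
    rw [h1, shapeFunction_eq]
    exact indicator_of_notMem (fun hc => hx ⟨lt_of_le_of_ne hc.1 h2.symm, lt_of_le_of_ne hc.2 h3⟩) _
  · rw [kernelEnergy_congr (coeFn_shapeLp L N i), shapeFunction_eq]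
    exact kernelEnergy_indicator_lt_top (hat_lipschitz hh i) (abs_hat_le hh i)
      (continuous_hat _ _).measurable

/-- Only the hats at the two ends of a cell are nonzero on it. Indexing coefficients by `ℕ` avoids
arithmetic in `Fin`. -/
theorem sum_shapeFunction {L : ℝ} (hL : 0 < L) {N m : ℕ} (hm : m ≤ N) (c : ℕ → ℝ) {x : ℝ}
    (hx : x ∈ Icc (m * meshSize L N) ((m + 1) * meshSize L N)) :
    ∑ i : Fin (N + 2), c i * shapeFunction L N i x =
      c m * (1 - (x / meshSize L N - m)) + c (m + 1) * (x / meshSize L N - m) := by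
  have hh := meshSize_pos hL N
  have hval : ∀ i : Fin (N + 2), c i * shapeFunction L N i x = c i * (if (i : ℕ) = m then
      1 - (x / meshSize L N - m) else if (i : ℕ) = m + 1 then x / meshSize L N - m else 0) := by
    intro i
    rw [shapeFunction_eq, indicator_of_mem (cell_subset hL hm hx), hat_eq hh hx]
  rw [Fintype.sum_congr _ _ hval, Fintype.sum_eq_add (⟨m, by omega⟩ : Fin (N + 2))
    ⟨m + 1, by omega⟩ (by simp)]
  · simp
  · rintro i ⟨h1, h2⟩
    rw [if_neg fun hc => h1 (Fin.ext hc), if_neg fun hc => h2 (Fin.ext hc), mul_zero]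

theorem coeFn_sum_shapeLp (L : ℝ) (N : ℕ) (c : Fin (N + 2) → ℝ) :
    (∑ i, c i • shapeLp L N i : Lp ℝ 2 (volume : Measure ℝ)) =ᵐ[volume]
      fun x => ∑ i, c i * shapeFunction L N i x := by
  have h1 : ∀ᵐ x : ℝ, ∀ i, shapeLp L N i x = shapeFunction L N i x :=
    ae_all_iff.2 fun i => coeFn_shapeLp L N i
  have h2 : ∀ᵐ x : ℝ, ∀ i, (c i • shapeLp L N i : Lp ℝ 2 (volume : Measure ℝ)) x =
      c i * shapeLp L N i x := ae_all_iff.2 fun i => Lp.coeFn_smul (c i) (shapeLp L N i)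
  filter_upwards [Lp.coeFn_finsetSum Finset.univ fun i => c i • shapeLp L N i, h1, h2] with x e1 e2
    e3
  rw [e1, Finset.sum_apply]
  exact Finset.sum_congr rfl fun i _ => by rw [e3, e2]

/-- By continuity, a combination that vanishes almost everywhere vanishes on all of `[0,L]`, in
particular at the nodes, where its values are the coefficients. -/
theorem linearIndependent_shapeLp {L : ℝ} (hL : 0 < L) (N : ℕ) :
    LinearIndependent ℝ (shapeLp L N) := by
  have hh := meshSize_pos hL N
  rw [Fintype.linearIndependent_iff]
  intro c hc i
  let c' : ℕ → ℝ := fun j => if hj : j < N + 2 then c ⟨j, hj⟩ else 0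
  have hcc : ∀ j : Fin (N + 2), c' j = c j := fun j => dif_pos j.2
  have h1 : (fun x => ∑ j, c j * shapeFunction L N j x) =ᵐ[volume] fun _ => 0 := by
    refine (coeFn_sum_shapeLp L N c).symm.trans ?_
    rw [hc]
    exact Lp.coeFn_zero ℝ 2 volume
  have hcont : ContinuousOn (fun x => ∑ j, c j * shapeFunction L N j x) (Icc 0 L) := by
    have : Continuous fun x => ∑ j : Fin (N + 2), c j * hat (meshSize L N) j x :=
      continuous_finsetSum _ fun j _ => continuous_const.mul (continuous_hat _ _)
    refine this.continuousOn.congr fun x hx => ?_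
    exact Finset.sum_congr rfl fun j _ => by rw [shapeFunction_eq, indicator_of_mem hx]
  have h2 := Measure.eqOn_Icc_of_ae_eq volume hL.ne (ae_restrict_of_ae h1) hcont continuousOn_const
  have h3 : ∀ m ≤ N, ∀ x ∈ Icc (m * meshSize L N) ((m + 1) * meshSize L N),
      c' m * (1 - (x / meshSize L N - m)) + c' (m + 1) * (x / meshSize L N - m) = 0 := by
    intro m hm x hx
    rw [← sum_shapeFunction hL hm c' hx]
    simp only [hcc]
    exact h2 (cell_subset hL hm hx)
  rw [← hcc]
  -- The last node starts no cell, so it is read off as the right end of cell `N`.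
  rcases Nat.lt_or_ge N i with hi | hi
  · have hiN : (i : ℕ) = N + 1 := by omega
    have := h3 N le_rfl ((N + 1) * meshSize L N) ⟨by nlinarith, le_rfl⟩
    rw [mul_div_cancel_right₀ _ hh.ne'] at this
    rw [hiN]
    simpa using this
  · have := h3 i hi (i * meshSize L N) ⟨le_rfl, by nlinarith⟩
    rw [mul_div_cancel_right₀ _ hh.ne'] at this
    simpa using this

theorem shapeLp_mem_discreteSpace {L : ℝ} (hL : 0 < L) (N : ℕ) (i : Fin (N + 2)) :
    shapeLp L N i ∈ discreteSpace L N := by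
  have hh := meshSize_pos hL N
  -- The half hats equal one at an endpoint, where `IsFEFunction` asks for zero, so the
  -- representative is cut off to the open interval.
  refine ⟨(Ioo 0 L).indicator (hat (meshSize L N) i), ⟨?_, fun x hx => indicator_of_notMem hx _,
    fun m hm => ?_⟩, ?_⟩
  · exact (continuous_hat _ _).continuousOn.congr fun x hx => indicator_of_mem hx _
  · have hmN : m ≤ N := Nat.lt_succ_iff.1 (Finset.mem_range.1 hm)
    have hval : ∀ x ∈ Ioo (m * meshSize L N) ((m + 1) * meshSize L N),
        (Ioo 0 L).indicator (hat (meshSize L N) i) x = if (i : ℕ) = m then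
          1 - (x / meshSize L N - m) else if (i : ℕ) = m + 1 then x / meshSize L N - m else 0 := by
      intro x hx
      have h0 : (0 : ℝ) ≤ m * meshSize L N := by positivity
      have h1 := (cell_subset hL hmN ⟨by nlinarith, le_rfl⟩ : ((m : ℝ) + 1) * meshSize L N ∈ _).2
      rw [indicator_of_mem (show x ∈ Ioo 0 L from ⟨h0.trans_lt hx.1, hx.2.trans_le h1⟩), hat_eq hh ⟨hx.1.le, hx.2.le⟩]
    by_cases h1 : (i : ℕ) = m
    · refine ⟨-(meshSize L N)⁻¹, 1 + m, fun x hx => ?_⟩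
      rw [hval x hx, if_pos h1]
      ring
    · by_cases h2 : (i : ℕ) = m + 1
      · refine ⟨(meshSize L N)⁻¹, -m, fun x hx => ?_⟩
        rw [hval x hx, if_neg h1, if_pos h2]
        ring
      · refine ⟨0, 0, fun x hx => ?_⟩
        rw [hval x hx, if_neg h1, if_neg h2]
        ring
  · filter_upwards [coeFn_shapeLp L N i, Measure.ae_ne volume 0, Measure.ae_ne volume L] with x h1
      h2 h3
    rw [h1, shapeFunction_eq]
    by_cases hx : x ∈ Icc 0 L
    · rw [indicator_of_mem hx, indicator_of_mem (show x ∈ Ioo 0 L from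
        ⟨lt_of_le_of_ne hx.1 h2.symm, lt_of_le_of_ne hx.2 h3⟩)]
    · rw [indicator_of_notMem hx, indicator_of_notMem fun hc => hx ⟨hc.1.le, hc.2.le⟩]

/-- Affine functions that agree with a function on either side of a point of continuity agree at
that point. -/
theorem affine_eq_at_node {v : ℝ → ℝ} {p q r a b a' b' : ℝ} (hpq : p < q) (hqr : q < r)
    (hv : ContinuousAt v q) (h1 : ∀ x ∈ Ioo p q, v x = a * x + b)
    (h2 : ∀ x ∈ Ioo q r, v x = a' * x + b') : a * q + b = a' * q + b' := by
  have l1 : Tendsto v (𝓝[<] q) (𝓝 (a * q + b)) := by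
    have : Tendsto (fun x => a * x + b) (𝓝[<] q) (𝓝 (a * q + b)) :=
      (Continuous.tendsto (by fun_prop) q).mono_left nhdsWithin_le_nhds
    refine this.congr' ?_
    filter_upwards [Ioo_mem_nhdsLT hpq] with x hx
    exact (h1 x hx).symm
  have l2 : Tendsto v (𝓝[>] q) (𝓝 (a' * q + b')) := by
    have : Tendsto (fun x => a' * x + b') (𝓝[>] q) (𝓝 (a' * q + b')) :=
      (Continuous.tendsto (by fun_prop) q).mono_left nhdsWithin_le_nhds
    refine this.congr' ?_
    filter_upwards [Ioo_mem_nhdsGT hqr] with x hx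
    exact (h2 x hx).symm
  rw [tendsto_nhds_unique l1 (hv.tendsto.mono_left nhdsWithin_le_nhds),
    tendsto_nhds_unique l2 (hv.tendsto.mono_left nhdsWithin_le_nhds)]

theorem span_shapeLp {L : ℝ} (hL : 0 < L) (N : ℕ) :
    Submodule.span ℝ (Set.range (shapeLp L N)) = discreteSpace L N := by
  have hh := meshSize_pos hL N
  have hNL := succ_mul_meshSize L N
  refine le_antisymm ?_ ?_
  · rw [Submodule.span_le]
    rintro _ ⟨i, rfl⟩
    exact shapeLp_mem_discreteSpace hL N i
  rintro u ⟨v, ⟨hvc, hv0, hva⟩, huv⟩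
  choose! a b hab using hva
  set h := meshSize L N with hhdef
  -- The coefficients are nodal values of the affine pieces: of the piece to the right, except at
  -- the last node. At `0` and `L` they are one-sided limits, as `v` itself is zero there.
  let c : ℕ → ℝ := fun j => if j ≤ N then a j * (j * h) + b j else a N * L + b N
  have hleft : ∀ m ≤ N, c m = a m * (m * h) + b m := fun m hm => if_pos hm
  have hright : ∀ m ≤ N, c (m + 1) = a m * ((m + 1) * h) + b m := by
    intro m hm
    rcases hm.eq_or_lt with rfl | hlt
    · have : c (m + 1) = a m * L + b m := if_neg (by omega)
      rw [this, hNL]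
    · rw [hleft (m + 1) hlt]
      push_cast
      have hq : ((m : ℝ) + 1) * h ∈ Ioo 0 L := by
        have : (m : ℝ) + 1 ≤ N := by exact_mod_cast hlt
        exact ⟨by positivity, by rw [← hNL]; nlinarith⟩
      have h1 := hab m (Finset.mem_range.2 (by omega))
      have h2 := hab (m + 1) (Finset.mem_range.2 (by omega))
      push_cast at h2
      exact (affine_eq_at_node (by nlinarith) (by nlinarith)
        (hvc.continuousAt (isOpen_Ioo.mem_nhds hq)) h1 h2).symm
  have hu : u = ∑ i : Fin (N + 2), c i • shapeLp L N i := by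
    refine Lp.ext (huv.trans ?_)
    have hnodes : ∀ᵐ x : ℝ, ∀ m : ℕ, x ≠ m * h := ae_all_iff.2 fun m => Measure.ae_ne volume _
    filter_upwards [coeFn_sum_shapeLp L N fun i => c i, hnodes] with x e1 e2
    rw [e1]
    by_cases hx : x ∈ Ioo 0 L
    · set m := ⌊x / h⌋₊ with hm
      have hx0 : 0 ≤ x / h := div_nonneg hx.1.le hh.le
      have h1 : (m : ℝ) * h < x :=
        lt_of_le_of_ne ((le_div_iff₀ hh).1 (Nat.floor_le hx0)) (e2 m).symm
      have h2 : x < (m + 1) * h := (div_lt_iff₀ hh).1 (Nat.lt_floor_add_one _)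
      have hmN : m ≤ N := by
        have : (m : ℝ) < N + 1 := by
          refine lt_of_mul_lt_mul_right ?_ hh.le
          rw [hNL]
          exact h1.trans hx.2
        exact Nat.lt_succ_iff.1 (by exact_mod_cast this)
      rw [sum_shapeFunction hL hmN c ⟨h1.le, h2.le⟩, hleft m hmN, hright m hmN,
        hab m (Finset.mem_range.2 (by omega)) x ⟨h1, h2⟩, ← hhdef]
      field_simp
      ring
    · rw [hv0 x hx]
      symm
      refine Finset.sum_eq_zero fun i _ => ?_
      have hx0 := e2 0
      have hxL := e2 (N + 1)
      push_cast at hx0 hxL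
      rw [hNL] at hxL
      rw [zero_mul] at hx0
      rw [shapeFunction_eq, indicator_of_notMem, mul_zero]
      exact fun hc => hx ⟨lt_of_le_of_ne hc.1 hx0.symm, lt_of_le_of_ne hc.2 hxL⟩
  rw [hu]
  exact Submodule.sum_mem _ fun i _ => Submodule.smul_mem _ _ (Submodule.subset_span ⟨i, rfl⟩)

theorem finrank_discreteSpace {L : ℝ} (hL : 0 < L) (N : ℕ) :
    Module.finrank ℝ (discreteSpace L N) = N + 2 := by
  rw [← span_shapeLp hL N, finrank_span_eq_card (linearIndependent_shapeLp hL N), Fintype.card_fin]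

theorem discreteSpace_le_energySpace {L : ℝ} (hL : 0 < L) (N : ℕ) :
    discreteSpace L N ≤ energySpace L := by
  rw [← span_shapeLp hL N, Submodule.span_le]
  rintro _ ⟨i, rfl⟩
  exact shapeLp_mem_energySpace hL N i

/-! ### The Dirichlet eigenvalues and their approximation -/

/-- Successive minimisers of the form of the logarithmic Laplacian on the energy space. -/
theorem exists_minimizing_seq_energyL {L : ℝ} (hL : 0 < L) :
    ∃ e : ℕ → Lp ℝ 2 (volume : Measure ℝ),
      ∀ k, IsMinimizingAt (fun u v : Lp ℝ 2 (volume : Measure ℝ) => energyL u v)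
        (energySpace L) e k := by
  obtain ⟨e, he⟩ := exists_minimizing_seq (d := ⊤)
    (a := fun u v : Lp ℝ 2 (volume : Measure ℝ) => energyL u v) (W := energySpace L)
    fun k _ f => exists_minimizer_energyL L k f <| by
      -- The energy space contains discrete spaces of dimension `k + 2`, so `k` constraints never
      -- exhaust it.
      obtain ⟨u, hu, h⟩ := exists_unit_orthogonal (M := discreteSpace L k) (k := k)
        (by rw [finrank_discreteSpace hL]; omega) f
      exact ⟨u, discreteSpace_le_energySpace hL k hu, h⟩
  exact ⟨e, fun k => he k (ENat.natCast_lt_top k)⟩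

theorem isDirichletEigenvalueSequence_of_minimizing {L : ℝ} {e : ℕ → Lp ℝ 2 (volume : Measure ℝ)}
    (he : ∀ k, IsMinimizingAt (fun u v : Lp ℝ 2 (volume : Measure ℝ) => energyL u v)
      (energySpace L) e k) :
    IsDirichletEigenvalueSequence L fun k => energyL (e k) (e k) := by
  have he' : ∀ k : ℕ, (k : ℕ∞) < ⊤ → IsMinimizingAt
      (fun u v : Lp ℝ 2 (volume : Measure ℝ) => energyL u v) (energySpace L) e k := fun k _ => he k
  refine ⟨fun i j hij => IsMinimizingAt.apply_self_mono he' hij (ENat.natCast_lt_top j),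
    fun μ => ?_⟩
  refine eigenspace_finrank_eq (symmFormOn_energyL L) he
    (tendsto_apply_self_atTop (a := fun u v : Lp ℝ 2 (volume : Measure ℝ) => energyL u v) he
      (totallyBounded_energyL L)) μ (eigenspace L μ) fun u => ?_
  simp only [inner_eq_integral]
  rfl

/-- Convergence can thus be proved for the energies of the minimisers and holds for any enumeration
of the eigenvalues. -/
theorem IsDirichletEigenvalueSequence.unique {L : ℝ} {lam lam' : ℕ → ℝ}
    (h : IsDirichletEigenvalueSequence L lam) (h' : IsDirichletEigenvalueSequence L lam') :
    lam = lam' := by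
  refine eq_of_encard_fiber_eq h.1 h'.1 (fun c => ?_) fun c => by rw [(h.2 c).2, (h'.2 c).2]
  rw [← Set.encard_lt_top_iff, (h.2 c).2]
  exact ENat.natCast_lt_top _

/-- Elements of the energy space are limits of finite element functions. -/
theorem exists_discrete_seq {L : ℝ} (hL : 0 < L) {u : Lp ℝ 2 (volume : Measure ℝ)}
    (hu : u ∈ energySpace L) : ∃ w : ℕ → Lp ℝ 2 (volume : Measure ℝ),
      (∀ N, w N ∈ discreteSpace L N) ∧ Tendsto (fun N => ‖u - w N‖) atTop (𝓝 0) ∧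
      Tendsto (fun N => energyL (u - w N : Lp ℝ 2 (volume : Measure ℝ))
        (u - w N : Lp ℝ 2 (volume : Measure ℝ))) atTop (𝓝 0) := by
  obtain ⟨B, hB0, hB⟩ := exists_lowerOrder_le L
  set D : Lp ℝ 2 (volume : Measure ℝ) → ℝ := fun w =>
    ‖u - w‖ ^ 2 + energy (u - w : Lp ℝ 2 (volume : Measure ℝ))
      (u - w : Lp ℝ 2 (volume : Measure ℝ)) with hD
  have hD0 : ∀ w, 0 ≤ D w := fun w => add_nonneg (sq_nonneg _) (energy_self_nonneg _)
  have hDsmall : ∀ ε > 0, ∀ᶠ N in atTop, ∃ w ∈ discreteSpace L N, D w ≤ ε := by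
    intro ε hε
    filter_upwards [eventually_exists_discrete_approx hL hu (half_pos hε)] with N hN
    obtain ⟨w, hw, h1, h2⟩ := hN
    refine ⟨w, hw, ?_⟩
    have e1 : ‖u - w‖ ^ 2 ≤ ε / 2 := by
      rw [Lp.norm_def, ← ENNReal.toReal_pow, eLpNorm_two_sq]
      exact ENNReal.toReal_le_of_le_ofReal (by positivity) h1
    have e2 := ENNReal.toReal_le_of_le_ofReal (by positivity) h2
    simp only [hD]
    rw [energy_self_eq (Lp_measurable _)]
    linarith
  -- Approximants are available for each `ε` only from some `N` on. Near-minimisers of the distance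
  -- `D` give one sequence for all `ε`.
  have hchoose : ∀ N : ℕ, ∃ w ∈ discreteSpace L N,
      D w ≤ sInf (D '' (discreteSpace L N : Set (Lp ℝ 2 (volume : Measure ℝ)))) +
        1 / ((N : ℝ) + 1) := by
    intro N
    obtain ⟨_, ⟨w, hw, rfl⟩, hlt⟩ := exists_lt_of_csInf_lt
      (Set.Nonempty.image D (s := (discreteSpace L N : Set (Lp ℝ 2 (volume : Measure ℝ))))
        ⟨0, (discreteSpace L N).zero_mem⟩)
      (lt_add_of_pos_right _ (by positivity : (0 : ℝ) < 1 / ((N : ℝ) + 1)))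
    exact ⟨w, hw, hlt.le⟩
  choose w hw hwD using hchoose
  have hlim : Tendsto (fun N => D (w N)) atTop (𝓝 0) := by
    refine tendsto_order.2 ⟨fun c hc => Eventually.of_forall fun N => hc.trans_le (hD0 _),
      fun c hc => ?_⟩
    filter_upwards [hDsmall (c / 3) (by positivity),
      tendsto_one_div_add_atTop_nhds_zero_nat.eventually_lt_const (by positivity : 0 < c / 3)]
      with N hN1 hN2
    obtain ⟨w', hw', hle⟩ := hN1
    have h1 : sInf (D '' (discreteSpace L N : Set (Lp ℝ 2 (volume : Measure ℝ)))) ≤ D w' :=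
      csInf_le ⟨0, by rintro _ ⟨x, -, rfl⟩; exact hD0 x⟩ ⟨w', hw', rfl⟩
    have := hwD N
    linarith
  have hn2 : Tendsto (fun N => ‖u - w N‖ ^ 2) atTop (𝓝 0) :=
    squeeze_zero (fun N => sq_nonneg _)
      (fun N => le_add_of_nonneg_right (energy_self_nonneg _)) hlim
  have hn : Tendsto (fun N => ‖u - w N‖) atTop (𝓝 0) := by
    have := hn2.sqrt
    simpa [Real.sqrt_sq (norm_nonneg _)] using this
  refine ⟨w, hw, hn, ?_⟩
  have hE : Tendsto (fun N => energy (u - w N : Lp ℝ 2 (volume : Measure ℝ))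
      (u - w N : Lp ℝ 2 (volume : Measure ℝ))) atTop (𝓝 0) :=
    squeeze_zero (fun N => energy_self_nonneg _)
      (fun N => le_add_of_nonneg_left (sq_nonneg _)) hlim
  have hlow : Tendsto (fun N => lowerOrder (u - w N : Lp ℝ 2 (volume : Measure ℝ))
      (u - w N : Lp ℝ 2 (volume : Measure ℝ))) atTop (𝓝 0) := by
    have h0 : Tendsto (fun N => B * ‖u - w N‖ ^ 2) atTop (𝓝 0) := by
      simpa using hn2.const_mul B
    refine squeeze_zero_norm (fun N => ?_) h0
    have hd := (energySpace L).sub_mem hu (discreteSpace_le_energySpace hL N (hw N))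
    rw [Real.norm_eq_abs, sq]
    exact hB _ hd _ hd
  simpa [energyL] using hE.add hlow

/-- The discrete eigenvalues are the energies of successive minimisers in the finite element
space. -/
theorem exists_minimizing_seq_discrete {L : ℝ} (hL : 0 < L) (N : ℕ) :
    ∃ e : ℕ → Lp ℝ 2 (volume : Measure ℝ), (∀ k : ℕ, (k : ℕ∞) < ((N + 2 : ℕ) : ℕ∞) →
      IsMinimizingAt (fun u v : Lp ℝ 2 (volume : Measure ℝ) => energyL u v)
        (discreteSpace L N) e k) ∧
      ∀ k : ℕ, k < N + 2 → IsLeast (minimaxValues L N (k + 1)) (energyL (e k) (e k)) := by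
  have ha := (symmFormOn_energyL L).mono (discreteSpace_le_energySpace hL N)
  obtain ⟨e, he⟩ := exists_minimizing_seq (d := ((N + 2 : ℕ) : ℕ∞))
    (a := fun u v : Lp ℝ 2 (volume : Measure ℝ) => energyL u v) (W := discreteSpace L N)
    fun k hk f => (ha.exists_extremal (by
      rw [finrank_discreteSpace hL]
      exact_mod_cast hk) f).1
  exact ⟨e, he, fun k hk => isLeast_minimaxSet ha he (by exact_mod_cast hk)⟩

theorem posDef_massMatrix {L : ℝ} (hL : 0 < L) (N : ℕ) : (massMatrix L N).PosDef := by
  have h := Matrix.posDef_gram_of_linearIndependent (linearIndependent_shapeLp hL N)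
  suffices hM : massMatrix L N = Matrix.gram ℝ (shapeLp L N) by rwa [hM]
  ext i j
  rw [Matrix.gram_apply, inner_eq_integral]
  refine (integral_congr_ae ?_).symm
  filter_upwards [coeFn_shapeLp L N i, coeFn_shapeLp L N j] with x h1 h2
  rw [h1, h2]

end LogLap

/-! ### The main theorem. -/

theorem proposition7p2 (L : ℝ) (hL : 0 < L) :
    -- the Dirichlet eigenvalues `λ_1 ≤ λ_2 ≤ …` form a sequence
    (∃ lam : ℕ → ℝ, LogLap.IsDirichletEigenvalueSequence L lam) ∧
    -- `λ_{k+1,h} → λ_{k+1}` as `h = L / (N+1) → 0`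
    (∀ lam : ℕ → ℝ, LogLap.IsDirichletEigenvalueSequence L lam → ∀ k : ℕ,
      Tendsto (fun N : ℕ => LogLap.discreteEigenvalue L N (k + 1)) atTop (𝓝 (lam k))) ∧
    ∀ N : ℕ,
      -- the maxima and the infimum that define `λ_{k,h}` exist
      (∀ k : ℕ, 1 ≤ k → k ≤ N + 2 →
        (∀ M : Submodule ℝ (Lp ℝ 2 (volume : Measure ℝ)), M ≤ LogLap.discreteSpace L N →
          Module.finrank ℝ M = k → ∃ c : ℝ, IsGreatest (LogLap.energyValues M) c) ∧
        IsGLB (LogLap.minimaxValues L N k) (LogLap.discreteEigenvalue L N k)) ∧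
      -- `λ_{k,h}` is the `k`-th eigenvalue of the stiffness matrix, relative to the mass matrix
      LogLap.AreEigenvaluesRelativeTo (LogLap.stiffnessMatrix L N) (LogLap.massMatrix L N)
        (fun i : Fin (N + 2) => LogLap.discreteEigenvalue L N ((i : ℕ) + 1)) := by
  obtain ⟨e, he⟩ := LogLap.exists_minimizing_seq_energyL hL
  have hseq := LogLap.isDirichletEigenvalueSequence_of_minimizing he
  have hform := LogLap.symmFormOn_energyL L
  obtain ⟨C, hC⟩ := LogLap.exists_le_energyL L
  refine ⟨⟨_, hseq⟩, fun lam hlam k => ?_, fun N => ?_⟩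
  · rw [hlam.unique hseq]
    refine LogLap.tendsto_minimax hform hC he
      (fun N => LogLap.discreteSpace_le_energySpace hL N)
      (fun u hu => LogLap.exists_discrete_seq hL hu) ?_
    -- For `N ≥ k` the index `k + 1` is at most `N + 2`, so the minimax set is nonempty and `sInf`
    -- is not a default value.
    filter_upwards [eventually_ge_atTop k] with N hN
    obtain ⟨e', -, hleast⟩ := LogLap.exists_minimizing_seq_discrete hL N
    have := hleast k (by omega)
    exact ⟨isGLB_csInf ⟨_, this.1⟩ ⟨_, this.2⟩, ⟨_, this.1⟩⟩
  · obtain ⟨e', he', hleast⟩ := LogLap.exists_minimizing_seq_discrete hL N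
    have hVW := LogLap.discreteSpace_le_energySpace hL N
    have hdis : ∀ i : Fin (N + 2), LogLap.discreteEigenvalue L N ((i : ℕ) + 1) =
        LogLap.energyL (e' i) (e' i) := fun i => (hleast i i.2).csInf_eq
    refine ⟨fun k hk1 hk2 => ⟨fun M hM hMk => ?_, ?_⟩, LogLap.posDef_massMatrix hL N, ?_, ?_⟩
    · exact LogLap.exists_isGreatest_sphereValues (hform.mono hVW) hM (by omega)
    · obtain ⟨j, rfl⟩ := Nat.exists_eq_add_of_le' hk1
      have := hleast j (by omega)
      exact isGLB_csInf ⟨_, this.1⟩ ⟨_, this.2⟩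
    · intro i j hij
      simp only [hdis]
      exact LogLap.IsMinimizingAt.apply_self_mono he' hij (by exact_mod_cast j.2)
    · intro t
      simp only [hdis]
      refine LogLap.det_smul_gram_sub (hform.mono hVW) he' (LogLap.span_shapeLp hL N)
        (fun i j => ?_) (fun i j => ?_) t
      · exact LogLap.energyL_congr (LogLap.coeFn_shapeLp L N i).symm
          (LogLap.coeFn_shapeLp L N j).symm
      · rw [LogLap.inner_eq_integral]
        refine (integral_congr_ae ?_).symm
        filter_upwards [LogLap.coeFn_shapeLp L N i, LogLap.coeFn_shapeLp L N j] with x h1 h2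
        rw [h1, h2]
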